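/- **Theorem 4.1.** Let $A=(a_{ij})_{i,j\in I}$ be an affine Cartan matrix, i.e. $I$ is finite and nonempty and $A$ is an indecomposable symmetrizable generalized Cartan matrix for which there is a vector $u$ with positive entries and $Au=0$. Let $a_i$ (resp. $a_i^\vee$) be the numerical labels of $A$ (resp. of $A^{T}$): the coprime positive integers with $\sum_j a_{ij}a_j=0$ for all $i$ (resp. $\sum_j a_{ji}a^\vee_j=0$ for all $i$). Put $d_i=a_i^\vee/a_i$. Let $q\in\mathbb C^\times$ be not a root of unity, fix $\hbar\in\mathbb C$ with $e^{\hbar}=q$, write $q^s=e^{s\hbar}$ for $s\in\mathbb Q$, and put $q_i=q^{d_i}$. Let $\mathcal A=\mathbb C[x_i^{\pm1},\,i\in I]$, let $\zeta_i$ be the algebra automorphism of $\mathcal A$ with $\zeta_i(x_j)=q_i^{-\delta_{ij}}x_j$, put $y_i=\prod_{j\in I}x_j^{a_{ji}}$, and for a unit $u$ of $\mathcal A$ put $\{u\}_i=\dfrac{u-u^{-1}}{q_i-q_i^{-1}}$. Consider the system, for $(\phi_i)_{i\in I}\in\mathcal A^I$, $$\zeta_i(\phi_i)-\phi_i=\{y_i\}_i\quad(i\in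 I),\qquad \phi_i\phi_j=\zeta_j^{-1}(\phi_i)\,\zeta_i^{-1}(\phi_j)\quad(i,j\in I,\ i\ne j).\tag{4.1}$$ The system (4.1) has a solution if and only if, for some $n$ and some numbering of $I$ by $0,1,\dots,n$, the matrix $A$ is one of the following; here $a_{ii}=2$, all off-diagonal entries not mentioned are $-1$ if $|i-j|=1$ and $0$ otherwise. * $A_n^{(1)}$ ($n\ge1$): for $n=1$, $a_{01}=a_{10}=-2$; for $n\ge2$, $a_{0n}=a_{n0}=-1$. * $C_n^{(1)}$ ($n\ge2$): $a_{10}=a_{n-1,n}=-2$. * $A_{2n}^{(2)}$ ($n\ge1$): for $n=1$, $a_{01}=-1$, $a_{10}=-4$; for $n\ge2$, $a_{10}=a_{n,n-1}=-2$. * $D_{n+1}^{(2)}$ ($n\ge2$): $a_{01}=a_{n,n-1}=-2$. Moreover, for every such numbering, all solutions of (4.1) are the following, with $\imath=\sqrt{-1}$. * $A_n^{(1)}$: $\phi_i=\{qbz_i\}_i\{bz_{i+1}\}_i$ for $0\le i\le n$ (with $z_{n+1}=z_0$), with $b\in\mathbb C^\times$ arbitrary, where $z_i=x_{i-1}^{-1}x_i$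 for $1\le i\le n$ and $z_0=(z_1\cdots z_n)^{-1}$. * $C_n^{(1)}$: $\phi_0=\{q_0bz_1^{-1}\}_0\{bz_1\}_0$, $\phi_i=\{q_ibz_i\}_i\{bz_{i+1}\}_i$ for $0<i<n$, $\phi_n=\{q_nbz_n\}_n\{bz_n^{-1}\}_n$, with $b=q^{-1/4}$ or $b=\imath q^{-1/4}$, where $z_i=x_{i-1}^{-1}x_i$. * $A_{2n}^{(2)}$: $\phi_0=\{\imath q^{-3/2}z_1\}_0\{\imath q^{-1/2}z_1\}_0$, $\phi_i=\{\imath q^{1/2}z_i\}_i\{\imath q^{-1/2}z_{i+1}\}_i$ for $0<i<n$, $\phi_n=\frac{\imath}{q_n-q_n^{-1}}\{\imath q^{1/2}z_n\}_n$, where $z_i=x_{i-1}^{-1}x_i$ for $1\le i<n$ and $z_n=x_{n-1}^{-1}x_n^2$. * $D_{n+1}^{(2)}$: $\phi_0=\frac{\imath}{q_0-q_0^{-1}}\{\imath q^{-1}z_1\}_0$, $\phi_i=\{\imath qz_i\}_i\{\imath q^{-1}z_{i+1}\}_i$ for $0<i<n$, $\phi_n=\frac{\imath}{q_n-q_n^{-1}}\{\imath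 qz_n\}_n$, where $z_1=x_0^{-2}x_1$, $z_i=x_{i-1}^{-1}x_i$ for $1<i<n$ and $z_n=x_{n-1}^{-1}x_n^2$. -/

import Mathlib

open scoped Matrix

noncomputable section

namespace QShift

/-! ### Affine Cartan matrices -/

/-- Generalized Cartan matrices. -/
structure IsGCM {I : Type*} (A : Matrix I I ℤ) : Prop where
  diag : ∀ i, A i i = 2
  offDiag : ∀ i j, i ≠ j → A i j ≤ 0
  zero : ∀ i j, A i j = 0 → A j i = 0

/-- `A` is symmetrizable: `D * A` is symmetric for a positive diagonal matrix `D`. -/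
def IsSymmetrizable {I : Type*} (A : Matrix I I ℤ) : Prop :=
  ∃ d : I → ℚ, (∀ i, 0 < d i) ∧ ∀ i j, d i * A i j = d j * A j i

/-- `A` is indecomposable: its Dynkin diagram is connected. -/
def IsIndecomposable {I : Type*} (A : Matrix I I ℤ) : Prop :=
  ∀ S : Set I, S.Nonempty → Sᶜ.Nonempty → ∃ i ∈ S, ∃ j ∈ Sᶜ, A i j ≠ 0

/-- Affine Cartan matrices: (symmetrizable) indecomposable generalized Cartan matrices with a
strictly positive vector `u` such that `A u = 0`. -/
structure IsAffineCartan {I : Type*} [Fintype I] (A : Matrix I I ℤ) : Prop where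
  nonempty : Nonempty I
  gcm : IsGCM A
  symmetrizable : IsSymmetrizable A
  indecomposable : IsIndecomposable A
  null : ∃ u : I → ℝ, (∀ i, 0 < u i) ∧ A.map (Int.cast : ℤ → ℝ) *ᵥ u = 0

/-- `a` is the family of numerical labels of the Dynkin diagram of an affine Cartan matrix `A`:
the coprime positive integers with `∑ j, a_{ij} a_j = 0` for all `i`. The labels `a_i^∨` of the
dual diagram are the numerical labels of `Aᵀ`. -/
structure IsLabels {I : Type*} [Fintype I] (A : Matrix I I ℤ) (a : I → ℕ) : Prop where
  pos : ∀ i, 0 < a i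
  coprime : Finset.univ.gcd a = 1
  null : ∀ i, ∑ j, A i j * (a j : ℤ) = 0

/-! ### The Laurent polynomial ring and the shift operators -/

/-- The Laurent polynomial ring `ℂ[x_i^{±1}, i ∈ I]` (for finite `I`), as the group algebra of
the free abelian group `ℤ^I` of exponent vectors. -/
abbrev Laurent (I : Type*) : Type _ := AddMonoidAlgebra ℂ (I → ℤ)

section ring

variable {I : Type*}

/-- The monomial `∏ j, x_j ^ (v j)`, as a unit of the Laurent polynomial ring. -/
def mono (v : I → ℤ) : (Laurent I)ˣ where
  val := AddMonoidAlgebra.single v 1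
  inv := AddMonoidAlgebra.single (-v) 1
  val_inv := by simp [AddMonoidAlgebra.single_mul_single, AddMonoidAlgebra.one_def]
  inv_val := by simp [AddMonoidAlgebra.single_mul_single, AddMonoidAlgebra.one_def]

/-- The variable `x_i`. -/
def x [DecidableEq I] (i : I) : (Laurent I)ˣ := mono (Pi.single i 1)

/-- A nonzero scalar, as a unit of the Laurent polynomial ring. -/
def scal (c : ℂˣ) : (Laurent I)ˣ := Units.map (algebraMap ℂ (Laurent I)).toMonoidHom c

/-- The algebra endomorphism `x_i ↦ c x_i`, `x_j ↦ x_j` for `j ≠ i`. -/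
def scaleHom (i : I) (c : ℂˣ) : Laurent I →ₐ[ℂ] Laurent I :=
  AddMonoidAlgebra.lift ℂ (Laurent I) (I → ℤ)
    { toFun := fun v => AddMonoidAlgebra.single v.toAdd ((c ^ (v.toAdd i) : ℂˣ) : ℂ)
      map_one' := by simp [AddMonoidAlgebra.one_def]
      map_mul' := fun v w => by
        simp [AddMonoidAlgebra.single_mul_single, zpow_add] }

theorem scaleHom_single (i : I) (c : ℂˣ) (v : I → ℤ) (r : ℂ) :
    scaleHom i c (AddMonoidAlgebra.single v r) =
      AddMonoidAlgebra.single v (r * ((c ^ (v i) : ℂˣ) : ℂ)) := by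
  simp [scaleHom, AddMonoidAlgebra.lift_single, AddMonoidAlgebra.smul_single]

theorem scaleHom_comp_inv (i : I) (c : ℂˣ) :
    (scaleHom i c).comp (scaleHom i c⁻¹) = AlgHom.id ℂ (Laurent I) := by
  apply AddMonoidAlgebra.algHom_ext
  · intro v
    simp only [AlgHom.comp_apply, scaleHom_single, AlgHom.id_apply]
    congr 1
    rw [one_mul, ← Units.val_mul, ← mul_zpow, inv_mul_cancel, one_zpow, Units.val_one]
  · ext

/-- The algebra automorphism `x_i ↦ c x_i`, `x_j ↦ x_j` for `j ≠ i`. -/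
def scaleEquiv (i : I) (c : ℂˣ) : Laurent I ≃ₐ[ℂ] Laurent I :=
  AlgEquiv.ofAlgHom (scaleHom i c) (scaleHom i c⁻¹) (scaleHom_comp_inv i c)
    (by simpa using scaleHom_comp_inv i c⁻¹)

/-- The shift operator `ζ_i`, the algebra automorphism with `ζ_i(x_j) = q_i^{-δ_{ij}} x_j`,
where `Q i` is `q_i`. -/
def zeta (Q : I → ℂˣ) (i : I) : Laurent I ≃ₐ[ℂ] Laurent I := scaleEquiv i (Q i)⁻¹

theorem zeta_x [DecidableEq I] (Q : I → ℂˣ) (i j : I) :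
    zeta Q i (x j : Laurent I) = ((Q i : ℂ) ^ (if i = j then (-1 : ℤ) else 0)) • (x j : Laurent I) := by
  have h : zeta Q i (x j : Laurent I) = scaleHom i (Q i)⁻¹ (x j : Laurent I) := rfl
  rw [h]
  by_cases hij : i = j
  · subst hij
    simp [x, mono, scaleHom_single, AddMonoidAlgebra.smul_single]
  · simp [x, mono, scaleHom_single, hij]

/-- `{u}_c = (u - u⁻¹) / (c - c⁻¹)` for a unit `u`; thus `{u}_i` is `brace (Q i) u`. -/
def brace (c : ℂˣ) (u : (Laurent I)ˣ) : Laurent I :=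
  ((c : ℂ) - (c : ℂ)⁻¹)⁻¹ • ((u : Laurent I) - ((u⁻¹ : (Laurent I)ˣ) : Laurent I))

/-- `(f, g)` is `(i, j)`-shiftable: `f g = ζ_j⁻¹(f) ζ_i⁻¹(g)`. -/
def Shiftable (Q : I → ℂˣ) (i j : I) (f g : Laurent I) : Prop :=
  f * g = (zeta Q j).symm f * (zeta Q i).symm g

/-- `y_i = ∏ j, x_j ^ a_{ji}`. -/
def y [Fintype I] [DecidableEq I] (A : Matrix I I ℤ) (i : I) : (Laurent I)ˣ :=
  ∏ j, x j ^ A j i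

/-- The system of equations `ζ_i(φ_i) - φ_i = {y_i}_i`, and `(φ_i, φ_j)` is `(i, j)`-shiftable,
for all `i ≠ j` in `I`. -/
def IsSolution [Fintype I] [DecidableEq I] (A : Matrix I I ℤ) (Q : I → ℂˣ) (φ : I → Laurent I) :
    Prop :=
  (∀ i, zeta Q i (φ i) - φ i = brace (Q i) (y A i)) ∧
    ∀ i j, i ≠ j → Shiftable Q i j (φ i) (φ j)

end ring

/-! ### Powers of `q` -/

/-- The power `q^s` for rational `s`, where `q = e^ħ`. Fixing the logarithm `ħ` of `q` fixes the
roots of `q` in a compatible way. -/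
def qpow (ħ : ℂ) (s : ℚ) : ℂˣ := Units.mk0 (Complex.exp ((s : ℂ) * ħ)) (Complex.exp_ne_zero _)

/-- `q_i = q^{d_i}` with `d_i = a_i^∨ / a_i`; here `a'` stands for the dual labels `a^∨`. -/
def qi {I : Type*} (ħ : ℂ) (a a' : I → ℕ) (i : I) : ℂˣ := qpow ħ ((a' i : ℚ) / (a i : ℚ))

/-- The imaginary unit, as a unit of `ℂ`. -/
def im : ℂˣ := Units.mk0 Complex.I Complex.I_ne_zero

/-! ### The four families of affine Cartan matrices, with nodes `0, …, n` -/

/-- Cartan matrix of type `A_n^{(1)}` for `n ≥ 1`; the indices are added cyclically, and for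
`n = 1` the two neighbours of a node coincide, so that the off-diagonal entries are `-2`. -/
def cartanA (n : ℕ) : Matrix (Fin (n + 1)) (Fin (n + 1)) ℤ := Matrix.of fun i j =>
  (if i = j then 2 else 0) - (if j = i + 1 then 1 else 0) - (if i = j + 1 then 1 else 0)

/-- The tridiagonal matrix with diagonal entries `2` and with `a_{k,k+1} = u k`,
`a_{k+1,k} = l k`. -/
def tridiag (n : ℕ) (u l : ℕ → ℤ) : Matrix (Fin (n + 1)) (Fin (n + 1)) ℤ := Matrix.of fun i j =>
  if i = j then 2
  else if j.val = i.val + 1 then u i.val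
  else if i.val = j.val + 1 then l j.val
  else 0

/-- Cartan matrix of type `C_n^{(1)}`, `0 ⇒ 1 - ⋯ - (n-1) ⇐ n`. -/
def cartanC (n : ℕ) : Matrix (Fin (n + 1)) (Fin (n + 1)) ℤ :=
  tridiag n (fun k => if k + 1 = n then -2 else -1) (fun k => if k = 0 then -2 else -1)

/-- Cartan matrix of type `A_{2n}^{(2)}`, `0 ⇒ 1 - ⋯ - (n-1) ⇒ n` (node `n` is the shortest root);
for `n = 1` it has `a_{01} = -1` and `a_{10} = -4`. -/
def cartanA2 (n : ℕ) : Matrix (Fin (n + 1)) (Fin (n + 1)) ℤ :=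
  tridiag n (fun _ => -1)
    (fun k => -((if k = 0 then 2 else 1) * (if k + 1 = n then 2 else 1)))

/-- Cartan matrix of type `D_{n+1}^{(2)}`, `0 ⇐ 1 - ⋯ - (n-1) ⇒ n`. -/
def cartanD2 (n : ℕ) : Matrix (Fin (n + 1)) (Fin (n + 1)) ℤ :=
  tridiag n (fun k => if k = 0 then -2 else -1) (fun k => if k + 1 = n then -2 else -1)

/-- `e` numbers the nodes `0, …, n` in such a way that `A` becomes the matrix `B`. -/
def IsNumbering {I : Type*} {n : ℕ} (A : Matrix I I ℤ) (B : Matrix (Fin (n + 1)) (Fin (n + 1)) ℤ)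
    (e : Fin (n + 1) ≃ I) : Prop :=
  ∀ i j, A (e i) (e j) = B i j

/-- `A` is the matrix `B` up to the numbering of the nodes. -/
def HasType {I : Type*} {n : ℕ} (A : Matrix I I ℤ) (B : Matrix (Fin (n + 1)) (Fin (n + 1)) ℤ) :
    Prop :=
  ∃ e : Fin (n + 1) ≃ I, IsNumbering A B e

/-! ### The explicit solutions

Here `Q` stands for the family `q_i`, and `e` for a numbering of the nodes by `0, …, n`. -/

section solutions

variable {I : Type*} [DecidableEq I] {n : ℕ}

/-- The variable attached to the node number `k` (for `k ≤ n`). -/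
def X (e : Fin (n + 1) ≃ I) (k : ℕ) : (Laurent I)ˣ := x (e (Fin.ofNat (n + 1) k))

/-- `z_i = x_{i-1}⁻¹ x_i` for `1 ≤ i ≤ n` and `z_0 = x_n⁻¹ x_0 = (z_1 ⋯ z_n)⁻¹`. -/
def zA (e : Fin (n + 1) ≃ I) (i : Fin (n + 1)) : (Laurent I)ˣ := (x (e (i - 1)))⁻¹ * x (e i)

/-- `z_k = x_{k-1}⁻¹ x_k` for `1 ≤ k ≤ n`. -/
def zC (e : Fin (n + 1) ≃ I) (k : ℕ) : (Laurent I)ˣ := (X e (k - 1))⁻¹ * X e k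

/-- `z_k = x_{k-1}⁻¹ x_k` for `1 ≤ k < n` and `z_n = x_{n-1}⁻¹ x_n²`. -/
def zA2 (e : Fin (n + 1) ≃ I) (k : ℕ) : (Laurent I)ˣ :=
  (X e (k - 1))⁻¹ * X e k ^ (if k = n then 2 else 1)

/-- `z_1 = x_0⁻² x_1`, `z_k = x_{k-1}⁻¹ x_k` for `1 < k < n`, and `z_n = x_{n-1}⁻¹ x_n²`. -/
def zD2 (e : Fin (n + 1) ≃ I) (k : ℕ) : (Laurent I)ˣ :=
  (X e (k - 1) ^ (if k = 1 then 2 else 1))⁻¹ * X e k ^ (if k = n then 2 else 1)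

/-- `φ_i = {q b z_i} {b z_{i+1}}` for all `i` (cyclically), where `q = q_i`. -/
def solA (Q : I → ℂˣ) (e : Fin (n + 1) ≃ I) (b : ℂˣ) (i : Fin (n + 1)) : Laurent I :=
  brace (Q (e i)) (scal (Q (e i) * b) * zA e i) * brace (Q (e i)) (scal b * zA e (i + 1))

/-- `φ_0 = {q_0 b z_1⁻¹}_0 {b z_1}_0`, `φ_i = {q_i b z_i}_i {b z_{i+1}}_i` for `0 < i < n`, and
`φ_n = {q_n b z_n}_n {b z_n⁻¹}_n`. -/
def solC (Q : I → ℂˣ) (e : Fin (n + 1) ≃ I) (b : ℂˣ) (i : Fin (n + 1)) : Laurent I :=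
  let c := Q (e i)
  if i.val = 0 then brace c (scal (c * b) * (zC e 1)⁻¹) * brace c (scal b * zC e 1)
  else if i.val = n then brace c (scal (c * b) * zC e n) * brace c (scal b * (zC e n)⁻¹)
  else brace c (scal (c * b) * zC e i.val) * brace c (scal b * zC e (i.val + 1))

/-- `φ_0 = {ι q^{-3/2} z_1}_0 {ι q^{-1/2} z_1}_0`,
`φ_i = {ι q^{1/2} z_i}_i {ι q^{-1/2} z_{i+1}}_i` for `0 < i < n`, and
`φ_n = ι (q_n - q_n⁻¹)⁻¹ {ι q^{1/2} z_n}_n`, where `ι² = -1` and `q = e^ħ`. -/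
def solA2 (ħ : ℂ) (Q : I → ℂˣ) (e : Fin (n + 1) ≃ I) (i : Fin (n + 1)) : Laurent I :=
  let c := Q (e i)
  if i.val = 0 then
    brace c (scal (im * qpow ħ (-3 / 2)) * zA2 e 1) * brace c (scal (im * qpow ħ (-1 / 2)) * zA2 e 1)
  else if i.val = n then
    (Complex.I / ((c : ℂ) - (c : ℂ)⁻¹)) • brace c (scal (im * qpow ħ (1 / 2)) * zA2 e n)
  else
    brace c (scal (im * qpow ħ (1 / 2)) * zA2 e i.val) *
      brace c (scal (im * qpow ħ (-1 / 2)) * zA2 e (i.val + 1))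

/-- `φ_0 = ι (q_0 - q_0⁻¹)⁻¹ {ι q⁻¹ z_1}_0`, `φ_i = {ι q z_i}_i {ι q⁻¹ z_{i+1}}_i` for `0 < i < n`,
and `φ_n = ι (q_n - q_n⁻¹)⁻¹ {ι q z_n}_n`, where `ι² = -1` and `q = e^ħ`. -/
def solD2 (ħ : ℂ) (Q : I → ℂˣ) (e : Fin (n + 1) ≃ I) (i : Fin (n + 1)) : Laurent I :=
  let c := Q (e i)
  if i.val = 0 then
    (Complex.I / ((c : ℂ) - (c : ℂ)⁻¹)) • brace c (scal (im * qpow ħ (-1)) * zD2 e 1)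
  else if i.val = n then
    (Complex.I / ((c : ℂ) - (c : ℂ)⁻¹)) • brace c (scal (im * qpow ħ 1) * zD2 e n)
  else
    brace c (scal (im * qpow ħ 1) * zD2 e i.val) *
      brace c (scal (im * qpow ħ (-1)) * zD2 e (i.val + 1))

end solutions

end QShift

end

/-! Put f_i = -(q_i - q_i⁻¹)² φ_i. As q_i is not a root of unity, ζ_i - 1 kills exactly the Laurent
polynomials of degree 0 in x_i, so the first equation of the system says that f_i = q_i y_i + q_i⁻¹
y_i⁻¹ + g_i with g_i of degree 0 in x_i (`normal_eq_iff`).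

Shiftability of (f_i, f_j) is then compared degree by degree in x_i (`part_of_shiftable`). The
extreme degrees show that f_j has x_i-degrees between a_{ij} and -a_{ij}. If a_{ij} = -1, only the
degrees 1 and -1 occur, and eliminating the two halves of f_j leaves a product of two Laurent
polynomials equal to a nonzero constant. Both factors are therefore monomials, which forces g_i =
q_i⁻¹ w + q_i w⁻¹ with a single term w = c x^v (`edge_core`). Multiplication by w y_i⁻¹ carries one
half of f_j to the other; since f_j is itself normal at j, either it is a four-term expression with
the same constant c, or g_j = 0 (`IsNormalSolution.edge`). Conversely these shapes are shiftable,
because a common factor 1 + w y_i⁻¹ is exchanged by the shifts (`shiftable_of_factor`).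

Consequences for A (`IsNormalSolution.isLocallyAdmissible`): a_{ij} = -1 forces a_{ji} to be -1, or
-2 with a leaf at one end, or -4; and two entries -1 in the row of i exclude a third neighbour. With
the positive null vector, a pair with a_{ij} a_{ji} ≥ 4 is the whole diagram; otherwise every node
has at most two neighbours, and the diagram is a cycle or a path. A cycle has only simple edges. On
a path the null vector, rescaled at the ends, is affine linear, which forces a double edge at each
end: these are C, A2 and D2.

Consequences for the solutions: v is determined by the neighbours, and c is the same at all nodes.
On a cycle c is free. A double edge from a leaf i to j forces c² = q_j², and even c = q_j if a_{ij}
= -2. The products of braces in the theorem are these four-term expressions in factored form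
(`scaleFactor_smul_brace_mul_brace`). The cycle of type A_1^{(1)} has no entry -1 and is solved by
direct comparison of coefficients (`IsNormalSolution.rankTwo`). -/

noncomputable section

namespace QShift

/-! ### Laurent polynomials: coefficients, degree in one variable, shift operators -/

section laurent

variable {I : Type*}

open AddMonoidAlgebra

theorem coeff_scaleHom (i : I) (c : ℂˣ) (f : Laurent I) (v : I → ℤ) :
    (scaleHom i c f).coeff v = (c : ℂ) ^ v i * f.coeff v := by
  classical
  induction f using AddMonoidAlgebra.induction_linear with
  | zero => simp
  | add x y hx hy => simp [hx, hy, mul_add]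
  | single m r =>
    rw [scaleHom_single]
    simp only [coeff_single, Finsupp.single_apply]
    split_ifs with h
    · subst h; simp [mul_comm]
    · simp

theorem coeff_zeta (Q : I → ℂˣ) (i : I) (f : Laurent I) (v : I → ℤ) :
    (zeta Q i f).coeff v = ((Q i : ℂ) ^ v i)⁻¹ * f.coeff v := by
  have : zeta Q i f = scaleHom i (Q i)⁻¹ f := rfl
  rw [this, coeff_scaleHom]
  simp

theorem coeff_zeta_symm (Q : I → ℂˣ) (i : I) (f : Laurent I) (v : I → ℤ) :
    ((zeta Q i).symm f).coeff v = (Q i : ℂ) ^ v i * f.coeff v := by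
  have : (zeta Q i).symm f = scaleHom i (Q i)⁻¹⁻¹ f := rfl
  rw [this, coeff_scaleHom]
  simp

theorem zeta_symm_single (Q : I → ℂˣ) (i : I) (v : I → ℤ) (r : ℂ) :
    (zeta Q i).symm (single v r : Laurent I) = single v ((Q i : ℂ) ^ v i * r) := by
  classical
  ext w
  rw [coeff_zeta_symm]
  simp only [coeff_single, Finsupp.single_apply]
  split_ifs with h
  · rw [h]
  · simp

theorem coeff_single_mul (v w : I → ℤ) (r : ℂ) (f : Laurent I) :
    (single v r * f).coeff w = r * f.coeff (w - v) := by
  apply coeff_single_mul_eq_mul_coeff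
  intro m _
  rw [eq_sub_iff_add_eq, add_comm]

theorem coeff_mul_single' (v w : I → ℤ) (r : ℂ) (f : Laurent I) :
    (f * single v r).coeff w = r * f.coeff (w - v) := by
  rw [mul_comm, coeff_single_mul]

/-- All exponents of `x_i` in `f` are equal to `m`. -/
def IsHomog (i : I) (m : ℤ) (f : Laurent I) : Prop := ∀ v, f.coeff v ≠ 0 → v i = m

/-- The part of `f` of degree `n` in `x_i`. -/
def part (i : I) (n : ℤ) (f : Laurent I) : Laurent I :=
  ofCoeff (f.coeff.filter fun v => v i = n)

theorem coeff_part (i : I) (n : ℤ) (f : Laurent I) (v : I → ℤ) :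
    (part i n f).coeff v = if v i = n then f.coeff v else 0 := by
  simp [part, Finsupp.filter_apply]

theorem part_add (i : I) (n : ℤ) (f g : Laurent I) :
    part i n (f + g) = part i n f + part i n g := by
  ext v; simp only [coeff_part, coeff_add, Finsupp.add_apply]; split_ifs <;> simp

theorem isHomog_single (i : I) (v : I → ℤ) (r : ℂ) : IsHomog i (v i) (single v r) := by
  classical
  intro w hw
  simp only [coeff_single, Finsupp.single_apply] at hw
  split_ifs at hw with h
  · rw [h]
  · exact absurd rfl hw

theorem part_mul_of_isHomog {i : I} {m : ℤ} {g : Laurent I} (hg : IsHomog i m g) (n : ℤ)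
    (f : Laurent I) : part i n (g * f) = g * part i (n - m) f := by
  classical
  induction f using AddMonoidAlgebra.induction_linear with
  | zero =>
    have h0 : ∀ k, part i k (0 : Laurent I) = 0 := fun k => by ext v; simp [coeff_part]
    rw [mul_zero, h0, h0, mul_zero]
  | add x y hx hy => rw [mul_add, part_add, hx, hy, part_add, mul_add]
  | single w r =>
    have h1 : part i (n - m) (single w r : Laurent I) = if w i = n - m then single w r else 0 := by
      ext v
      rw [coeff_part]
      split_ifs with h1 h2 h2
      · rfl
      · simp only [coeff_single, Finsupp.single_apply, coeff_zero, Finsupp.zero_apply]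
        rw [if_neg]; rintro rfl; exact h2 h1
      · simp only [coeff_single, Finsupp.single_apply]
        rw [if_neg]; rintro rfl; exact h1 h2
      · rfl
    rw [h1]
    ext v
    rw [coeff_part, coeff_mul_single']
    by_cases hc : g.coeff (v - w) = 0
    · rw [hc, mul_zero, ite_self]
      split_ifs
      · rw [coeff_mul_single', hc, mul_zero]
      · rw [mul_zero]; rfl
    · have := hg _ hc
      simp only [Pi.sub_apply] at this
      by_cases h2 : v i = n
      · rw [if_pos h2, if_pos (by omega), coeff_mul_single']
      · rw [if_neg h2, if_neg (by omega)]; simp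

theorem part_zeta_symm_self (Q : I → ℂˣ) (i : I) (n : ℤ) (f : Laurent I) :
    part i n ((zeta Q i).symm f) = (Q i : ℂ) ^ n • part i n f := by
  ext v
  simp only [coeff_part, coeff_zeta_symm, coeff_smul, Finsupp.smul_apply, smul_eq_mul]
  split_ifs with h
  · rw [h]
  · simp

theorem IsHomog.zeta_symm {i : I} {m : ℤ} {g : Laurent I} (hg : IsHomog i m g) (Q : I → ℂˣ)
    (j : I) : IsHomog i m ((zeta Q j).symm g) := by
  intro v hv
  rw [coeff_zeta_symm] at hv
  exact hg v (right_ne_zero_of_mul hv)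

theorem shiftable_symm {Q : I → ℂˣ} {i j : I} {f g : Laurent I} :
    Shiftable Q i j f g ↔ Shiftable Q j i g f := by
  unfold Shiftable
  rw [mul_comm f g, mul_comm ((zeta Q j).symm f)]

theorem shiftable_smul {Q : I → ℂˣ} {i j : I} {f g : Laurent I} {a b : ℂ} (ha : a ≠ 0)
    (hb : b ≠ 0) : Shiftable Q i j (a • f) (b • g) ↔ Shiftable Q i j f g := by
  unfold Shiftable
  rw [map_smul, map_smul, smul_mul_smul_comm, smul_mul_smul_comm]
  exact (smul_right_injective _ (mul_ne_zero ha hb)).eq_iff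

/-- The only divisors of a monomial are monomials. -/
theorem eq_single_of_mul_eq_single {f g : Laurent I} {v : I → ℤ} {c : ℂ} (hc : c ≠ 0)
    (h : f * g = single v c) : ∃ w a, a ≠ 0 ∧ f = single w a := by
  classical
  have hf : f ≠ 0 := by rintro rfl; simp [eq_comm, single_eq_zero, hc] at h
  have hg : g ≠ 0 := by rintro rfl; simp [eq_comm, single_eq_zero, hc] at h
  have hfs : 0 < f.coeff.support.card := by
    rw [Finset.card_pos, Finsupp.support_nonempty_iff]; simpa using hf
  have hgs : 0 < g.coeff.support.card := by
    rw [Finset.card_pos, Finsupp.support_nonempty_iff]; simpa using hg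
  have hcard : ¬ 1 < f.coeff.support.card * g.coeff.support.card := by
    intro h1
    -- Exponent vectors have two unique sums: unless both factors are monomials, two different pairs
    -- of exponents have sums that arise in only one way. Both sums survive in the product, so both
    -- equal v, which contradicts uniqueness.
    obtain ⟨p, hp, p', hp', hne, hu, hu'⟩ := TwoUniqueSums.uniqueAdd_of_one_lt_card h1
    have key : ∀ p : (I → ℤ) × (I → ℤ), p ∈ f.coeff.support ×ˢ g.coeff.support →
        UniqueAdd f.coeff.support g.coeff.support p.1 p.2 → p.1 + p.2 = v := by
      intro p hp hu
      have := coeff_mul_add_of_uniqueAdd hu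
      rw [h] at this
      simp only [coeff_single, Finsupp.single_apply] at this
      by_contra hv
      rw [if_neg (Ne.symm hv)] at this
      simp only [Finset.mem_product, Finsupp.mem_support_iff] at hp
      exact mul_ne_zero hp.1 hp.2 this.symm
    have e1 := key p hp hu
    have e2 := key p' hp' hu'
    rw [Finset.mem_product] at hp hp'
    have := hu hp'.1 hp'.2 (e2.trans e1.symm)
    exact hne (Prod.ext this.1.symm this.2.symm)
  have h1 : f.coeff.support.card = 1 := by nlinarith
  obtain ⟨w, hw⟩ := Finset.card_eq_one.mp h1
  refine ⟨w, f.coeff w, ?_, ?_⟩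
  · rw [← Finsupp.mem_support_iff, hw]; simp
  · ext u
    simp only [coeff_single, Finsupp.single_apply]
    split_ifs with hu
    · rw [hu]
    · by_contra h0
      have : u ∈ f.coeff.support := by simpa using h0
      rw [hw, Finset.mem_singleton] at this
      exact hu this.symm

end laurent

/-! ### Comparing the shiftability relation degree by degree in one variable -/

section edge

variable {I : Type*}

open AddMonoidAlgebra

/-- The exponent vector of `y_i`. -/
def yv (A : Matrix I I ℤ) (i : I) : I → ℤ := fun k => A k i

/-- `f` is `q_i y_i + q_i⁻¹ y_i⁻¹` up to terms of degree `0` in `x_i`. -/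
def IsNormal (A : Matrix I I ℤ) (Q : I → ℂˣ) (i : I) (f : Laurent I) : Prop :=
  ∃ g, IsHomog i 0 g ∧
    f = single (yv A i) (Q i : ℂ) + single (-yv A i) (Q i : ℂ)⁻¹ + g

/-- The family `Q i = q ^ d i` for a symmetrizer `d` of `A` and `q` not a root of unity. -/
structure IsQFamily (A : Matrix I I ℤ) (Q : I → ℂˣ) (d : I → ℚ) : Prop where
  pos : ∀ i, 0 < d i
  symm : ∀ i j, d i * A i j = d j * A j i
  pow : ∀ i j (m n : ℤ), (Q i : ℂ) ^ m * (Q j : ℂ) ^ n = 1 ↔ d i * m + d j * n = 0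

variable {A : Matrix I I ℤ} {Q : I → ℂˣ} {d : I → ℚ} {i j : I}

theorem IsQFamily.zpow_eq_one (hQ : IsQFamily A Q d) (i : I) (n : ℤ) :
    (Q i : ℂ) ^ n = 1 ↔ n = 0 := by
  have := hQ.pow i i n 0
  simp only [zpow_zero, mul_one, Int.cast_zero, mul_zero, add_zero] at this
  rw [this]
  simp [(hQ.pos i).ne']

theorem IsQFamily.zpow_eq (hQ : IsQFamily A Q d) (i j : I) :
    (Q j : ℂ) ^ A j i = (Q i : ℂ) ^ A i j := by
  have := (hQ.pow j i (A j i) (-A i j)).2 (by push_cast; linarith [hQ.symm i j])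
  rw [zpow_neg] at this
  exact eq_of_mul_inv_eq_one this

theorem IsQFamily.sub_inv_ne_zero (hQ : IsQFamily A Q d) (i : I) :
    (Q i : ℂ) - (Q i : ℂ)⁻¹ ≠ 0 := by
  intro h
  have h2 := (hQ.zpow_eq_one i 2).not.2 two_ne_zero
  have h0 := (Q i).ne_zero
  apply h2
  rw [sub_eq_zero] at h
  rw [zpow_ofNat, sq]
  nth_rw 1 [h]
  exact inv_mul_cancel₀ h0

/-- This is the degree n part in x_i of the shiftability relation. Multiplication by y_i^{±1} moves
the degree by ±2, multiplication by g preserves it, and ζ_i⁻¹ is a scalar on each homogeneous part,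
so only the parts of F in degrees n - 2, n and n + 2 interact. -/
theorem part_of_shiftable (hA : IsGCM A) {g F : Laurent I} (hg : IsHomog i 0 g)
    (h : Shiftable Q i j (single (yv A i) (Q i : ℂ) + single (-yv A i) (Q i : ℂ)⁻¹ + g) F)
    (n : ℤ) :
    single (yv A i) (Q i : ℂ) * part i (n - 2) F + single (-yv A i) (Q i : ℂ)⁻¹ * part i (n + 2) F
        + g * part i n F =
      ((Q j : ℂ) ^ A j i * (Q i : ℂ) ^ (n - 2)) • (single (yv A i) (Q i : ℂ) * part i (n - 2) F) +
      (((Q j : ℂ) ^ A j i)⁻¹ * (Q i : ℂ) ^ (n + 2)) •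
        (single (-yv A i) (Q i : ℂ)⁻¹ * part i (n + 2) F) +
      (Q i : ℂ) ^ n • ((zeta Q j).symm g * part i n F) := by
  have hy : IsHomog i 2 (single (yv A i) (Q i : ℂ)) := by
    have := isHomog_single i (yv A i) (Q i : ℂ)
    rwa [yv, hA.diag] at this
  have hy' : IsHomog i (-2) (single (-yv A i) (Q i : ℂ)⁻¹) := by
    have := isHomog_single i (-yv A i) (Q i : ℂ)⁻¹
    rwa [Pi.neg_apply, yv, hA.diag] at this
  have h1 := congrArg (part i n) h
  rw [map_add, map_add, add_mul, add_mul, add_mul, add_mul, part_add, part_add, part_add, part_add,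
    part_mul_of_isHomog hy, part_mul_of_isHomog hy', part_mul_of_isHomog hg,
    part_mul_of_isHomog (hy.zeta_symm Q j), part_mul_of_isHomog (hy'.zeta_symm Q j),
    part_mul_of_isHomog (hg.zeta_symm Q j), part_zeta_symm_self, part_zeta_symm_self,
    part_zeta_symm_self, zeta_symm_single, zeta_symm_single, sub_neg_eq_add, sub_zero] at h1
  rw [h1]
  have e1 : ∀ a b : ℂ, (single (yv A i) (a * b) : Laurent I) = a • single (yv A i) b := by simp
  have e2 : ∀ a b : ℂ, (single (-yv A i) (a * b) : Laurent I) = a • single (-yv A i) b := by simp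
  rw [e1, e2, smul_mul_smul_comm, smul_mul_smul_comm, mul_smul_comm]
  simp [yv]

theorem part_eq_zero_iff {n : ℤ} {F : Laurent I} :
    part i n F = 0 ↔ ∀ v, F.coeff v ≠ 0 → v i ≠ n := by
  constructor
  · intro h v hv hn
    have := coeff_part i n F v
    rw [h, if_pos hn] at this
    exact hv (by simpa using this.symm)
  · intro h
    ext v
    rw [coeff_part]
    split_ifs with hn
    · by_contra h0; exact h v h0 hn
    · rfl

theorem single_mul_eq_zero {v : I → ℤ} {c : ℂ} (hc : c ≠ 0) {F : Laurent I}
    (h : single v c * F = 0) : F = 0 :=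
  (mul_eq_zero.1 h).resolve_left (by simpa using hc)

/-- If `(f_i, f_j)` is shiftable, the degrees in `x_i` of the terms of `f_j` are bounded
by `-a_{ij}`. -/
theorem abs_le_of_shiftable (hA : IsGCM A) (hQ : IsQFamily A Q d) {f F : Laurent I}
    (hf : IsNormal A Q i f) (h : Shiftable Q i j f F) {v : I → ℤ} (hv : F.coeff v ≠ 0) :
    |v i| ≤ -A i j := by
  obtain ⟨g, hg, rfl⟩ := hf
  have hne : F.coeff.support.Nonempty := ⟨v, by simpa using hv⟩
  have hq := (Q i).ne_zero
  obtain ⟨u, hu, hmax⟩ := Finset.exists_max_image F.coeff.support (fun v => v i) hne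
  obtain ⟨w, hw, hmin⟩ := Finset.exists_min_image F.coeff.support (fun v => v i) hne
  simp only [Finsupp.mem_support_iff] at hu hmax hw hmin
  -- Two degrees above the top of F, only the product of q_i y_i with the top part of F contributes.
  -- The two sides differ there by the factor q_i^{a_{ij} + u_i}, which must be 1. The bottom degree
  -- is treated in the same way with y_i⁻¹.
  have hup : u i = -A i j := by
    have h1 := part_of_shiftable hA hg h (u i + 2)
    have z1 : part i (u i + 2) F = 0 := part_eq_zero_iff.2 fun v hv => by
      have := hmax v hv; omega
    have z2 : part i (u i + 2 + 2) F = 0 := part_eq_zero_iff.2 fun v hv => by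
      have := hmax v hv; omega
    rw [z1, z2, add_sub_cancel_right, hQ.zpow_eq] at h1
    simp only [mul_zero, smul_zero, add_zero] at h1
    rw [← zpow_add₀ hq] at h1
    by_contra hc
    have hk : 1 - (Q i : ℂ) ^ (A i j + u i) ≠ 0 := by
      intro h0
      exact hc (by have := (hQ.zpow_eq_one i _).1 (sub_eq_zero.1 h0).symm; omega)
    have h2 : (1 - (Q i : ℂ) ^ (A i j + u i)) • (single (yv A i) (Q i : ℂ) * part i (u i) F) = 0 := by
      rw [sub_smul, one_smul, ← h1, sub_self]
    have h3 := single_mul_eq_zero hq ((smul_eq_zero.1 h2).resolve_left hk)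
    exact part_eq_zero_iff.1 h3 u hu rfl
  have hlo : w i = A i j := by
    have h1 := part_of_shiftable hA hg h (w i - 2)
    have z1 : part i (w i - 2) F = 0 := part_eq_zero_iff.2 fun v hv => by
      have := hmin v hv; omega
    have z2 : part i (w i - 2 - 2) F = 0 := part_eq_zero_iff.2 fun v hv => by
      have := hmin v hv; omega
    rw [z1, z2, sub_add_cancel, hQ.zpow_eq] at h1
    simp only [mul_zero, smul_zero, add_zero, zero_add] at h1
    rw [← zpow_neg, ← zpow_add₀ hq] at h1
    by_contra hc
    have hk : 1 - (Q i : ℂ) ^ (-A i j + w i) ≠ 0 := by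
      intro h0
      exact hc (by have := (hQ.zpow_eq_one i _).1 (sub_eq_zero.1 h0).symm; omega)
    have h2 : (1 - (Q i : ℂ) ^ (-A i j + w i)) •
        (single (-yv A i) (Q i : ℂ)⁻¹ * part i (w i) F) = 0 := by
      rw [sub_smul, one_smul, ← h1, sub_self]
    have h3 := single_mul_eq_zero (inv_ne_zero hq) ((smul_eq_zero.1 h2).resolve_left hk)
    exact part_eq_zero_iff.1 h3 w hw rfl
  rw [abs_le]
  have := hmax v hv
  have := hmin v hv
  omega

/-- Write σ = ζ_j⁻¹ and split F into its parts of x_i-degree 1 and -1. The relation in degrees 1 and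
-1 says that qσg - g and q⁻¹σg - g carry each part to a multiple of the other. Composing, their
product is a nonzero constant, so both are monomials, and g is recovered from them by linear
algebra. -/
theorem edge_core (hA : IsGCM A) (hQ : IsQFamily A Q d) (hij : A i j = -1) {g F : Laurent I}
    (hg : IsHomog i 0 g) (hF : F ≠ 0)
    (h : Shiftable Q i j (single (yv A i) (Q i : ℂ) + single (-yv A i) (Q i : ℂ)⁻¹ + g) F) :
    ∃ (v : I → ℤ) (c : ℂ), c ≠ 0 ∧ v i = 0 ∧
      g = single v ((Q i : ℂ)⁻¹ * c) + single (-v) ((Q i : ℂ) * c⁻¹) ∧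
      ((v ≠ 0 ∧ v j = -A j i) ∨ (v = 0 ∧ c ^ 2 = Q i)) ∧
      (∀ w, F.coeff w ≠ 0 → w i = 1 ∨ w i = -1) ∧
      ∀ w, w i = 1 → F.coeff (w + (v - yv A i)) = c * F.coeff w := by
  classical
  have hq := (Q i).ne_zero
  have hs := hQ.sub_inv_ne_zero i
  set q : ℂ := (Q i : ℂ) with hqdef
  have hκ : (Q j : ℂ) ^ A j i = q⁻¹ := by rw [hQ.zpow_eq, hij, zpow_neg_one]
  have hb : ∀ w, F.coeff w ≠ 0 → |w i| ≤ 1 := fun w hw => by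
    have := abs_le_of_shiftable hA hQ ⟨g, hg, rfl⟩ h hw
    rwa [hij, neg_neg] at this
  have hbig : ∀ n : ℤ, 1 < |n| → part i n F = 0 := fun n hn =>
    part_eq_zero_iff.2 fun w hw h1 => by
      have := hb w hw; rw [h1] at this; omega
  have hq1 : (1 : ℂ) - q⁻¹ ≠ 0 := by
    intro h0
    have := (hQ.zpow_eq_one i (-1)).1 (by rw [zpow_neg_one]; exact (sub_eq_zero.1 h0).symm)
    omega
  -- The degree 2 component sees only the degree 0 part of F, multiplied by 1 on one side and by
  -- q_i⁻¹ on the other.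
  have h0 : part i 0 F = 0 := by
    have h1 := part_of_shiftable hA hg h 2
    rw [hbig 2 (by norm_num), hbig (2 + 2) (by norm_num), hκ] at h1
    simp only [mul_zero, smul_zero, add_zero, sub_self, zpow_zero, mul_one] at h1
    have h2 : (1 - q⁻¹) • (single (yv A i) q * part i 0 F) = 0 := by
      rw [sub_smul, one_smul, ← h1, sub_self]
    exact single_mul_eq_zero hq ((smul_eq_zero.1 h2).resolve_left hq1)
  have hdeg : ∀ w, F.coeff w ≠ 0 → w i = 1 ∨ w i = -1 := fun w hw => by
    have h1 := abs_le.1 (hb w hw)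
    have h2 := part_eq_zero_iff.1 h0 w hw
    omega
  have e1 := part_of_shiftable hA hg h 1
  have e2 := part_of_shiftable hA hg h (-1)
  rw [hbig (1 + 2) (by norm_num), hκ, show (1 - 2 : ℤ) = -1 by norm_num] at e1
  rw [hbig (-1 - 2) (by norm_num), hκ, show (-1 + 2 : ℤ) = 1 by norm_num] at e2
  simp only [mul_zero, smul_zero, add_zero, zero_add, zpow_one, zpow_neg_one, inv_inv] at e1 e2
  set σg := (zeta Q j).symm g with hσ
  set hp := part i 1 F with hpdef
  set hm := part i (-1) F with hmdef
  set P : Laurent I := single (yv A i) q with hP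
  set N : Laurent I := single (-yv A i) q⁻¹ with hN
  have hPN : P * N = 1 := by
    rw [hP, hN, single_mul_single, add_neg_cancel, mul_inv_cancel₀ hq, one_def]
  have e1' : (q • σg - g) * hp = (1 - q⁻¹ * q⁻¹) • (P * hm) := by
    rw [sub_mul, sub_smul, one_smul, smul_mul_assoc]
    linear_combination (exp := 1) -e1
  have e2' : (q⁻¹ • σg - g) * hm = (1 - q * q) • (N * hp) := by
    rw [sub_mul, sub_smul, one_smul, smul_mul_assoc]
    linear_combination (exp := 1) -e2
  have hk1 : (1 : ℂ) - q⁻¹ * q⁻¹ ≠ 0 := by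
    intro h0; apply hs
    field_simp at h0 ⊢
    linear_combination h0
  have hk2 : (1 : ℂ) - q * q ≠ 0 := by
    intro h0; apply hs
    field_simp
    linear_combination -h0
  have hsum : ∀ w, F.coeff w = hp.coeff w + hm.coeff w := fun w => by
    rw [hpdef, hmdef, coeff_part, coeff_part]
    by_cases hw : F.coeff w = 0
    · rw [hw]; simp
    · rcases hdeg w hw with h1 | h1 <;> rw [h1] <;> norm_num
  have hp0 : hp ≠ 0 := by
    intro h0
    rw [h0, mul_zero] at e1'
    have h1 := single_mul_eq_zero hq ((smul_eq_zero.1 e1'.symm).resolve_left hk1)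
    exact hF (by ext w; rw [hsum, h0, h1]; simp)
  have hm0 : hm ≠ 0 := by
    intro h0
    rw [h0, mul_zero] at e2'
    exact hp0 (single_mul_eq_zero (inv_ne_zero hq) ((smul_eq_zero.1 e2'.symm).resolve_left hk2))
  have hAB : (q • σg - g) * (q⁻¹ • σg - g) = single 0 ((1 - q⁻¹ * q⁻¹) * (1 - q * q)) := by
    have h1 : (q • σg - g) * (q⁻¹ • σg - g) * (hp * hm) =
        single 0 ((1 - q⁻¹ * q⁻¹) * (1 - q * q)) * (hp * hm) := by
      have h2 : (single 0 ((1 - q⁻¹ * q⁻¹) * (1 - q * q)) : Laurent I) =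
          ((1 - q⁻¹ * q⁻¹) * (1 - q * q)) • (1 : Laurent I) := by
        rw [one_def, smul_single, smul_eq_mul, mul_one]
      rw [h2, mul_mul_mul_comm, e1', e2', smul_mul_smul_comm, smul_mul_assoc, one_mul,
        mul_mul_mul_comm, hPN, one_mul, mul_comm hm]
    exact mul_right_cancel₀ (mul_ne_zero hp0 hm0) h1
  obtain ⟨v, a, ha, hv⟩ := eq_single_of_mul_eq_single (mul_ne_zero hk1 hk2) hAB
  have hB : q⁻¹ • σg - g = single (-v) ((1 - q⁻¹ * q⁻¹) * (1 - q * q) * a⁻¹) := by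
    rw [hv] at hAB
    apply mul_left_cancel₀ (show (single v a : Laurent I) ≠ 0 by simpa using ha)
    rw [hAB, single_mul_single, add_neg_cancel]
    congr 1
    field_simp
  -- The constant c is a/(q_i - q_i⁻¹). With w = c x^v the solutions of the two linear equations
  -- become g = q_i⁻¹ w + q_i w⁻¹ and σg = w + w⁻¹.
  have hc : a * (q - q⁻¹)⁻¹ ≠ 0 := mul_ne_zero ha (inv_ne_zero hs)
  have hgv : (q - q⁻¹) • g = single v (q⁻¹ * a) +
      single (-v) (-(q * ((1 - q⁻¹ * q⁻¹) * (1 - q * q) * a⁻¹))) := by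
    have h1 : (q - q⁻¹) • g = q⁻¹ • (q • σg - g) - q • (q⁻¹ • σg - g) := by
      rw [smul_sub, smul_sub, smul_smul, smul_smul, mul_inv_cancel₀ hq, inv_mul_cancel₀ hq,
        sub_smul]
      abel
    rw [h1, hv, hB, smul_single, smul_single, sub_eq_add_neg, ← neg_one_smul ℂ (single (-v) _),
      smul_single]
    simp only [smul_eq_mul, neg_one_mul]
  have hσv : (q - q⁻¹) • σg = single v a +
      single (-v) (-((1 - q⁻¹ * q⁻¹) * (1 - q * q) * a⁻¹)) := by
    have h1 : (q - q⁻¹) • σg = (q • σg - g) - (q⁻¹ • σg - g) := by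
      rw [sub_smul]; abel
    rw [h1, hv, hB, sub_eq_add_neg, ← neg_one_smul ℂ (single (-v) _), smul_single]
    simp only [smul_eq_mul, neg_one_mul]
  have hK : (1 - q⁻¹ * q⁻¹) * (1 - q * q) = -(q - q⁻¹) ^ 2 := by field_simp; ring
  have hgv' : g = single v (q⁻¹ * (a * (q - q⁻¹)⁻¹)) + single (-v) (q * (a * (q - q⁻¹)⁻¹)⁻¹) := by
    apply smul_right_injective _ hs
    beta_reduce
    rw [hgv, hK, smul_add, smul_single, smul_single, smul_eq_mul, smul_eq_mul]
    generalize q - q⁻¹ = s at hs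
    congr 2 <;> field_simp
  have hσv' : σg = single v (a * (q - q⁻¹)⁻¹) + single (-v) (a * (q - q⁻¹)⁻¹)⁻¹ := by
    apply smul_right_injective _ hs
    beta_reduce
    rw [hσv, hK, smul_add, smul_single, smul_single, smul_eq_mul, smul_eq_mul]
    generalize q - q⁻¹ = s at hs
    congr 2 <;> field_simp
  have hrel : P * hm = single v (q * (a * (q - q⁻¹)⁻¹)) * hp := by
    apply smul_right_injective _ hk1
    beta_reduce
    have h1 : (1 - q⁻¹ * q⁻¹) * q = q - q⁻¹ := by field_simp
    rw [← e1', hv, ← smul_mul_assoc, smul_single, smul_eq_mul, ← mul_assoc, h1]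
    generalize q - q⁻¹ = s at hs
    congr 2
    field_simp
  -- The coefficient at x^v of the monomial qσg - g is nonzero, whereas g and σg involve only degree
  -- 0 in x_i.
  have hvi : v i = 0 := by
    have h1 := congrArg (fun f : Laurent I => f.coeff v) hv
    simp only [coeff_sub, coeff_smul, Finsupp.sub_apply, Finsupp.smul_apply, coeff_single,
      Finsupp.single_eq_same, hσ, coeff_zeta_symm, smul_eq_mul] at h1
    by_contra h2
    have h3 : g.coeff v = 0 := by
      by_contra h4; exact h2 (hg v h4)
    rw [h3] at h1
    simp only [mul_zero, sub_zero] at h1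
    exact ha h1.symm
  generalize a * (q - q⁻¹)⁻¹ = c at hc hgv' hσv' hrel
  refine ⟨v, c, hc, hvi, hgv', ?_, hdeg, ?_⟩
  -- Compatibility of the formulas for g and σg, read at x^v. If v = 0 the two terms merge, and what
  -- remains is (c² - q_i)(q_i - 1) = 0; otherwise q_j^{v_j} = q_i, which the symmetrizer turns into
  -- v_j = -a_{ji}.
  · have h1 := congrArg (fun f : Laurent I => f.coeff v) hσv'
    simp only [hσ, coeff_zeta_symm] at h1
    rw [hgv'] at h1
    simp only [coeff_add, Finsupp.add_apply, coeff_single, Finsupp.single_eq_same] at h1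
    by_cases hv0 : v = 0
    · right
      refine ⟨hv0, ?_⟩
      subst hv0
      simp only [Pi.zero_apply, zpow_zero, neg_zero, Finsupp.single_eq_same, one_mul] at h1
      field_simp at h1
      have h2 : (c ^ 2 - q) * (q - 1) = 0 := by linear_combination -h1
      refine sub_eq_zero.1 ((mul_eq_zero.1 h2).resolve_right fun h3 => hq1 ?_)
      rw [sub_eq_zero.1 h3]; simp
    · left
      refine ⟨hv0, ?_⟩
      have hne : -v ≠ v := fun h2 => hv0 (by
        funext k
        have := congrFun h2 k
        simp only [Pi.neg_apply] at this
        simp only [Pi.zero_apply]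
        omega)
      rw [Finsupp.single_eq_of_ne' hne, Finsupp.single_eq_of_ne' hne, add_zero, add_zero,
        ← mul_assoc] at h1
      have h2 := mul_right_cancel₀ hc (h1.trans (one_mul c).symm)
      have h3 := (hQ.pow j i (v j) (-1)).1 (by rw [zpow_neg_one]; exact h2)
      have h4 := hQ.symm i j
      rw [hij] at h4
      push_cast at h3 h4
      have h5 : d j * ((v j : ℚ) + A j i) = 0 := by linarith
      have h6 := (mul_eq_zero.1 h5).resolve_left (hQ.pos j).ne'
      have h7 : v j + A j i = 0 := by exact_mod_cast h6
      omega
  · intro w hw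
    have h1 := congrArg (fun f : Laurent I => f.coeff (w + v)) hrel
    simp only [hP, coeff_single_mul, add_sub_cancel_right] at h1
    have hyi : yv A i i = 2 := hA.diag i
    rw [hmdef, hpdef, coeff_part, coeff_part, if_pos hw, if_pos (by
      simp only [Pi.add_apply, Pi.sub_apply, hvi, hw, hyi]; norm_num), mul_assoc] at h1
    rw [← add_sub_assoc]
    exact mul_left_cancel₀ hq h1

end edge

/-! ### The shapes of f_i and f_j along an edge with a_{ij} = -1, and the converse -/

section edge

variable {I : Type*}

open AddMonoidAlgebra

/-- The Laurent polynomial `q_i y_i + q_i⁻¹ y_i⁻¹`. -/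
def twoTerm (A : Matrix I I ℤ) (Q : I → ℂˣ) (i : I) : Laurent I :=
  single (yv A i) (Q i : ℂ) + single (-yv A i) (Q i : ℂ)⁻¹

/-- The Laurent polynomial `q_i y_i + q_i⁻¹ y_i⁻¹ + q_i⁻¹ w + q_i w⁻¹` for `w = c x^v`. -/
def fourTerm (A : Matrix I I ℤ) (Q : I → ℂˣ) (i : I) (v : I → ℤ) (c : ℂ) : Laurent I :=
  twoTerm A Q i + (single v ((Q i : ℂ)⁻¹ * c) + single (-v) ((Q i : ℂ) * c⁻¹))

/-- The system of equations for the rescaled unknowns `f_i = -(q_i - q_i⁻¹)² φ_i`. -/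
structure IsNormalSolution (A : Matrix I I ℤ) (Q : I → ℂˣ) (f : I → Laurent I) : Prop where
  normal : ∀ i, IsNormal A Q i (f i)
  shift : ∀ i j, i ≠ j → Shiftable Q i j (f i) (f j)

variable {A : Matrix I I ℤ} {Q : I → ℂˣ} {d : I → ℚ} {i j : I} {f : I → Laurent I}

theorem eq_neg_self_iff {v : I → ℤ} : -v = v ↔ v = 0 := by
  constructor
  · intro h
    funext k
    have := congrFun h k
    simp only [Pi.neg_apply] at this
    simp only [Pi.zero_apply]
    omega
  · rintro rfl; simp

theorem IsGCM.neg_yv_ne (hA : IsGCM A) (i : I) : -yv A i ≠ yv A i := by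
  intro h
  have h1 : (-yv A i) i = yv A i i := by rw [h]
  simp only [Pi.neg_apply, yv, hA.diag] at h1
  omega

theorem coeff_twoTerm_of_eq_zero (hA : IsGCM A) {w : I → ℤ} (hw : w i = 0) :
    (twoTerm A Q i).coeff w = 0 := by
  have h1 : yv A i ≠ w := by
    rintro rfl; simp [yv, hA.diag] at hw
  have h2 : -yv A i ≠ w := by
    rintro rfl; simp [yv, hA.diag] at hw
  simp [twoTerm, Finsupp.single_eq_of_ne' h1, Finsupp.single_eq_of_ne' h2]

theorem coeff_twoTerm_yv (hA : IsGCM A) : (twoTerm A Q i).coeff (yv A i) = Q i := by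
  simp [twoTerm, Finsupp.single_eq_of_ne' (hA.neg_yv_ne i)]

theorem coeff_twoTerm_neg_yv (hA : IsGCM A) : (twoTerm A Q i).coeff (-yv A i) = (Q i : ℂ)⁻¹ := by
  simp [twoTerm, Finsupp.single_eq_of_ne' (hA.neg_yv_ne i).symm]

theorem coeff_twoTerm_ne_zero {w : I → ℤ} (hw : (twoTerm A Q i).coeff w ≠ 0) :
    w = yv A i ∨ w = -yv A i := by
  by_contra h
  push Not at h
  apply hw
  simp [twoTerm, Finsupp.single_eq_of_ne' h.1.symm, Finsupp.single_eq_of_ne' h.2.symm]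

theorem isHomog_zero_four {v : I → ℤ} (hv : v i = 0) (a b : ℂ) :
    IsHomog i 0 (single v a + single (-v) b : Laurent I) := by
  intro w hw
  by_contra h
  apply hw
  have h1 : v ≠ w := by rintro rfl; exact h hv
  have h2 : -v ≠ w := by rintro rfl; simp [hv] at h
  simp [Finsupp.single_eq_of_ne' h1, Finsupp.single_eq_of_ne' h2]

theorem isNormal_twoTerm : IsNormal A Q i (twoTerm A Q i) :=
  ⟨0, by intro v hv; simp at hv, by rw [add_zero, twoTerm]⟩

theorem isNormal_fourTerm {v : I → ℤ} (hv : v i = 0) (c : ℂ) :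
    IsNormal A Q i (fourTerm A Q i v c) :=
  ⟨_, isHomog_zero_four hv _ _, rfl⟩

/-- In terms of w = c x^v the expression is invariant under w ↦ q_i² w⁻¹, so the pair (v, c) can be
recovered from it only up to this involution. -/
theorem fourTerm_neg (v : I → ℤ) (c : ℂ) :
    fourTerm A Q i (-v) c = fourTerm A Q i v ((Q i : ℂ) ^ 2 * c⁻¹) := by
  have hq := (Q i).ne_zero
  unfold fourTerm
  congr 1
  rw [neg_neg, add_comm]
  congr 2
  · field_simp
  · rw [mul_inv, inv_inv]; field_simp

theorem coeff_fourTerm (hA : IsGCM A) {v : I → ℤ} (hvi : v i = 0) (hv : v ≠ 0) (c : ℂ) :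
    (fourTerm A Q i v c).coeff v = (Q i : ℂ)⁻¹ * c := by
  have h1 : -v ≠ v := eq_neg_self_iff.not.2 hv
  rw [fourTerm, coeff_add, Finsupp.add_apply, coeff_twoTerm_of_eq_zero hA hvi]
  simp [Finsupp.single_eq_of_ne' h1]

/-- Serves to compare the descriptions of one f_i that come from two different edges at i. The sign
reflects the involution of `fourTerm_neg`. -/
theorem fourTerm_left_injective (hA : IsGCM A) {v w : I → ℤ} (hvi : v i = 0) (hv : v ≠ 0)
    {c c' : ℂ} (hc : c ≠ 0) (h : fourTerm A Q i v c = fourTerm A Q i w c') : v = w ∨ v = -w := by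
  by_contra hn
  push Not at hn
  have h1 := coeff_fourTerm (Q := Q) hA hvi hv c
  rw [h, fourTerm, coeff_add, Finsupp.add_apply, coeff_twoTerm_of_eq_zero hA hvi] at h1
  simp [Finsupp.single_eq_of_ne' hn.1.symm, Finsupp.single_eq_of_ne' hn.2.symm, hc] at h1

theorem fourTerm_right_injective (hA : IsGCM A) {v : I → ℤ} (hvi : v i = 0) (hv : v ≠ 0)
    {c c' : ℂ} (h : fourTerm A Q i v c = fourTerm A Q i v c') : c = c' := by
  have h1 := coeff_fourTerm (Q := Q) hA hvi hv c
  rw [h, coeff_fourTerm hA hvi hv] at h1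
  exact (mul_left_cancel₀ (inv_ne_zero (Q i).ne_zero) h1).symm

/-- The consequences of shiftability along an edge with `a_{ij} = -1`. -/
theorem IsNormalSolution.edge (hA : IsGCM A) (hQ : IsQFamily A Q d) (hf : IsNormalSolution A Q f)
    (hne : i ≠ j) (hij : A i j = -1) :
    ∃ (v : I → ℤ) (c : ℂ), c ≠ 0 ∧ v i = 0 ∧ f i = fourTerm A Q i v c ∧
      ((v ≠ 0 ∧ v j = -A j i ∧ ∀ k, k ≠ i → k ≠ j → v k = A k i) ∨
        (v = 0 ∧ c ^ 2 = Q i ∧ ∀ k, k ≠ i → k ≠ j → A k i = 0)) ∧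
      ((v j - A j i = 2 ∧ f j = fourTerm A Q j (v - yv A i - yv A j) c) ∨
        (v - yv A i = 2 • yv A j ∧ c = (Q j : ℂ) ^ 2 ∧ (∀ k, k ≠ i → k ≠ j → A k j = 0) ∧
          f j = twoTerm A Q j)) := by
  classical
  obtain ⟨g, hg, hfi⟩ := hf.normal i
  obtain ⟨G, hG, hfj⟩ := hf.normal j
  have hs := hf.shift i j hne
  rw [← twoTerm] at hfj
  have hQj := (Q j).ne_zero
  have hyj : yv A j j = 2 := hA.diag j
  have hyi : yv A i i = 2 := hA.diag i
  have hyji : yv A j i = -1 := hij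
  set F := f j with hF
  have hFy : F.coeff (yv A j) = Q j := by
    rw [hfj, coeff_add, Finsupp.add_apply, coeff_twoTerm_yv hA]
    have : G.coeff (yv A j) = 0 := by
      by_contra h; have := hG _ h; omega
    rw [this, add_zero]
  have hFy' : F.coeff (-yv A j) = (Q j : ℂ)⁻¹ := by
    rw [hfj, coeff_add, Finsupp.add_apply, coeff_twoTerm_neg_yv hA]
    have : G.coeff (-yv A j) = 0 := by
      by_contra h; have := hG _ h; simp only [Pi.neg_apply] at this; omega
    rw [this, add_zero]
  have hFn : ∀ w, F.coeff w ≠ 0 → w j ≠ 0 → w = yv A j ∨ w = -yv A j := by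
    intro w hw hwj
    apply coeff_twoTerm_ne_zero (Q := Q)
    intro h0
    rw [hfj, coeff_add, Finsupp.add_apply, h0, zero_add] at hw
    exact hwj (hG w hw)
  have hFG : ∀ w, w j = 0 → G.coeff w = F.coeff w := by
    intro w hw
    rw [hfj, coeff_add, Finsupp.add_apply, coeff_twoTerm_of_eq_zero hA hw, zero_add]
  have hF0 : F ≠ 0 := by
    intro h; rw [h] at hFy; exact hQj hFy.symm
  have hbd : ∀ w, F.coeff w ≠ 0 → ∀ k, k ≠ j → |w k| ≤ -A k j := fun w hw k hk =>
    abs_le_of_shiftable hA hQ (hf.normal k) (hf.shift k j hk) hw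
  rw [hfi] at hs
  obtain ⟨v, c, hc, hvi, hgv, hv, hdeg, hrel⟩ := edge_core hA hQ hij hg hF0 hs
  have hfi' : f i = fourTerm A Q i v c := by rw [hfi, hgv]; rfl
  set δ := v - yv A i with hδ
  have hδi : δ i = -2 := by rw [hδ, Pi.sub_apply, hvi, hyi]; norm_num
  have hrel' : ∀ w, w i = -1 → F.coeff w = c * F.coeff (w - δ) := by
    intro w hw
    have := hrel (w - δ) (by rw [Pi.sub_apply, hw, hδi]; norm_num)
    rwa [sub_add_cancel] at this
  -- Translation by δ identifies the terms of x_i-degree 1 with those of x_i-degree -1. The known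
  -- terms y_j⁻¹ and y_j have degrees 1 and -1, so their translates also occur in F.
  have k1 : F.coeff (-yv A j + δ) = c * (Q j : ℂ)⁻¹ := by
    rw [hrel _ (by rw [Pi.neg_apply, hyji]; norm_num), hFy']
  have k2 : F.coeff (yv A j - δ) = (Q j : ℂ) * c⁻¹ := by
    have := hrel' _ hyji
    rw [hFy] at this
    rw [this]; field_simp
  have k1' : F.coeff (-yv A j + δ) ≠ 0 := by
    rw [k1]; exact mul_ne_zero hc (inv_ne_zero hQj)
  -- For a third node k, the bound on the x_k-degree of f_j, applied to the term -y_j + δ, gives v_k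
  -- ≤ a_{ki}. The reverse inequality is the same bound for f_i at its term x^v, which is present
  -- when v ≠ 0. When v = 0, the first inequality alone gives a_{ki} = 0.
  have hvk : (v ≠ 0 ∧ v j = -A j i ∧ ∀ k, k ≠ i → k ≠ j → v k = A k i) ∨
        (v = 0 ∧ c ^ 2 = Q i ∧ ∀ k, k ≠ i → k ≠ j → A k i = 0) := by
    have hle : ∀ k, k ≠ i → k ≠ j → v k ≤ A k i := by
      intro k hki hkj
      have := abs_le.1 (hbd _ k1' k hkj)
      simp only [Pi.add_apply, Pi.neg_apply, hδ, Pi.sub_apply, yv] at this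
      omega
    rcases hv with ⟨hv0, hvj⟩ | ⟨hv0, hcq⟩
    · refine Or.inl ⟨hv0, hvj, fun k hki hkj => le_antisymm (hle k hki hkj) ?_⟩
      have h1 : (f i).coeff v ≠ 0 := by
        rw [hfi', coeff_fourTerm hA hvi hv0]
        exact mul_ne_zero (inv_ne_zero (Q i).ne_zero) hc
      have := abs_le.1 (abs_le_of_shiftable hA hQ (hf.normal k) (hf.shift k i hki) h1)
      omega
    · refine Or.inr ⟨hv0, hcq, fun k hki hkj => ?_⟩
      have h1 := hle k hki hkj
      rw [hv0, Pi.zero_apply] at h1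
      have := hA.offDiag k i hki
      omega
  refine ⟨v, c, hc, hvi, hfi', hvk, ?_⟩
  -- The exponent -y_j + δ has x_j-degree δ_j - 2. If this is 0 it belongs to the part of f_j left
  -- free by normality. Otherwise it must be one of ±y_j; it is not -y_j, since δ ≠ 0.
  by_cases hδj : δ j = 2
  · left
    refine ⟨by rw [hδ] at hδj; exact hδj, ?_⟩
    rw [hfj, fourTerm]
    congr 1
    change G = single (δ - yv A j) ((Q j : ℂ)⁻¹ * c) + single (-(δ - yv A j)) ((Q j : ℂ) * c⁻¹)
    have hu : (δ - yv A j) j = 0 := by rw [Pi.sub_apply, hδj, hyj]; norm_num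
    have hui : (δ - yv A j) i = -1 := by rw [Pi.sub_apply, hδi, hyji]; norm_num
    have hun : -(δ - yv A j) ≠ δ - yv A j := by
      rw [Ne, eq_neg_self_iff]; intro h; rw [h] at hui; simp at hui
    ext w
    by_cases hwj : w j = 0
    · rw [hFG w hwj]
      by_cases hw1 : w = δ - yv A j
      · rw [hw1, show δ - yv A j = -yv A j + δ by abel, k1,
          show -yv A j + δ = δ - yv A j by abel]
        simp only [coeff_add, Finsupp.add_apply, coeff_single, Finsupp.single_eq_same]
        rw [Finsupp.single_eq_of_ne' hun, add_zero, mul_comm]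
      · by_cases hw2 : w = -(δ - yv A j)
        · have : F.coeff w = (Q j : ℂ) * c⁻¹ := by rw [hw2, neg_sub, k2]
          rw [this, hw2]
          simp only [coeff_add, Finsupp.add_apply, coeff_single, Finsupp.single_eq_same]
          rw [Finsupp.single_eq_of_ne' hun.symm, zero_add]
        · simp only [coeff_add, Finsupp.add_apply, coeff_single]
          rw [Finsupp.single_eq_of_ne' (Ne.symm hw1), Finsupp.single_eq_of_ne' (Ne.symm hw2),
            add_zero]
          -- Any further term of x_j-degree 0 would be translated by δ or -δ to x_j-degree 2 or -2,
          -- hence onto y_j or y_j⁻¹; so it was already one of the two listed exponents.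
          by_contra hw0
          rcases hdeg w hw0 with h1 | h1
          · have h2 : F.coeff (w + δ) ≠ 0 := by rw [hrel w h1]; exact mul_ne_zero hc hw0
            have h3 : (w + δ) j = 2 := by rw [Pi.add_apply, hwj, hδj]; norm_num
            rcases hFn _ h2 (by omega) with h4 | h4
            · exact hw2 (by rw [neg_sub, ← h4]; abel)
            · rw [h4, Pi.neg_apply] at h3; omega
          · have h2 : F.coeff (w - δ) ≠ 0 := by
              intro h0; rw [hrel' w h1, h0, mul_zero] at hw0; exact hw0 rfl
            have h3 : (w - δ) j = -2 := by rw [Pi.sub_apply, hwj, hδj]; norm_num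
            rcases hFn _ h2 (by omega) with h4 | h4
            · rw [h4] at h3; omega
            · exact hw1 (by rw [sub_eq_add_neg, ← h4]; abel)
    · have h1 : G.coeff w = 0 := by
        by_contra h; exact hwj (hG w h)
      have h2 := isHomog_zero_four hu ((Q j : ℂ)⁻¹ * c) ((Q j : ℂ) * c⁻¹)
      rw [h1]
      by_contra h
      exact hwj (h2 w (Ne.symm h))
  · right
    have h1 : (-yv A j + δ) j ≠ 0 := by
      rw [Pi.add_apply, Pi.neg_apply, hyj]; omega
    have hδ2 : -yv A j + δ = yv A j := by
      rcases hFn _ k1' h1 with h | h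
      · exact h
      · have h2 : δ = 0 := by simpa using h
        rw [h2] at hδi; simp at hδi
    have hδ3 : δ = 2 • yv A j := by
      rw [two_smul]; nth_rw 1 [← hδ2]; abel
    have hδ4 : δ j = 4 := by
      rw [hδ3, Pi.smul_apply, hyj]; norm_num
    refine ⟨hδ3, ?_, ?_, ?_⟩
    · rw [hδ2, hFy] at k1
      field_simp at k1
      exact k1.symm
    · intro k hki hkj
      have h2 := congrFun hδ3 k
      have h3 : v k = A k i := by
        rcases hvk with h | h
        · exact h.2.2 k hki hkj
        · rw [h.2.2 k hki hkj, h.1]; rfl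
      simp only [hδ, Pi.sub_apply, Pi.smul_apply, yv, h3] at h2
      simpa using h2.symm
    -- Here δ_j = 4, so a term of x_j-degree 0 would be translated to x_j-degree ±4, where a normal
    -- f_j has no terms.
    · have : G = 0 := by
        ext w
        by_cases hwj : w j = 0
        · rw [hFG w hwj]
          by_contra hw0
          change ¬ F.coeff w = 0 at hw0
          rcases hdeg w hw0 with h1 | h1
          · have h2 : F.coeff (w + δ) ≠ 0 := by rw [hrel w h1]; exact mul_ne_zero hc hw0
            have h3 : (w + δ) j = 4 := by rw [Pi.add_apply, hwj, hδ4]; norm_num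
            rcases hFn _ h2 (by omega) with h4 | h4
            · rw [h4] at h3; omega
            · rw [h4, Pi.neg_apply] at h3; omega
          · have h2 : F.coeff (w - δ) ≠ 0 := by
              intro h0; rw [hrel' w h1, h0, mul_zero] at hw0; exact hw0 rfl
            have h3 : (w - δ) j = -4 := by rw [Pi.sub_apply, hwj, hδ4]; norm_num
            rcases hFn _ h2 (by omega) with h4 | h4
            · rw [h4] at h3; omega
            · rw [h4, Pi.neg_apply] at h3; omega
        · by_contra h; exact hwj (hG w h)
      rw [hfj, this, add_zero]

/-- Let w = c x^v and t = w y_i⁻¹. Then f_i = (1 + q_i⁻² t)(q_i y_i + q_i w⁻¹), and ζ_j⁻¹ turns it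
into (1 + t)(y_i + w⁻¹). Since t has x_i-degree -2 and h has x_i-degree 1, ζ_i⁻¹ turns F = h(1 + t)
into q_i h(1 + q_i⁻² t). The factors 1 + t and 1 + q_i⁻² t change places and the product is
unchanged. -/
theorem shiftable_of_factor (hQ : IsQFamily A Q d) (hij : A i j = -1) {v : I → ℤ} {c : ℂ}
    (hc : c ≠ 0) (hv : v j = -A j i ∨ (v = 0 ∧ c ^ 2 = Q i)) {h F : Laurent I}
    (hh : IsHomog i 1 h) (hδ : (v - yv A i) i = -2)
    (hF : F = h * (1 + single (v - yv A i) c)) :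
    Shiftable Q i j (fourTerm A Q i v c) F := by
  have hq := (Q i).ne_zero
  have hκ : (Q j : ℂ) ^ A j i = (Q i : ℂ)⁻¹ := by rw [hQ.zpow_eq, hij, zpow_neg_one]
  have h1 : fourTerm A Q i v c = (1 + single (v - yv A i) (((Q i : ℂ) ^ 2)⁻¹ * c)) *
      (single (yv A i) (Q i : ℂ) + single (-v) ((Q i : ℂ) * c⁻¹)) := by
    rw [one_def, add_mul, mul_add, mul_add, single_mul_single, single_mul_single,
      single_mul_single, single_mul_single, fourTerm, twoTerm, sub_add_cancel,
      show v - yv A i + -v = -yv A i by abel, zero_add, zero_add, one_mul, one_mul,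
      show ((Q i : ℂ) ^ 2)⁻¹ * c * Q i = (Q i : ℂ)⁻¹ * c by field_simp,
      show ((Q i : ℂ) ^ 2)⁻¹ * c * (Q i * c⁻¹) = (Q i : ℂ)⁻¹ by field_simp]
    abel
  have h2 : (zeta Q j).symm (fourTerm A Q i v c) = (1 + single (v - yv A i) c) *
      (single (yv A i) 1 + single (-v) c⁻¹) := by
    have e1 : (1 + single (v - yv A i) c) * (single (yv A i) 1 + single (-v) c⁻¹) =
        (single (yv A i) 1 + single (-yv A i) 1 + (single v c + single (-v) c⁻¹) : Laurent I) := by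
      rw [one_def, add_mul, mul_add, mul_add, single_mul_single, single_mul_single,
        single_mul_single, single_mul_single, sub_add_cancel,
        show v - yv A i + -v = -yv A i by abel, zero_add, zero_add, one_mul, one_mul, mul_one,
        mul_inv_cancel₀ hc]
      abel
    rw [e1, fourTerm, twoTerm, map_add, map_add, map_add, zeta_symm_single, zeta_symm_single,
      zeta_symm_single, zeta_symm_single, Pi.neg_apply, Pi.neg_apply, zpow_neg, zpow_neg]
    have e2 : (Q j : ℂ) ^ yv A i j = (Q i : ℂ)⁻¹ := hκ
    rw [e2, inv_mul_cancel₀ hq, inv_inv, mul_inv_cancel₀ hq]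
    congr 1
    rcases hv with hv | ⟨rfl, hv⟩
    · rw [hv, zpow_neg, hκ, inv_inv]
      congr 2 <;> field_simp
    · simp only [Pi.zero_apply, zpow_zero, neg_zero, inv_one, one_mul]
      rw [← single_add, ← single_add]
      congr 1
      rw [← hv]
      field_simp
      ring
  have h3 : (zeta Q i).symm F = (Q i : ℂ) • (h * (1 + single (v - yv A i) (((Q i : ℂ) ^ 2)⁻¹ * c))) := by
    rw [hF, map_mul, map_add, map_one, zeta_symm_single, hδ]
    have e1 : (zeta Q i).symm h = (Q i : ℂ) • h := by
      ext w
      rw [coeff_zeta_symm, coeff_smul, Finsupp.smul_apply, smul_eq_mul]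
      by_cases hw : h.coeff w = 0
      · rw [hw]; simp
      · rw [hh w hw, zpow_one]
    rw [e1, smul_mul_assoc]
    norm_cast
  unfold Shiftable
  rw [h2, h3, h1, hF]
  have h4 : (single (yv A i) (Q i : ℂ) + single (-v) ((Q i : ℂ) * c⁻¹) : Laurent I) =
      (Q i : ℂ) • (single (yv A i) 1 + single (-v) c⁻¹) := by simp
  rw [h4, mul_smul_comm, smul_mul_assoc, mul_smul_comm]
  congr 1
  ring

theorem shiftable_fourTerm (hA : IsGCM A) (hQ : IsQFamily A Q d) (hij : A i j = -1)
    {v : I → ℤ} {c : ℂ} (hc : c ≠ 0) (hvi : v i = 0)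
    (hv : v j = -A j i ∨ (v = 0 ∧ c ^ 2 = Q i)) :
    Shiftable Q i j (fourTerm A Q i v c) (fourTerm A Q j (v - yv A i - yv A j) c) := by
  have hQj := (Q j).ne_zero
  have hδ : (v - yv A i) i = -2 := by
    rw [Pi.sub_apply, hvi, yv, hA.diag]; norm_num
  have hyji : yv A j i = -1 := hij
  -- The cofactor is the part of f_j of degree 1 in x_i: the terms y_j⁻¹ and y_j x^{-δ}, whose
  -- translates by δ are the other two terms.
  refine shiftable_of_factor hQ hij hc hv (h := single (-yv A j) (Q j : ℂ)⁻¹ +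
    single (yv A j - (v - yv A i)) ((Q j : ℂ) * c⁻¹)) ?_ hδ ?_
  · intro w hw
    by_contra hne
    apply hw
    have h1 : -yv A j ≠ w := by rintro rfl; simp [hyji] at hne
    have h2 : yv A j - (v - yv A i) ≠ w := by
      rintro rfl; apply hne; rw [Pi.sub_apply, hyji, hδ]; norm_num
    simp [Finsupp.single_eq_of_ne' h1, Finsupp.single_eq_of_ne' h2]
  · rw [one_def, add_mul, mul_add, mul_add, single_mul_single, single_mul_single,
      single_mul_single, single_mul_single, fourTerm, twoTerm, sub_add_cancel, add_zero, add_zero,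
      mul_one, mul_one, inv_mul_cancel_right₀ hc,
      show -yv A j + (v - yv A i) = v - yv A i - yv A j by abel,
      show -(v - yv A i - yv A j) = yv A j - (v - yv A i) by abel]
    abel

theorem shiftable_twoTerm (hA : IsGCM A) (hQ : IsQFamily A Q d) (hij : A i j = -1)
    {v : I → ℤ} {c : ℂ} (hvi : v i = 0) (hv : v j = -A j i ∨ (v = 0 ∧ c ^ 2 = Q i))
    (hδ' : v - yv A i = 2 • yv A j) (hcj : c = (Q j : ℂ) ^ 2) :
    Shiftable Q i j (fourTerm A Q i v c) (twoTerm A Q j) := by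
  have hQj := (Q j).ne_zero
  have hc : c ≠ 0 := by rw [hcj]; exact pow_ne_zero _ hQj
  have hδ : (v - yv A i) i = -2 := by
    rw [Pi.sub_apply, hvi, yv, hA.diag]; norm_num
  have hyji : yv A j i = -1 := hij
  refine shiftable_of_factor hQ hij hc hv (h := single (-yv A j) (Q j : ℂ)⁻¹) ?_ hδ ?_
  · have := isHomog_single i (-yv A j) (Q j : ℂ)⁻¹
    rwa [Pi.neg_apply, hyji, neg_neg] at this
  · rw [one_def, mul_add, single_mul_single, single_mul_single, twoTerm, hδ', add_zero, mul_one,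
      hcj, show -yv A j + 2 • yv A j = yv A j by rw [two_smul]; abel,
      show (Q j : ℂ)⁻¹ * (Q j : ℂ) ^ 2 = Q j by field_simp, add_comm]

theorem zeta_symm_of_forall_eq_zero {f : Laurent I} (h : ∀ w, f.coeff w ≠ 0 → w j = 0) :
    (zeta Q j).symm f = f := by
  ext w
  rw [coeff_zeta_symm]
  by_cases hw : f.coeff w = 0
  · rw [hw, mul_zero]
  · rw [h w hw, zpow_zero, one_mul]

/-- Covers non-adjacent nodes: both shifts act trivially, so shiftability holds automatically. -/
theorem shiftable_of_isHomog {f g : Laurent I} (hf : IsHomog j 0 f) (hg : IsHomog i 0 g) :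
    Shiftable Q i j f g := by
  unfold Shiftable
  rw [zeta_symm_of_forall_eq_zero hf, zeta_symm_of_forall_eq_zero hg]

theorem isHomog_twoTerm (h : A j i = 0) : IsHomog j 0 (twoTerm A Q i) := by
  intro w hw
  rcases coeff_twoTerm_ne_zero hw with rfl | rfl <;> simp [yv, h]

theorem isHomog_fourTerm (h : A j i = 0) {v : I → ℤ} (hv : v j = 0) (c : ℂ) :
    IsHomog j 0 (fourTerm A Q i v c) := by
  intro w hw
  by_contra h0
  apply hw
  have h1 : (twoTerm A Q i).coeff w = 0 := by
    by_contra h1; exact h0 (isHomog_twoTerm h w h1)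
  have h2 := isHomog_zero_four hv ((Q i : ℂ)⁻¹ * c) ((Q i : ℂ) * c⁻¹)
  rw [fourTerm, coeff_add, Finsupp.add_apply, h1, zero_add]
  by_contra h3
  exact h0 (h2 w h3)

end edge

/-! ### Passing between φ_i and f_i, and expanding products of braces -/

section normalization

variable {I : Type*}

open AddMonoidAlgebra

theorem mono_add (v w : I → ℤ) : (mono (v + w) : (Laurent I)ˣ) = mono v * mono w := by
  ext1
  simp [mono, single_mul_single]

theorem mono_zero : (mono 0 : (Laurent I)ˣ) = 1 := by
  ext1
  simp [mono, one_def]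

theorem mono_neg (v : I → ℤ) : (mono (-v) : (Laurent I)ˣ) = (mono v)⁻¹ := by
  rw [eq_inv_iff_mul_eq_one, ← mono_add, neg_add_cancel, mono_zero]

/-- Monomials, as a group homomorphism. -/
def monoHom : Multiplicative (I → ℤ) →* (Laurent I)ˣ where
  toFun v := mono v.toAdd
  map_one' := mono_zero
  map_mul' _ _ := mono_add _ _

theorem mono_zsmul (v : I → ℤ) (n : ℤ) : (mono (n • v) : (Laurent I)ˣ) = mono v ^ n :=
  map_zpow monoHom (Multiplicative.ofAdd v) n

theorem mono_sum {ι : Type*} (s : Finset ι) (v : ι → I → ℤ) :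
    (mono (∑ k ∈ s, v k) : (Laurent I)ˣ) = ∏ k ∈ s, mono (v k) :=
  map_prod monoHom (fun k => Multiplicative.ofAdd (v k)) s

theorem y_eq_mono [Fintype I] [DecidableEq I] (A : Matrix I I ℤ) (i : I) :
    y A i = mono (yv A i) := by
  have h : yv A i = ∑ j, A j i • (Pi.single j 1 : I → ℤ) := by
    rw [pi_eq_sum_univ' (yv A i)]
    rfl
  rw [h, mono_sum]
  exact Finset.prod_congr rfl fun j _ => (mono_zsmul _ _).symm

theorem brace_scal_mono (c a : ℂˣ) (v : I → ℤ) :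
    brace c (scal a * mono v) =
      ((c : ℂ) - (c : ℂ)⁻¹)⁻¹ • (single v (a : ℂ) - single (-v) (a : ℂ)⁻¹) := by
  have h1 : ∀ (b : ℂˣ) (w : I → ℤ), ((scal b * mono w : (Laurent I)ˣ) : Laurent I) =
      single w (b : ℂ) := by
    intro b w
    simp [scal, mono, coe_algebraMap, single_mul_single]
  have h2 : ((scal a * mono v : (Laurent I)ˣ))⁻¹ = scal a⁻¹ * mono (-v) := by
    rw [mono_neg, mul_inv]
    congr 1
  rw [brace, h2, h1, h1]
  simp

theorem brace_mono (c : ℂˣ) (v : I → ℤ) :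
    brace c (mono v) =
      ((c : ℂ) - (c : ℂ)⁻¹)⁻¹ • (single v (1 : ℂ) - single (-v) (1 : ℂ)) := by
  have := brace_scal_mono c 1 v
  simpa [scal] using this

/-- The brace is odd both under u ↦ u⁻¹ and under u ↦ -u, hence invariant under u ↦ -u⁻¹. -/
theorem brace_scal_mono_neg (c a : ℂˣ) (v : I → ℤ) :
    brace c (scal a * mono v) = brace c (scal (-a⁻¹) * mono (-v)) := by
  rw [brace_scal_mono, brace_scal_mono, neg_neg]
  congr 1
  have h : ∀ (w : I → ℤ) (b : ℂ), (single w (-b) : Laurent I) = -single w b := fun w b => by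
    rw [← neg_one_mul, ← smul_eq_mul, ← smul_single, neg_one_smul]
  simp only [Units.val_neg, Units.val_inv_eq_inv_val, inv_neg, inv_inv, h]
  abel

/-- The factor `-(q_i - q_i⁻¹)²` used to normalize the unknowns. -/
def scaleFactor (Q : I → ℂˣ) (i : I) : ℂ := -((Q i : ℂ) - (Q i : ℂ)⁻¹) ^ 2

variable {A : Matrix I I ℤ} {Q : I → ℂˣ} {d : I → ℚ} {i j : I}

theorem IsQFamily.scaleFactor_ne_zero (hQ : IsQFamily A Q d) (i : I) : scaleFactor Q i ≠ 0 :=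
  neg_ne_zero.2 (pow_ne_zero _ (hQ.sub_inv_ne_zero i))

/-- Because q_i is not a root of unity, the fixed points of ζ_i are exactly the Laurent polynomials
of degree 0 in x_i; normality means that f differs from the two-term expression by such a fixed
point. -/
theorem isNormal_iff (hQ : IsQFamily A Q d) {f : Laurent I} :
    IsNormal A Q i f ↔ zeta Q i f - f = zeta Q i (twoTerm A Q i) - twoTerm A Q i := by
  constructor
  · rintro ⟨g, hg, rfl⟩
    rw [← twoTerm, map_add]
    have : zeta Q i g = g := by
      have h := congrArg (zeta Q i) (zeta_symm_of_forall_eq_zero (Q := Q) hg)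
      rw [AlgEquiv.apply_symm_apply] at h
      exact h.symm
    rw [this]
    abel
  · intro h
    refine ⟨f - twoTerm A Q i, ?_, by rw [← twoTerm]; abel⟩
    have h1 : zeta Q i (f - twoTerm A Q i) = f - twoTerm A Q i := by
      rw [map_sub]; linear_combination (exp := 1) h
    intro v hv
    have h2 := congrArg (fun f : Laurent I => f.coeff v) h1
    simp only [coeff_zeta] at h2
    have h3 := mul_right_cancel₀ hv (h2.trans (one_mul _).symm)
    exact (hQ.zpow_eq_one i _).1 (inv_eq_one.1 h3)

/-- The scale factor is chosen so that the two-term expression t satisfies ζ_i(t) - t = -(q_i -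
q_i⁻¹)² {y_i}_i. -/
theorem normal_eq_iff [Fintype I] [DecidableEq I] (hA : IsGCM A) (hQ : IsQFamily A Q d)
    {φ : Laurent I} :
    zeta Q i φ - φ = brace (Q i) (y A i) ↔ IsNormal A Q i (scaleFactor Q i • φ) := by
  have hq := (Q i).ne_zero
  have hs := hQ.sub_inv_ne_zero i
  have h1 : zeta Q i (twoTerm A Q i) - twoTerm A Q i =
      scaleFactor Q i • brace (Q i) (y A i) := by
    have e : ∀ v r, zeta Q i (single v r : Laurent I) = single v (((Q i : ℂ) ^ v i)⁻¹ * r) := by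
      intro v r
      have : (Q i : ℂ) ^ v i ≠ 0 := zpow_ne_zero _ hq
      rw [← (zeta Q i).apply_symm_apply (single v (((Q i : ℂ) ^ v i)⁻¹ * r)), zeta_symm_single,
        mul_inv_cancel_left₀ this]
    rw [y_eq_mono, brace_mono, smul_smul, twoTerm, map_add, e, e, smul_sub, smul_single,
      smul_single, scaleFactor]
    have hyi : yv A i i = 2 := hA.diag i
    have e2 : ∀ (v : I → ℤ) (a b : ℂ), (single v (a + b) : Laurent I) = single v a + single v b :=
      fun v a b => single_add v a b
    have e3 : ∀ (v : I → ℤ) (a : ℂ), (single v (-a) : Laurent I) = -single v a := fun v a => by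
      rw [eq_neg_iff_add_eq_zero, ← single_add, neg_add_cancel, single_zero]
    have e4 : -((Q i : ℂ) - (Q i : ℂ)⁻¹) ^ 2 * ((Q i : ℂ) - (Q i : ℂ)⁻¹)⁻¹ =
        (Q i : ℂ)⁻¹ + -(Q i : ℂ) := by
      rw [sq, neg_mul, mul_assoc, mul_inv_cancel₀ hs]; ring
    have e5 : ((Q i : ℂ) ^ 2)⁻¹ * Q i = (Q i : ℂ)⁻¹ := by field_simp
    rw [Pi.neg_apply, hyi, e4, smul_eq_mul, mul_one, e2, e2, e3, e3, zpow_neg,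
      inv_inv, zpow_ofNat, e5, show (Q i : ℂ) ^ 2 * (Q i : ℂ)⁻¹ = Q i by field_simp]
    abel
  rw [isNormal_iff hQ, h1, map_smul, ← smul_sub]
  exact (smul_right_injective _ (hQ.scaleFactor_ne_zero i)).eq_iff.symm

theorem isSolution_iff [Fintype I] [DecidableEq I] (hA : IsGCM A) (hQ : IsQFamily A Q d)
    {φ : I → Laurent I} :
    IsSolution A Q φ ↔ IsNormalSolution A Q fun i => scaleFactor Q i • φ i := by
  constructor
  · rintro ⟨h1, h2⟩
    exact ⟨fun i => (normal_eq_iff hA hQ).1 (h1 i), fun i j hij =>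
      (shiftable_smul (hQ.scaleFactor_ne_zero i) (hQ.scaleFactor_ne_zero j)).2 (h2 i j hij)⟩
  · rintro ⟨h1, h2⟩
    exact ⟨fun i => (normal_eq_iff hA hQ).2 (h1 i), fun i j hij =>
      (shiftable_smul (hQ.scaleFactor_ne_zero i) (hQ.scaleFactor_ne_zero j)).1 (h2 i j hij)⟩

theorem scaleFactor_smul_eq_iff (hQ : IsQFamily A Q d) {f g h : Laurent I}
    (hg : scaleFactor Q i • g = h) : scaleFactor Q i • f = h ↔ f = g := by
  rw [← hg]
  exact (smul_right_injective _ (hQ.scaleFactor_ne_zero i)).eq_iff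

/-- The four products in the expansion are exactly the four terms: the mixed ones give q_i y_i and
its inverse, because x^{v-w} = y_i and a/b = q_i, and the others give the term with constant c =
-q_i² b². -/
theorem scaleFactor_smul_brace_mul_brace (hQ : IsQFamily A Q d) {v w : I → ℤ} {a b : ℂˣ}
    (hvw : v - w = yv A i) (hab : a = Q i * b) :
    scaleFactor Q i • (brace (Q i) (scal a * mono v) * brace (Q i) (scal b * mono w)) =
      fourTerm A Q i (v + w) (-((Q i : ℂ) ^ 2 * (b : ℂ) ^ 2)) := by
  have hs := hQ.sub_inv_ne_zero i
  have hq := (Q i).ne_zero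
  have hb := b.ne_zero
  rw [brace_scal_mono, brace_scal_mono, smul_mul_smul_comm, smul_smul, scaleFactor,
    show -((Q i : ℂ) - (Q i : ℂ)⁻¹) ^ 2 * (((Q i : ℂ) - (Q i : ℂ)⁻¹)⁻¹ *
      ((Q i : ℂ) - (Q i : ℂ)⁻¹)⁻¹) = -1 by generalize (Q i : ℂ) - (Q i : ℂ)⁻¹ = s at hs; field_simp,
    fourTerm, twoTerm, ← hvw, hab, Units.val_mul]
  have e3 : ∀ (v : I → ℤ) (a : ℂ), (single v (-a) : Laurent I) = -single v a := fun v a => by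
    rw [eq_neg_iff_add_eq_zero, ← single_add, neg_add_cancel, single_zero]
  rw [sub_mul, mul_sub, mul_sub, single_mul_single, single_mul_single, single_mul_single,
    single_mul_single, mul_neg, inv_neg, mul_neg, e3, e3, neg_one_smul,
    show v + -w = v - w by abel, show -v + w = -(v - w) by abel,
    show -v + -w = -(v + w) by abel, show (Q i : ℂ) * b * (b : ℂ)⁻¹ = Q i by field_simp,
    show ((Q i : ℂ) * b)⁻¹ * b = (Q i : ℂ)⁻¹ by field_simp,
    show (Q i : ℂ)⁻¹ * ((Q i : ℂ) ^ 2 * (b : ℂ) ^ 2) = Q i * b * b by field_simp,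
    show (Q i : ℂ) * ((Q i : ℂ) ^ 2 * (b : ℂ) ^ 2)⁻¹ = (Q i * b : ℂ)⁻¹ * (b : ℂ)⁻¹ by field_simp]
  abel

/-- A single brace has two terms of opposite sign; the factor ι in the coefficient together with the
one in a makes both signs positive. This is the form of φ_i at a node with g_i = 0. -/
theorem scaleFactor_smul_I_smul_brace (hQ : IsQFamily A Q d) {v : I → ℤ} {a : ℂˣ}
    (h : (v = yv A i ∧ (a : ℂ) = Complex.I * Q i) ∨
      (v = -yv A i ∧ (a : ℂ) = Complex.I * (Q i : ℂ)⁻¹)) :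
    scaleFactor Q i • ((Complex.I / ((Q i : ℂ) - (Q i : ℂ)⁻¹)) • brace (Q i) (scal a * mono v)) =
      twoTerm A Q i := by
  have hs := hQ.sub_inv_ne_zero i
  have hq := (Q i).ne_zero
  have hI := Complex.I_mul_I
  rw [brace_scal_mono, smul_smul, smul_smul, scaleFactor,
    show -((Q i : ℂ) - (Q i : ℂ)⁻¹) ^ 2 * (Complex.I / ((Q i : ℂ) - (Q i : ℂ)⁻¹)) *
      ((Q i : ℂ) - (Q i : ℂ)⁻¹)⁻¹ = -Complex.I by
        generalize (Q i : ℂ) - (Q i : ℂ)⁻¹ = s at hs; field_simp,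
    smul_sub, smul_single, smul_single, twoTerm, sub_eq_add_neg, ← neg_one_smul ℂ (single (-v) _),
    smul_single]
  rcases h with ⟨rfl, ha⟩ | ⟨rfl, ha⟩
  · rw [ha]
    congr 2
    · simp only [smul_eq_mul]; linear_combination (-(Q i : ℂ)) * hI
    · simp only [smul_eq_mul, mul_inv, Complex.inv_I]; linear_combination (-(Q i : ℂ)⁻¹) * hI
  · rw [ha, add_comm, neg_neg]
    congr 2
    · simp only [smul_eq_mul, mul_inv, Complex.inv_I, inv_inv]
      linear_combination (-(Q i : ℂ)) * hI
    · simp only [smul_eq_mul]; linear_combination (-(Q i : ℂ)⁻¹) * hI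

end normalization

/-! ### Numerical labels, the symmetrizer d_i = a_i^∨/a_i, and powers of q -/

section labels

variable {I : Type*}

theorem IsGCM.transpose {A : Matrix I I ℤ} (hA : IsGCM A) : IsGCM A.transpose where
  diag := hA.diag
  offDiag i j h := hA.offDiag j i h.symm
  zero i j := hA.zero j i

theorem IsIndecomposable.transpose {A : Matrix I I ℤ} (hA : IsGCM A) (h : IsIndecomposable A) :
    IsIndecomposable A.transpose := fun S hS hS' => by
  obtain ⟨i, hi, j, hj, hij⟩ := h S hS hS'
  exact ⟨i, hi, j, hj, fun h0 => hij (hA.zero j i h0)⟩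

/-- Positive null vectors of an indecomposable generalized Cartan matrix are proportional. -/
theorem exists_eq_mul_of_null [Fintype I] [Nonempty I] {A : Matrix I I ℤ} (hA : IsGCM A)
    (h : IsIndecomposable A) {u w : I → ℚ} (hw : ∀ i, 0 < w i)
    (hu0 : ∀ i, ∑ j, (A i j : ℚ) * u j = 0) (hw0 : ∀ i, ∑ j, (A i j : ℚ) * w j = 0) :
    ∃ t, ∀ i, u i = t * w i := by
  -- With t the minimal ratio u_i/w_i, the vector u - t w is nonnegative, is still null and vanishes
  -- somewhere. A row where it vanishes is a sum of nonpositive terms, so it vanishes at all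
  -- neighbours too.
  obtain ⟨i₀, hi₀⟩ := Finite.exists_min fun i => u i / w i
  set t := u i₀ / w i₀ with ht
  have hle : ∀ i, 0 ≤ u i - t * w i := fun i => by
    have := (le_div_iff₀ (hw i)).1 (hi₀ i)
    linarith
  refine ⟨t, ?_⟩
  by_contra hne
  push Not at hne
  obtain ⟨k, hk⟩ := hne
  obtain ⟨i, hi, j, hj, hij⟩ := h {i | u i = t * w i} ⟨i₀, by
    simp only [Set.mem_ofPred_eq, ht]; field_simp [(hw i₀).ne']⟩ ⟨k, hk⟩
  simp only [Set.mem_ofPred_eq, Set.mem_compl_iff] at hi hj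
  have hsum : ∑ k, (A i k : ℚ) * (u k - t * w k) = 0 := by
    have : ∑ k, (A i k : ℚ) * (u k - t * w k) =
        ∑ k, (A i k : ℚ) * u k - t * ∑ k, (A i k : ℚ) * w k := by
      rw [Finset.mul_sum, ← Finset.sum_sub_distrib]
      exact Finset.sum_congr rfl fun k _ => by ring
    rw [this, hu0, hw0]; ring
  have hterm : ∀ k ∈ Finset.univ, (A i k : ℚ) * (u k - t * w k) ≤ 0 := by
    intro k _
    by_cases hki : i = k
    · rw [← hki, hi, sub_self, mul_zero]
    · exact mul_nonpos_of_nonpos_of_nonneg (by exact_mod_cast hA.offDiag i k hki) (hle k)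
  have h1 := (Finset.sum_eq_zero_iff_of_nonpos hterm).1 hsum j (Finset.mem_univ _)
  rcases mul_eq_zero.1 h1 with h2 | h2
  · exact hij (by exact_mod_cast h2)
  · exact hj (by linarith)

/-- If D is any symmetrizer, then (D_i a_i) is a positive null vector of Aᵀ, as is a^∨. The two are
proportional, so a_i^∨/a_i is a multiple of D_i. -/
theorem labels_symmetrize [Fintype I] {A : Matrix I I ℤ} (hA : IsAffineCartan A) {a a' : I → ℕ}
    (ha : IsLabels A a) (ha' : IsLabels A.transpose a') (i j : I) :
    ((a' i : ℚ) / a i) * A i j = ((a' j : ℚ) / a j) * A j i := by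
  have := hA.nonempty
  obtain ⟨D, hD, hDs⟩ := hA.symmetrizable
  have hpos : ∀ i, 0 < (a i : ℚ) := fun i => by exact_mod_cast ha.pos i
  obtain ⟨t, ht⟩ := exists_eq_mul_of_null hA.gcm.transpose
    (hA.indecomposable.transpose hA.gcm) (u := fun i => (a' i : ℚ)) (w := fun i => D i * a i)
    (fun i => mul_pos (hD i) (hpos i)) (fun i => by exact_mod_cast ha'.null i) (fun i => by
      have h1 : ∑ j, (A.transpose i j : ℚ) * (D j * a j) = D i * ∑ j, (A i j : ℚ) * a j := by
        rw [Finset.mul_sum]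
        refine Finset.sum_congr rfl fun j _ => ?_
        rw [Matrix.transpose_apply]
        linear_combination (-(a j : ℚ)) * hDs i j
      have h2 : ∑ j, (A i j : ℚ) * a j = 0 := by exact_mod_cast ha.null i
      rw [h1, h2, mul_zero])
  have h1 : ∀ i, (a' i : ℚ) / a i = t * D i := fun i => by
    have := (hpos i).ne'
    rw [ht i]; field_simp
  rw [h1, h1]
  linear_combination t * hDs i j

theorem coe_qpow (ħ : ℂ) (s : ℚ) : (qpow ħ s : ℂ) = Complex.exp (s * ħ) := rfl

theorem qpow_add (ħ : ℂ) (s t : ℚ) : qpow ħ (s + t) = qpow ħ s * qpow ħ t := by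
  ext1
  rw [Units.val_mul, coe_qpow, coe_qpow, coe_qpow, ← Complex.exp_add]
  push_cast; ring_nf

theorem qpow_zpow (ħ : ℂ) (s : ℚ) (n : ℤ) : qpow ħ s ^ n = qpow ħ (s * n) := by
  ext1
  rw [Units.val_zpow_eq_zpow_val, coe_qpow, coe_qpow, ← Complex.exp_int_mul]
  push_cast; ring_nf

theorem qpow_pow (ħ : ℂ) (s : ℚ) (n : ℕ) : qpow ħ s ^ n = qpow ħ (s * n) := by
  rw [← zpow_natCast, qpow_zpow]; norm_cast

theorem qpow_zero (ħ : ℂ) : qpow ħ 0 = 1 := by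
  ext1; rw [coe_qpow]; simp

theorem qpow_neg (ħ : ℂ) (s : ℚ) : qpow ħ (-s) = (qpow ħ s)⁻¹ := by
  rw [eq_inv_iff_mul_eq_one, ← qpow_add, neg_add_cancel, qpow_zero]

theorem qpow_eq_one_iff {ħ : ℂ} (hq : ∀ m : ℕ, 0 < m → Complex.exp ħ ^ m ≠ 1) {s : ℚ} :
    qpow ħ s = 1 ↔ s = 0 := by
  constructor
  · intro h
    -- Raising q^s = 1 to the power of the denominator of s gives an integral power of q equal to 1.
    have h1 : Complex.exp ħ ^ s.num = 1 := by
      have h2 : qpow ħ s ^ s.den = 1 := by rw [h, one_pow]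
      rw [qpow_pow, Rat.mul_den_eq_num] at h2
      have h3 : (qpow ħ s.num : ℂ) = 1 := by rw [h2]; rfl
      rw [coe_qpow] at h3
      rw [← Complex.exp_int_mul, ← h3]
      norm_cast
    by_contra hs
    have h4 : 0 < s.num.natAbs := Int.natAbs_pos.2 (Rat.num_ne_zero.2 hs)
    apply hq _ h4
    rcases Int.natAbs_eq s.num with h5 | h5
    · rw [h5, zpow_natCast] at h1; exact h1
    · rw [h5, zpow_neg, inv_eq_one, zpow_natCast] at h1; exact h1
  · rintro rfl; exact qpow_zero ħ

theorem isQFamily_qi [Fintype I] {A : Matrix I I ℤ} (hA : IsAffineCartan A) {a a' : I → ℕ}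
    (ha : IsLabels A a) (ha' : IsLabels A.transpose a') {ħ : ℂ}
    (hq : ∀ m : ℕ, 0 < m → Complex.exp ħ ^ m ≠ 1) :
    IsQFamily A (qi ħ a a') fun i => (a' i : ℚ) / a i where
  pos i := div_pos (by exact_mod_cast ha'.pos i) (by exact_mod_cast ha.pos i)
  symm := labels_symmetrize hA ha ha'
  pow i j m n := by
    rw [← Units.val_zpow_eq_zpow_val, ← Units.val_zpow_eq_zpow_val, ← Units.val_mul,
      Units.val_eq_one, qi, qi, qpow_zpow, qpow_zpow, ← qpow_add, qpow_eq_one_iff hq]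

end labels

/-! ### Type A_n^{(1)}, including the rank two case -/

section cyclic

variable {I : Type*} [DecidableEq I]

open AddMonoidAlgebra

variable {A : Matrix I I ℤ} {Q : I → ℂˣ} {d : I → ℚ} {i j : I} {f : I → Laurent I}

omit [DecidableEq I] in
theorem IsQFamily.eq_of_eq (hQ : IsQFamily A Q d) (h : A i j = A j i) (h0 : A i j ≠ 0) :
    Q i = Q j := by
  have h1 := hQ.symm i j
  rw [← h] at h1
  have h2 : d i = d j := mul_right_cancel₀ (by exact_mod_cast h0) h1
  have h3 := (hQ.pow i j 1 (-1)).2 (by rw [h2]; push_cast; ring)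
  rw [zpow_one, zpow_neg_one] at h3
  ext1
  exact eq_of_mul_inv_eq_one h3

/-- Shiftability along a simply laced edge. -/
theorem IsNormalSolution.simple_edge (hA : IsGCM A) (hQ : IsQFamily A Q d)
    (hf : IsNormalSolution A Q f) (hne : i ≠ j) (hij : A i j = -1) (hji : A j i = -1) :
    ∃ c, c ≠ 0 ∧
      f i = fourTerm A Q i (yv A i - 2 • Pi.single i 1 + 2 • Pi.single j 1) c ∧
      f j = fourTerm A Q j (2 • Pi.single j 1 - 2 • Pi.single i 1 - yv A j) c := by
  obtain ⟨v, c, hc, hvi, hfi, hv, hj⟩ := hf.edge hA hQ hne hij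
  have hj' : v j = 1 ∧ f j = fourTerm A Q j (v - yv A i - yv A j) c := by
    rcases hj with ⟨h1, h2⟩ | ⟨h1, -⟩
    · exact ⟨by omega, h2⟩
    · have := congrFun h1 j
      simp only [Pi.sub_apply, Pi.smul_apply, yv, hji, hA.diag] at this
      rcases hv with h | h
      · rw [h.2.1, hji] at this; norm_num at this
      · rw [h.1] at this; norm_num at this
  have hveq : v = yv A i - 2 • Pi.single i 1 + 2 • Pi.single j 1 := by
    rcases hv with h | h
    · funext k
      simp only [Pi.add_apply, Pi.sub_apply, Pi.smul_apply, yv]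
      by_cases hki : k = i
      · subst hki; rw [hvi, hA.diag, Pi.single_eq_same, Pi.single_eq_of_ne hne]; norm_num
      · by_cases hkj : k = j
        · subst hkj; rw [hj'.1, hji, Pi.single_eq_same, Pi.single_eq_of_ne hki]; norm_num
        · rw [h.2.2 k hki hkj, Pi.single_eq_of_ne hki, Pi.single_eq_of_ne hkj]; norm_num
    · rw [h.1] at hj'; simp at hj'
  refine ⟨c, hc, hveq ▸ hfi, ?_⟩
  rw [hj'.2, hveq]
  congr 1
  abel

theorem fin_const {α : Type*} {n : ℕ} {g : Fin (n + 1) → α} (h : ∀ i, g i = g (i + 1))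
    (i : Fin (n + 1)) : g i = g 0 := by
  induction i using Fin.induction with
  | zero => rfl
  | succ k ih => rw [← ih, h k.castSucc, Fin.coeSucc_eq_succ]

theorem yv_cartanA {n : ℕ} {e : Fin (n + 1) ≃ I} (he : IsNumbering A (cartanA n) e)
    (i : Fin (n + 1)) : yv A (e i) =
      2 • Pi.single (e i) 1 - Pi.single (e (i - 1)) 1 - Pi.single (e (i + 1)) 1 := by
  funext k
  obtain ⟨m, rfl⟩ := e.surjective k
  simp only [yv, he m i, cartanA, Matrix.of_apply, Pi.sub_apply, Pi.smul_apply, Pi.single_apply,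
    e.injective.eq_iff, eq_sub_iff_add_eq, eq_comm (a := m + 1)]
  split_ifs <;> simp

/-- The exponent vector of `z_i z_{i+1}` in type `A_n^{(1)}`. -/
def cycVec {n : ℕ} (e : Fin (n + 1) ≃ I) (i : Fin (n + 1)) : I → ℤ :=
  Pi.single (e (i + 1)) 1 - Pi.single (e (i - 1)) 1

theorem Fin.ne_add_one {n : ℕ} (hn : 1 ≤ n) (i : Fin (n + 1)) : i ≠ i + 1 := by
  intro h
  have : (1 : Fin (n + 1)) = 0 := by
    rwa [eq_comm, add_eq_left] at h
  have := congrArg Fin.val this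
  rw [Fin.val_one' , Fin.val_zero, Nat.mod_eq_of_lt (by omega)] at this
  omega

theorem Fin.ne_add_two {n : ℕ} (hn : 2 ≤ n) (i : Fin (n + 1)) : i ≠ i + 1 + 1 := by
  intro h
  have h1 : (1 + 1 : Fin (n + 1)) = 0 := by
    rwa [eq_comm, add_assoc, add_eq_left] at h
  have := congrArg Fin.val h1
  rw [Fin.val_add, Fin.val_one', Fin.val_zero, Nat.mod_eq_of_lt (show 1 < n + 1 by omega),
    Nat.mod_eq_of_lt (by omega)] at this
  omega

theorem cycVec_self {n : ℕ} (hn : 1 ≤ n) (e : Fin (n + 1) ≃ I) (i : Fin (n + 1)) :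
    cycVec e i (e i) = 0 := by
  have h1 := Fin.ne_add_one hn i
  have h2 := Fin.ne_add_one hn (i - 1)
  rw [sub_add_cancel] at h2
  rw [cycVec, Pi.sub_apply, Pi.single_eq_of_ne (e.injective.ne h1),
    Pi.single_eq_of_ne (e.injective.ne h2.symm), sub_zero]

theorem cycVec_ne_zero {n : ℕ} (hn : 2 ≤ n) (e : Fin (n + 1) ≃ I) (i : Fin (n + 1)) :
    cycVec e i (e (i + 1)) = 1 := by
  have h2 := Fin.ne_add_two hn (i - 1)
  rw [sub_add_cancel] at h2
  rw [cycVec, Pi.sub_apply, Pi.single_eq_same, Pi.single_eq_of_ne (e.injective.ne h2.symm),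
    sub_zero]

theorem cycVec_recursion {n : ℕ} {e : Fin (n + 1) ≃ I} (he : IsNumbering A (cartanA n) e)
    (i : Fin (n + 1)) :
    cycVec e i - yv A (e i) - yv A (e (i + 1)) = cycVec e (i + 1) := by
  rw [yv_cartanA he, yv_cartanA he, cycVec, cycVec, add_sub_cancel_right]
  abel

theorem cartanA_apply_succ {n : ℕ} (hn : 2 ≤ n) (i : Fin (n + 1)) :
    cartanA n i (i + 1) = -1 ∧ cartanA n (i + 1) i = -1 := by
  have h1 := Fin.ne_add_one (by omega) i
  have h2 := Fin.ne_add_two hn i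
  simp [cartanA, h1, h1.symm, h2]

omit [DecidableEq I] in
-- When a_{ij} = -2 the x_i-degrees lie between -2 and 2. Comparing the components of degree 3 and
-- -3 removes the degrees 1 and -1.
theorem even_of_shiftable (hA : IsGCM A) (hQ : IsQFamily A Q d) (hij : A i j = -2)
    {f F : Laurent I} (hf : IsNormal A Q i f) (h : Shiftable Q i j f F) {w : I → ℤ}
    (hw : F.coeff w ≠ 0) : w i = 0 ∨ w i = 2 ∨ w i = -2 := by
  have hb : ∀ w, F.coeff w ≠ 0 → |w i| ≤ 2 := fun w hw => by
    have := abs_le_of_shiftable hA hQ hf h hw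
    rwa [hij] at this
  obtain ⟨g, hg, rfl⟩ := hf
  have hq := (Q i).ne_zero
  have hbig : ∀ n : ℤ, 2 < |n| → part i n F = 0 := fun n hn =>
    part_eq_zero_iff.2 fun w hw h1 => by
      have := hb w hw; rw [h1] at this; omega
  have hκ : (Q j : ℂ) ^ A j i = (Q i : ℂ) ^ (-2 : ℤ) := by rw [hQ.zpow_eq, hij]
  have h1 : part i 1 F = 0 := by
    have h1 := part_of_shiftable hA hg h 3
    rw [hbig 3 (by norm_num), hbig (3 + 2) (by norm_num), hκ, ← zpow_add₀ hq] at h1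
    norm_num at h1
    have hk : (1 : ℂ) - (Q i : ℂ)⁻¹ ≠ 0 := fun h0 => by
      have := (hQ.zpow_eq_one i (-1)).1 (by rw [zpow_neg_one]; exact (sub_eq_zero.1 h0).symm)
      omega
    have h2 : ((1 : ℂ) - (Q i : ℂ)⁻¹) • (single (yv A i) (Q i : ℂ) * part i 1 F) = 0 := by
      rw [sub_smul, one_smul, ← h1, sub_self]
    exact single_mul_eq_zero hq ((smul_eq_zero.1 h2).resolve_left hk)
  have h2 : part i (-1) F = 0 := by
    have h1 := part_of_shiftable hA hg h (-3)
    rw [hbig (-3) (by norm_num), hbig (-3 - 2) (by norm_num), hκ, ← zpow_neg, ← zpow_add₀ hq] at h1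
    norm_num at h1
    have hk : (1 : ℂ) - (Q i : ℂ) ≠ 0 := fun h0 => by
      have := (hQ.zpow_eq_one i 1).1 (by rw [zpow_one]; exact (sub_eq_zero.1 h0).symm)
      omega
    rw [show (Q i : ℂ) ^ 2 * (Q i : ℂ)⁻¹ = Q i by field_simp] at h1
    have h2 : ((1 : ℂ) - (Q i : ℂ)) • (single (-yv A i) (Q i : ℂ)⁻¹ * part i (-1) F) = 0 := by
      rw [sub_smul, one_smul, ← h1, sub_self]
    exact single_mul_eq_zero (inv_ne_zero hq) ((smul_eq_zero.1 h2).resolve_left hk)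
  have e0 := abs_le.1 (hb w hw)
  have e1 := part_eq_zero_iff.1 h1 w hw
  have e2 := part_eq_zero_iff.1 h2 w hw
  omega

/-- The rank two case of `cartanA_iff`. -/
theorem IsNormalSolution.rankTwo (hA : IsGCM A) (hQ : IsQFamily A Q d)
    (hf : IsNormalSolution A Q f) (hne : i ≠ j) (hij : A i j = -2) (hji : A j i = -2)
    (hI : ∀ k, k = i ∨ k = j) :
    ∃ γ, f i = twoTerm A Q i + single 0 γ ∧ (f j).coeff 0 = γ := by
  classical
  set pt : ℤ → ℤ → I → ℤ := fun a b => a • Pi.single i 1 + b • Pi.single j 1 with hpt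
  have pti : ∀ a b, pt a b i = a := fun a b => by
    simp [hpt, Pi.single_eq_of_ne hne]
  have ptj : ∀ a b, pt a b j = b := fun a b => by
    simp [hpt, Pi.single_eq_of_ne hne.symm]
  have ptext : ∀ w : I → ℤ, w = pt (w i) (w j) := fun w => by
    funext k
    rcases hI k with rfl | rfl
    · rw [pti]
    · rw [ptj]
  have ptinj : ∀ {a b a' b'}, pt a b = pt a' b' ↔ a = a' ∧ b = b' := by
    intro a b a' b'
    constructor
    · intro h
      exact ⟨by rw [← pti a b, h, pti], by rw [← ptj a b, h, ptj]⟩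
    · rintro ⟨rfl, rfl⟩; rfl
  have ptsub : ∀ a b a' b', pt a b - pt a' b' = pt (a - a') (b - b') := fun a b a' b' => by
    simp only [hpt, sub_smul]; abel
  have ptneg : ∀ a b, -pt a b = pt (-a) (-b) := fun a b => by
    simp only [hpt, neg_smul]; abel
  have h00 : (0 : I → ℤ) = pt 0 0 := by simp [hpt]
  clear_value pt
  have hyi : yv A i = pt 2 (-2) := by
    rw [ptext (yv A i)]; simp only [yv, hA.diag, hji]
  have hyj : yv A j = pt (-2) 2 := by
    rw [ptext (yv A j)]; simp only [yv, hA.diag, hij]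
  have hqq : Q j = Q i := hQ.eq_of_eq (hji.trans hij.symm) (by rw [hji]; norm_num)
  obtain ⟨g, hg, hfi⟩ := hf.normal i
  obtain ⟨G, hG, hfj⟩ := hf.normal j
  have hs := hf.shift i j hne
  have hb : ∀ w, (f i).coeff w ≠ 0 → w j = 0 ∨ w j = 2 ∨ w j = -2 := fun w hw =>
    even_of_shiftable hA hQ hji (hf.normal j) (hf.shift j i hne.symm) hw
  have hB : ∀ w, (f j).coeff w ≠ 0 → w i = 0 ∨ w i = 2 ∨ w i = -2 := fun w hw =>
    even_of_shiftable hA hQ hij (hf.normal i) hs hw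
  set F := f j with hF
  set q : ℂ := (Q i : ℂ) with hqdef
  have hq : q ≠ 0 := (Q i).ne_zero
  -- By normality g involves only x_j, and by the parity statement with i and j exchanged only its
  -- powers -2, 0 and 2.
  have hg' : g = single (pt 0 2) (g.coeff (pt 0 2)) + single 0 (g.coeff (pt 0 0)) +
      single (pt 0 (-2)) (g.coeff (pt 0 (-2))) := by
    rw [h00]
    ext w
    simp only [coeff_add, Finsupp.add_apply, coeff_single, Finsupp.single_apply]
    rw [ptext w]
    simp only [ptinj]
    by_cases hw : w i = 0
    · rw [hw]
      by_cases hw0 : g.coeff (pt 0 (w j)) = 0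
      · have h1 : ∀ m, (if (0 : ℤ) = 0 ∧ m = w j then g.coeff (pt 0 m) else 0) = 0 := by
          intro m
          split_ifs with h
          · rw [h.2]; exact hw0
          · rfl
        rw [h1, h1, h1, hw0, add_zero, add_zero]
      · have h1 : (f i).coeff (pt 0 (w j)) ≠ 0 := by
          rw [hfi, ← twoTerm, coeff_add, Finsupp.add_apply,
            coeff_twoTerm_of_eq_zero hA (pti _ _), zero_add]
          exact hw0
        have h2 := hb _ h1
        rw [ptj] at h2
        rcases h2 with h2 | h2 | h2 <;> rw [h2] <;> norm_num
    · have h0 : g.coeff (pt (w i) (w j)) = 0 := by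
        by_contra h; have := hg _ h; rw [pti] at this; exact hw this
      simp [h0, Ne.symm hw]
  generalize g.coeff (pt 0 2) = γ at hg'
  generalize g.coeff (pt 0 0) = γ₀ at hg'
  generalize g.coeff (pt 0 (-2)) = γ' at hg'
  have hF0 : ∀ a b, b ≠ 0 → F.coeff (pt a b) = (twoTerm A Q j).coeff (pt a b) := by
    intro a b hb0
    rw [hfj, ← twoTerm, coeff_add, Finsupp.add_apply]
    have : G.coeff (pt a b) = 0 := by
      by_contra h; have := hG _ h; rw [ptj] at this; exact hb0 this
    rw [this, add_zero]
  have hFz : ∀ a b, b ≠ 0 → b ≠ -a → F.coeff (pt a b) = 0 := by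
    intro a b h1 h2
    rw [hF0 a b h1]
    by_contra h
    rcases coeff_twoTerm_ne_zero h with h | h
    · rw [hyj, ptinj] at h; omega
    · rw [hyj, ptneg, ptinj] at h; omega
  have hF1 : F.coeff (pt 2 (-2)) = q⁻¹ := by
    rw [hF0 _ _ (by norm_num), show pt 2 (-2) = -yv A j by rw [hyj, ptneg]; norm_num,
      coeff_twoTerm_neg_yv hA, hqq]
  have hF2 : F.coeff (pt (-2) 2) = q := by
    rw [hF0 _ _ (by norm_num), ← hyj, coeff_twoTerm_yv hA, hqq]
  have hF4 : ∀ a b, 2 < |a| → F.coeff (pt a b) = 0 := by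
    intro a b h
    by_contra h0
    have := hB _ h0
    rw [pti] at this
    rcases this with rfl | rfl | rfl <;> norm_num at h
  -- The coefficient of x_i^n x_j^b in the shiftability relation; five choices of (n, b) suffice.
  have key : ∀ n b, q * F.coeff (pt (n - 2) (b + 2)) + q⁻¹ * F.coeff (pt (n + 2) (b - 2)) +
      (γ * F.coeff (pt n (b - 2)) + γ₀ * F.coeff (pt n b) + γ' * F.coeff (pt n (b + 2))) =
      q ^ (-2 : ℤ) * q ^ (n - 2) * (q * F.coeff (pt (n - 2) (b + 2))) +
      q ^ (2 : ℤ) * q ^ (n + 2) * (q⁻¹ * F.coeff (pt (n + 2) (b - 2))) +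
      q ^ n * (q ^ (2 : ℤ) * γ * F.coeff (pt n (b - 2)) + γ₀ * F.coeff (pt n b) +
        q ^ (-2 : ℤ) * γ' * F.coeff (pt n (b + 2))) := by
    intro n b
    have h1 := hs
    rw [hfi] at h1
    have h2 := congrArg (fun f : Laurent I => f.coeff (pt n b)) (part_of_shiftable hA hg h1 n)
    beta_reduce at h2
    rw [hg', map_add, map_add, zeta_symm_single, zeta_symm_single, zeta_symm_single, hji, hqq,
      hyi, ptneg] at h2
    simp only [add_mul, coeff_add, coeff_smul, Finsupp.add_apply, Finsupp.smul_apply, smul_eq_mul,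
      coeff_single_mul, ptsub, coeff_part, pti, ptj, sub_zero, Pi.zero_apply] at h2
    norm_num at h2
    norm_num
    exact h2
  have k1 := key 2 2
  have k2 := key 2 0
  have k3 := key 2 (-2)
  have k4 := key (-2) (-2)
  have k5 := key (-2) 0
  norm_num at k1 k2 k3 k4 k5
  rw [hFz 0 4 (by norm_num) (by norm_num), hF4 4 0 (by norm_num),
    hFz 2 2 (by norm_num) (by norm_num), hFz 2 4 (by norm_num) (by norm_num)] at k1
  rw [hFz 0 2 (by norm_num) (by norm_num), hF4 4 (-2) (by norm_num), hF1,
    hFz 2 2 (by norm_num) (by norm_num)] at k2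
  rw [hF4 4 (-4) (by norm_num), hFz 2 (-4) (by norm_num) (by norm_num), hF1] at k3
  rw [hFz 0 (-4) (by norm_num) (by norm_num), hF4 (-4) 0 (by norm_num),
    hFz (-2) (-4) (by norm_num) (by norm_num), hFz (-2) (-2) (by norm_num) (by norm_num)] at k4
  rw [hFz 0 (-2) (by norm_num) (by norm_num), hF4 (-4) 2 (by norm_num), hF2,
    hFz (-2) (-2) (by norm_num) (by norm_num)] at k5
  have hq4 : q ^ 4 - 1 ≠ 0 := fun h => by
    have := (hQ.zpow_eq_one i 4).1 (by
      rw [show (4 : ℤ) = ((4 : ℕ) : ℤ) by norm_num, zpow_natCast]; exact sub_eq_zero.1 h)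
    omega
  have hq2 : q ^ 2 - 1 ≠ 0 := fun h => by
    have := (hQ.zpow_eq_one i 2).1 (by
      rw [show (2 : ℤ) = ((2 : ℕ) : ℤ) by norm_num, zpow_natCast]; exact sub_eq_zero.1 h)
    omega
  -- The point (2, 2) says that γ times the coefficient of x_i² in F vanishes; if that coefficient
  -- vanishes, the point (2, 0) gives γ = 0. The points (-2, -2) and (-2, 0) treat γ' in the same
  -- way, and (2, -2) identifies the constant terms.
  have hγ : γ = 0 := by
    have h1 : (q ^ 4 - 1) * (γ * F.coeff (pt 2 0)) = 0 := by linear_combination -k1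
    rcases mul_eq_zero.1 ((mul_eq_zero.1 h1).resolve_left hq4) with h2 | h2
    · exact h2
    · rw [h2] at k2
      have h3 : (q ^ 4 - 1) * q⁻¹ * γ = 0 := by linear_combination -k2
      exact (mul_eq_zero.1 h3).resolve_left (mul_ne_zero hq4 (inv_ne_zero hq))
  have hγ' : γ' = 0 := by
    have h1 : (q ^ 4 - 1) * (γ' * F.coeff (pt (-2) 0)) = 0 := by
      field_simp at k4
      have h2 : q * ((q ^ 4 - 1) * (γ' * F.coeff (pt (-2) 0))) = 0 := by linear_combination k4
      exact (mul_eq_zero.1 h2).resolve_left hq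
    rcases mul_eq_zero.1 ((mul_eq_zero.1 h1).resolve_left hq4) with h2 | h2
    · exact h2
    · rw [h2] at k5
      field_simp at k5
      have h3 : q ^ 2 * (q ^ 4 - 1) * γ' = 0 := by linear_combination k5
      exact (mul_eq_zero.1 h3).resolve_left (mul_ne_zero (pow_ne_zero _ hq) hq4)
  refine ⟨γ₀, ?_, ?_⟩
  · rw [hfi, hg', hγ, hγ', single_zero, single_zero, zero_add, add_zero]; rfl
  · field_simp at k3
    have h3 : (q ^ 2 - 1) * (F.coeff (pt 0 0) - γ₀) = 0 := by
      rw [hγ'] at k3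
      linear_combination k3
    rw [h00]
    exact sub_eq_zero.1 ((mul_eq_zero.1 h3).resolve_left hq2)

omit [DecidableEq I] in
theorem fourTerm_zero (c : ℂ) : fourTerm A Q i 0 c =
    twoTerm A Q i + single 0 ((Q i : ℂ)⁻¹ * c + (Q i : ℂ) * c⁻¹) := by
  rw [fourTerm, neg_zero, single_add]

omit [DecidableEq I] in
theorem exists_fourTerm_zero (γ : ℂ) :
    ∃ c, c ≠ 0 ∧ fourTerm A Q i 0 c = twoTerm A Q i + single 0 γ := by
  have hq := (Q i).ne_zero
  -- With c = q_i t the equation becomes t + t⁻¹ = γ, whose root t = (γ + s)/2 is nonzero because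
  -- the two roots have product 1.
  obtain ⟨s, hs⟩ := IsAlgClosed.exists_pow_nat_eq (γ ^ 2 - 4) two_pos
  have h1 : (Q i : ℂ) * ((γ + s) / 2) ≠ 0 := by
    refine mul_ne_zero hq fun h => ?_
    have h2 : s = -γ := by linear_combination 2 * h
    rw [h2] at hs
    have : (4 : ℂ) = 0 := by linear_combination hs
    norm_num at this
  refine ⟨(Q i : ℂ) * ((γ + s) / 2), h1, ?_⟩
  rw [fourTerm, neg_zero, ← single_add]
  congr 2
  have h3 : (γ + s) ≠ 0 := fun h => h1 (by rw [h]; simp)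
  field_simp
  linear_combination hs

/-- For n ≥ 2 every edge is simple and determines both exponent vectors. These are nonzero, so the
constants obtained from the two edges at a node agree, and one constant serves the whole cycle. For
n = 1 all exponent vectors vanish and `IsNormalSolution.rankTwo` takes over. -/
theorem cartanA_iff {n : ℕ} (hn : 1 ≤ n) (hA : IsGCM A) (hQ : IsQFamily A Q d)
    {e : Fin (n + 1) ≃ I} (he : IsNumbering A (cartanA n) e) :
    IsNormalSolution A Q f ↔
      ∃ c, c ≠ 0 ∧ ∀ i, f (e i) = fourTerm A Q (e i) (cycVec e i) c := by
  rcases hn.eq_or_lt with rfl | hn2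
  · have h01 : A (e 0) (e 1) = -2 := by rw [he]; rfl
    have h10 : A (e 1) (e 0) = -2 := by rw [he]; rfl
    have hne : e 0 ≠ e 1 := e.injective.ne (by decide)
    have hqq : Q (e 0) = Q (e 1) := hQ.eq_of_eq (h01.trans h10.symm) (by rw [h01]; norm_num)
    have hz : ∀ i, cycVec e i = 0 := fun i => by
      rw [cycVec]
      have : i + 1 = i - 1 := by revert i; decide
      rw [this, sub_self]
    have hI : ∀ k, k = e 0 ∨ k = e 1 := fun k => by
      obtain ⟨m, rfl⟩ := e.surjective k
      rw [e.injective.eq_iff, e.injective.eq_iff]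
      revert m; decide
    have h20 : ∀ i γ, (twoTerm A Q i + single 0 γ : Laurent I).coeff 0 = γ := fun i γ => by
      rw [coeff_add, Finsupp.add_apply, coeff_twoTerm_of_eq_zero hA rfl]; simp
    constructor
    · intro hf
      obtain ⟨γ, h1, h2⟩ := hf.rankTwo hA hQ hne h01 h10 hI
      obtain ⟨γ', h3, h4⟩ := hf.rankTwo hA hQ hne.symm h10 h01 fun k => (hI k).symm
      have h5 : γ' = γ := by rw [h3, h20] at h2; exact h2
      obtain ⟨c, hc, hc'⟩ := exists_fourTerm_zero (A := A) (Q := Q) (i := e 0) γ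
      refine ⟨c, hc, fun i => ?_⟩
      rw [hz]
      have : i = 0 ∨ i = 1 := by revert i; decide
      rcases this with rfl | rfl
      · rw [h1, hc']
      · rw [h3, h5, fourTerm_zero, ← hqq]
        rw [fourTerm_zero] at hc'
        congr 1
        exact (add_left_cancel hc').symm
    · rintro ⟨c, hc, hfc⟩
      have hf' : ∀ i, f (e i) = fourTerm A Q (e i) 0 c := fun i => by rw [hfc, hz]
      have hy : yv A (e 1) = -yv A (e 0) := by
        funext k
        rcases hI k with rfl | rfl
        · simp [yv, h01, hA.diag]
        · simp [yv, h10, hA.diag]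
      -- In rank two y_1 = y_0⁻¹, and the shift ζ_j⁻¹ turns f_i into f_j. Shiftability thus reduces
      -- to commutativity.
      have h2 : ∀ i j, Q i = Q j → A j i = -2 → yv A j = -yv A i →
          (zeta Q j).symm (fourTerm A Q i 0 c) = fourTerm A Q j 0 c := by
        intro i j hq h hy
        have hq0 := (Q j).ne_zero
        rw [fourTerm_zero, fourTerm_zero, twoTerm, twoTerm, map_add, map_add, zeta_symm_single,
          zeta_symm_single, zeta_symm_single, hy, neg_neg, hq]
        simp only [Pi.neg_apply, Pi.zero_apply, yv, h, zpow_zero, one_mul, neg_neg]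
        rw [add_comm (single (yv A i) _)]
        congr 3
        · rw [show (2 : ℤ) = ((2 : ℕ) : ℤ) by norm_num, zpow_natCast]; field_simp
        · rw [zpow_neg, show (2 : ℤ) = ((2 : ℕ) : ℤ) by norm_num, zpow_natCast]; field_simp
      have hs : Shiftable Q (e 0) (e 1) (f (e 0)) (f (e 1)) := by
        unfold Shiftable
        rw [hf', hf', h2 _ _ hqq h10 hy, h2 _ _ hqq.symm h01 (by rw [hy, neg_neg]), mul_comm]
      refine ⟨fun i => ?_, fun i j hij => ?_⟩
      · obtain ⟨i, rfl⟩ := e.surjective i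
        rw [hf']
        exact isNormal_fourTerm (Pi.zero_apply _) c
      · rcases hI i with rfl | rfl <;> rcases hI j with rfl | rfl
        · exact absurd rfl hij
        · exact hs
        · exact shiftable_symm.1 hs
        · exact absurd rfl hij
  · have hn' : 2 ≤ n := hn2
    have hne : ∀ i, e i ≠ e (i + 1) := fun i => e.injective.ne (Fin.ne_add_one hn i)
    have hs1 : ∀ i, A (e i) (e (i + 1)) = -1 := fun i => by
      rw [he]; exact (cartanA_apply_succ hn' i).1
    have hs2 : ∀ i, A (e (i + 1)) (e i) = -1 := fun i => by
      rw [he]; exact (cartanA_apply_succ hn' i).2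
    have hv0 : ∀ i, cycVec e i ≠ 0 := fun i h => by
      have := cycVec_ne_zero hn' e i
      rw [h] at this; simp at this
    constructor
    · intro hf
      have h1 : ∀ i, ∃ c, c ≠ 0 ∧ f (e i) = fourTerm A Q (e i) (cycVec e i) c ∧
          f (e (i + 1)) = fourTerm A Q (e (i + 1)) (cycVec e (i + 1)) c := by
        intro i
        obtain ⟨c, hc, h1, h2⟩ := hf.simple_edge hA hQ (hne i) (hs1 i) (hs2 i)
        refine ⟨c, hc, ?_, ?_⟩
        · rw [h1, yv_cartanA he, cycVec]
          congr 1
          abel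
        · rw [h2, yv_cartanA he, cycVec, add_sub_cancel_right]
          congr 1
          abel
      choose c hc h2 h3 using h1
      have h4 : ∀ i, c i = c (i + 1) := fun i => by
        have := h3 i
        rw [h2 (i + 1)] at this
        exact (fourTerm_right_injective hA (cycVec_self hn e _) (hv0 _) this).symm
      refine ⟨c 0, hc 0, fun i => ?_⟩
      rw [h2, fin_const h4]
    · rintro ⟨c, hc, hfc⟩
      have hs : ∀ i, Shiftable Q (e i) (e (i + 1)) (f (e i)) (f (e (i + 1))) := by
        intro i
        rw [hfc, hfc, ← cycVec_recursion he]
        exact shiftable_fourTerm hA hQ (hs1 i) hc (cycVec_self hn e i)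
          (Or.inl (by rw [cycVec_ne_zero hn', hs2]; norm_num))
      refine ⟨fun i => ?_, fun i j hij => ?_⟩
      · obtain ⟨i, rfl⟩ := e.surjective i
        rw [hfc]
        exact isNormal_fourTerm (cycVec_self hn e i) c
      · obtain ⟨i, rfl⟩ := e.surjective i
        obtain ⟨j, rfl⟩ := e.surjective j
        rw [Ne, e.injective.eq_iff] at hij
        by_cases h1 : j = i + 1
        · rw [h1]; exact hs i
        · by_cases h2 : i = j + 1
          · rw [h2]; exact shiftable_symm.1 (hs j)
          · have hcyc : ∀ i j, j ≠ i + 1 → i ≠ j + 1 → cycVec e i (e j) = 0 := by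
              intro i j h1 h2
              rw [cycVec, Pi.sub_apply, Pi.single_eq_of_ne (e.injective.ne h1),
                Pi.single_eq_of_ne (e.injective.ne fun h => h2 (by rw [h, sub_add_cancel])),
                sub_zero]
            have hAij : A (e i) (e j) = 0 := by
              rw [he]; simp [cartanA, hij, h1, h2]
            rw [hfc, hfc]
            exact shiftable_of_isHomog (isHomog_fourTerm (hA.zero _ _ hAij) (hcyc i j h1 h2) c)
              (isHomog_fourTerm hAij (hcyc j i h2 h1) c)

theorem cartanA_solution_iff [Fintype I] {n : ℕ} (hn : 1 ≤ n) (hA : IsGCM A)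
    (hQ : IsQFamily A Q d) {e : Fin (n + 1) ≃ I} (he : IsNumbering A (cartanA n) e)
    (φ : I → Laurent I) :
    IsSolution A Q φ ↔ ∃ b : ℂˣ, ∀ i, φ (e i) = solA Q e b i := by
  have hqc : ∀ i, Q (e i) = Q (e 0) := fin_const fun i => by
    have h1 := Fin.ne_add_one hn i
    refine hQ.eq_of_eq ?_ ?_
    · rw [he, he]; simp [cartanA, h1, h1.symm]; ring
    · rw [he]; simp [cartanA, h1]; split_ifs <;> norm_num
  have hsol : ∀ (b : ℂˣ) i, scaleFactor Q (e i) • solA Q e b i =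
      fourTerm A Q (e i) (cycVec e i) (-((Q (e i) : ℂ) ^ 2 * (b : ℂ) ^ 2)) := by
    intro b i
    have h1 : zA e i = mono (Pi.single (e i) 1 - Pi.single (e (i - 1)) 1) := by
      rw [zA, x, x, ← mono_neg, ← mono_add]; congr 1; abel
    have h2 : zA e (i + 1) = mono (Pi.single (e (i + 1)) 1 - Pi.single (e i) 1) := by
      rw [zA, x, x, ← mono_neg, ← mono_add, add_sub_cancel_right]; congr 1; abel
    rw [solA, h1, h2, scaleFactor_smul_brace_mul_brace hQ ?_ rfl]
    · congr 1
      rw [cycVec]; abel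
    · rw [yv_cartanA he]; abel
  rw [isSolution_iff hA hQ, cartanA_iff hn hA hQ he]
  constructor
  · rintro ⟨c, hc, hφ⟩
    -- The constants correspond by c = -q² b², where q is the common value of the q_i; every nonzero
    -- c arises.
    obtain ⟨b, hb⟩ := IsAlgClosed.exists_pow_nat_eq (-c / (Q (e 0) : ℂ) ^ 2) two_pos
    have hq := (Q (e 0)).ne_zero
    have hb0 : b ≠ 0 := by
      rintro rfl
      rw [zero_pow two_ne_zero, eq_comm, div_eq_zero_iff, neg_eq_zero] at hb
      exact hb.elim hc (pow_ne_zero _ hq)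
    refine ⟨Units.mk0 b hb0, fun i => ?_⟩
    rw [← scaleFactor_smul_eq_iff hQ (hsol _ i), hφ i, hqc, Units.val_mk0, hb]
    congr 1
    field_simp
  · rintro ⟨b, hb⟩
    refine ⟨-((Q (e 0) : ℂ) ^ 2 * (b : ℂ) ^ 2), ?_, fun i => ?_⟩
    · simp
    · rw [hb, hsol, hqc]

end cyclic

/-! ### Paths with double edges at both ends: all normalized solutions -/

section path

variable {I : Type*} [DecidableEq I]

open AddMonoidAlgebra

variable {A : Matrix I I ℤ} {Q : I → ℂˣ} {d : I → ℚ} {i j k : I} {f : I → Laurent I}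

omit [DecidableEq I] in
-- The involution of `fourTerm_neg` fixes the constants with c² = q_i². For these the direction in
-- which the path is traversed is immaterial.
theorem fourTerm_neg_of_sq {v : I → ℤ} {c : ℂ} (hc : c ^ 2 = (Q i : ℂ) ^ 2) :
    fourTerm A Q i (-v) c = fourTerm A Q i v c := by
  have hc0 : c ≠ 0 := fun h => by
    rw [h, zero_pow two_ne_zero, eq_comm] at hc
    exact pow_ne_zero _ (Q i).ne_zero hc
  rw [fourTerm_neg, ← hc]
  congr 1
  field_simp

omit [DecidableEq I] in
theorem IsQFamily.eq_sq_of_eq (hQ : IsQFamily A Q d) (hij : A i j = -1) (hji : A j i = -2) :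
    (Q i : ℂ) = (Q j : ℂ) ^ 2 := by
  have h1 := hQ.symm i j
  rw [hij, hji] at h1
  push_cast at h1
  have h2 := (hQ.pow i j 1 (-2)).2 (by push_cast; linarith)
  rw [zpow_one, zpow_neg] at h2
  have h3 := eq_of_mul_inv_eq_one h2
  rw [h3]
  norm_cast

/-- The Laurent polynomial attached to a leaf `i` with neighbour `j`. -/
def endTerm (A : Matrix I I ℤ) (Q : I → ℂˣ) (i j : I) (c : ℂ) : Laurent I :=
  if A i j = -2 then twoTerm A Q i else fourTerm A Q i 0 c

/-- The node `i` is a leaf of the Dynkin diagram, joined by a double edge to the node `j`, whose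
only other neighbour is `k`. -/
structure IsDoubleEnd (A : Matrix I I ℤ) (i j k : I) : Prop where
  ne_ij : i ≠ j
  ne_ik : i ≠ k
  ne_jk : j ≠ k
  leaf : ∀ m, m ≠ i → m ≠ j → A m i = 0
  two : ∀ m, m ≠ i → m ≠ j → m ≠ k → A m j = 0
  next : A k j ≠ 0
  double : (A i j = -1 ∧ A j i = -2) ∨ (A i j = -2 ∧ A j i = -1)

theorem IsDoubleEnd.yv_leaf (hA : IsGCM A) (h : IsDoubleEnd A i j k) :
    yv A i = 2 • Pi.single i 1 + A j i • Pi.single j 1 := by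
  funext m
  simp only [yv, Pi.add_apply, Pi.smul_apply]
  by_cases hi : m = i
  · subst hi; rw [hA.diag, Pi.single_eq_same, Pi.single_eq_of_ne h.ne_ij]; simp
  · by_cases hj : m = j
    · subst hj; rw [Pi.single_eq_same, Pi.single_eq_of_ne hi]; simp
    · rw [h.leaf m hi hj, Pi.single_eq_of_ne hi, Pi.single_eq_of_ne hj]; simp

theorem IsDoubleEnd.yv_next (hA : IsGCM A) (h : IsDoubleEnd A i j k) :
    yv A j = 2 • Pi.single j 1 + A i j • Pi.single i 1 + A k j • Pi.single k 1 := by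
  funext m
  simp only [yv, Pi.add_apply, Pi.smul_apply]
  by_cases hi : m = i
  · subst hi
    rw [Pi.single_eq_same, Pi.single_eq_of_ne h.ne_ij, Pi.single_eq_of_ne h.ne_ik]; simp
  · by_cases hj : m = j
    · subst hj
      rw [hA.diag, Pi.single_eq_same, Pi.single_eq_of_ne hi, Pi.single_eq_of_ne h.ne_jk]; simp
    · by_cases hk : m = k
      · subst hk
        rw [Pi.single_eq_same, Pi.single_eq_of_ne hi, Pi.single_eq_of_ne hj]; simp
      · rw [h.two m hi hj hk, Pi.single_eq_of_ne hi, Pi.single_eq_of_ne hj,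
          Pi.single_eq_of_ne hk]; simp

/-- The edge analysis is applied in the direction whose Cartan entry is -1. Starting from the leaf,
the second neighbour k of j excludes the two-term shape of f_j, so v = 0 and c² = q_i = q_j².
Starting from j, the same neighbour excludes v = 0, so v_i = 2 and the leaf has the two-term shape,
with c = q_i² = q_j. -/
theorem IsDoubleEnd.forward (hA : IsGCM A) (hQ : IsQFamily A Q d) (h : IsDoubleEnd A i j k)
    (hf : IsNormalSolution A Q f) :
    ∃ c, c ^ 2 = (Q j : ℂ) ^ 2 ∧ (A i j = -2 → c = Q j) ∧ f i = endTerm A Q i j c ∧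
      f j = fourTerm A Q j (A i j • Pi.single i 1 - A k j • Pi.single k 1) c := by
  have y1 := h.yv_leaf hA
  have y2 := h.yv_next hA
  rcases h.double with ⟨hij, hji⟩ | ⟨hij, hji⟩
  · obtain ⟨v, c, hc, hvi, hfi, hv, hj⟩ := hf.edge hA hQ h.ne_ij hij
    have hj' : v j - A j i = 2 ∧ f j = fourTerm A Q j (v - yv A i - yv A j) c := by
      rcases hj with h1 | h1
      · exact h1
      · exact absurd (h1.2.2.1 k h.ne_ik.symm h.ne_jk.symm) h.next
    have hv' : v = 0 ∧ c ^ 2 = Q i := by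
      rcases hv with h1 | h1
      · omega
      · exact ⟨h1.1, h1.2.1⟩
    refine ⟨c, by rw [hv'.2, hQ.eq_sq_of_eq hij hji], by rw [hij]; intro h; omega, ?_, ?_⟩
    · rw [endTerm, if_neg (by rw [hij]; norm_num), hfi, hv'.1]
    · rw [hj'.2, hv'.1, y1, y2, hij, hji]
      congr 1
      module
  · obtain ⟨v, c, hc, hvi, hfi, hv, hj⟩ := hf.edge hA hQ h.ne_ij.symm hji
    have hv' : v i = 2 := by
      rcases hv with h1 | h1
      · rw [h1.2.1, hij]; norm_num
      · exact absurd (h1.2.2 k h.ne_jk.symm h.ne_ik.symm) h.next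
    obtain ⟨h1, h2, -, h3⟩ := hj.resolve_left (by omega)
    have hq := hQ.eq_sq_of_eq hji hij
    refine ⟨c, by rw [h2, hq], fun _ => by rw [h2, hq], ?_, ?_⟩
    · rw [endTerm, if_pos hij, h3]
    · have hv2 : v = -(A i j • Pi.single i 1 - A k j • Pi.single k 1) := by
        rw [sub_eq_iff_eq_add.1 h1, y1, y2, hij, hji]; module
      rw [hfi, hv2, fourTerm_neg_of_sq (by rw [h2, hq])]

theorem IsDoubleEnd.backward (hA : IsGCM A) (hQ : IsQFamily A Q d) (h : IsDoubleEnd A i j k)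
    {c : ℂ} (hc : c ^ 2 = (Q j : ℂ) ^ 2) (hc' : A i j = -2 → c = Q j) :
    Shiftable Q i j (endTerm A Q i j c)
      (fourTerm A Q j (A i j • Pi.single i 1 - A k j • Pi.single k 1) c) := by
  have y1 := h.yv_leaf hA
  have y2 := h.yv_next hA
  have hc0 : c ≠ 0 := fun h => by
    rw [h, zero_pow two_ne_zero, eq_comm] at hc
    exact pow_ne_zero _ (Q j).ne_zero hc
  rcases h.double with ⟨hij, hji⟩ | ⟨hij, hji⟩
  · have := shiftable_fourTerm hA hQ hij hc0 (Pi.zero_apply i)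
      (Or.inr ⟨rfl, by rw [hc, hQ.eq_sq_of_eq hij hji]⟩)
    rw [endTerm, if_neg (by rw [hij]; norm_num)]
    convert this using 2
    rw [y1, y2, hij, hji]; module
  · rw [endTerm, if_pos hij, ← fourTerm_neg_of_sq hc, shiftable_symm]
    refine shiftable_twoTerm hA hQ hji ?_ (Or.inl ?_) ?_ ?_
    · simp [Pi.single_eq_of_ne h.ne_ij.symm, Pi.single_eq_of_ne h.ne_jk]
    · simp [Pi.single_eq_of_ne h.ne_ik, hij]
    · rw [y1, y2, hij, hji]; module
    · rw [hc' hij, hQ.eq_sq_of_eq hji hij]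

/-- The nodes `N 0, …, N n` form a path with simple interior edges and double edges
at both ends. -/
structure IsDoublePath (A : Matrix I I ℤ) (n : ℕ) (N : ℕ → I) : Prop where
  two_le : 2 ≤ n
  surj : ∀ i, ∃ k ≤ n, N k = i
  inj : ∀ k ≤ n, ∀ m ≤ n, N k = N m → k = m
  edge : ∀ k, 0 < k → k + 1 < n → A (N k) (N (k + 1)) = -1 ∧ A (N (k + 1)) (N k) = -1
  far : ∀ k m, k + 1 < m → m ≤ n → A (N k) (N m) = 0 ∧ A (N m) (N k) = 0
  left : (A (N 0) (N 1) = -1 ∧ A (N 1) (N 0) = -2) ∨ (A (N 0) (N 1) = -2 ∧ A (N 1) (N 0) = -1)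
  right : (A (N n) (N (n - 1)) = -1 ∧ A (N (n - 1)) (N n) = -2) ∨
    (A (N n) (N (n - 1)) = -2 ∧ A (N (n - 1)) (N n) = -1)

/-- The exponent vector of `z_k z_{k+1}`. -/
def pathVec (A : Matrix I I ℤ) (N : ℕ → I) (k : ℕ) : I → ℤ :=
  A (N (k - 1)) (N k) • Pi.single (N (k - 1)) 1 - A (N (k + 1)) (N k) • Pi.single (N (k + 1)) 1

variable {n : ℕ} {N : ℕ → I}

omit [DecidableEq I] in
theorem IsDoublePath.adj (h : IsDoublePath A n N) {k : ℕ} (hk : k < n) :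
    A (N (k + 1)) (N k) ≠ 0 ∧ A (N k) (N (k + 1)) ≠ 0 := by
  by_cases h0 : k = 0
  · subst h0
    rcases h.left with h1 | h1 <;> simp [h1]
  · by_cases h2 : k + 1 = n
    · subst h2
      have := h.right
      rw [Nat.add_sub_cancel] at this
      rcases this with h1 | h1 <;> simp [h1]
    · have := h.edge k (by omega) (by omega)
      simp [this]

omit [DecidableEq I] in
theorem IsDoublePath.leftEnd (h : IsDoublePath A n N) : IsDoubleEnd A (N 0) (N 1) (N 2) where
  ne_ij he := by have := h.two_le; have := h.inj 0 (by omega) 1 (by omega) he; omega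
  ne_ik he := by have := h.two_le; have := h.inj 0 (by omega) 2 (by omega) he; omega
  ne_jk he := by have := h.two_le; have := h.inj 1 (by omega) 2 (by omega) he; omega
  leaf m h0 h1 := by
    obtain ⟨k, hk, rfl⟩ := h.surj m
    have : k ≠ 0 := fun h => h0 (by rw [h])
    have : k ≠ 1 := fun h => h1 (by rw [h])
    exact (h.far 0 k (by omega) hk).2
  two m h0 h1 h2 := by
    obtain ⟨k, hk, rfl⟩ := h.surj m
    have : k ≠ 0 := fun h => h0 (by rw [h])
    have : k ≠ 1 := fun h => h1 (by rw [h])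
    have : k ≠ 2 := fun h => h2 (by rw [h])
    exact (h.far 1 k (by omega) hk).2
  next := (h.adj (k := 1) (by have := h.two_le; omega)).1
  double := h.left

omit [DecidableEq I] in
theorem IsDoublePath.rightEnd (h : IsDoublePath A n N) :
    IsDoubleEnd A (N n) (N (n - 1)) (N (n - 2)) where
  ne_ij he := by have := h.two_le; have := h.inj n (by omega) (n - 1) (by omega) he; omega
  ne_ik he := by have := h.two_le; have := h.inj n (by omega) (n - 2) (by omega) he; omega
  ne_jk he := by have := h.two_le; have := h.inj (n - 1) (by omega) (n - 2) (by omega) he; omega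
  leaf m h0 h1 := by
    obtain ⟨k, hk, rfl⟩ := h.surj m
    have : k ≠ n := fun h => h0 (by rw [h])
    have : k ≠ n - 1 := fun h => h1 (by rw [h])
    exact (h.far k n (by omega) le_rfl).1
  two m h0 h1 h2 := by
    obtain ⟨k, hk, rfl⟩ := h.surj m
    have : k ≠ n := fun h => h0 (by rw [h])
    have : k ≠ n - 1 := fun h => h1 (by rw [h])
    have : k ≠ n - 2 := fun h => h2 (by rw [h])
    exact (h.far k (n - 1) (by omega) (by omega)).1
  next := by
    have h2 := h.two_le
    have := (h.adj (k := n - 2) (by omega)).2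
    rwa [show n - 2 + 1 = n - 1 by omega] at this
  double := h.right

theorem IsDoublePath.yv_eq (hA : IsGCM A) (h : IsDoublePath A n N) {k : ℕ} (hk : 0 < k)
    (hkn : k < n) : yv A (N k) = 2 • Pi.single (N k) 1 +
      A (N (k - 1)) (N k) • Pi.single (N (k - 1)) 1 +
      A (N (k + 1)) (N k) • Pi.single (N (k + 1)) 1 := by
  funext i
  obtain ⟨m, hm, rfl⟩ := h.surj i
  have hN : ∀ a b, a ≤ n → b ≤ n → a ≠ b → N a ≠ N b := fun a b ha hb hab he =>
    hab (h.inj a ha b hb he)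
  simp only [yv, Pi.add_apply, Pi.smul_apply]
  by_cases h1 : m = k
  · subst h1
    rw [hA.diag, Pi.single_eq_same, Pi.single_eq_of_ne (hN _ _ (by omega) (by omega) (by omega)),
      Pi.single_eq_of_ne (hN _ _ (by omega) (by omega) (by omega))]; simp
  · by_cases h2 : m = k - 1
    · subst h2
      rw [Pi.single_eq_same, Pi.single_eq_of_ne (hN _ _ (by omega) (by omega) (by omega)),
        Pi.single_eq_of_ne (hN _ _ (by omega) (by omega) (by omega))]; simp
    · by_cases h3 : m = k + 1
      · subst h3
        rw [Pi.single_eq_same, Pi.single_eq_of_ne (hN _ _ (by omega) (by omega) (by omega)),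
          Pi.single_eq_of_ne (hN _ _ (by omega) (by omega) (by omega))]; simp
      · rw [Pi.single_eq_of_ne (hN _ _ (by omega) (by omega) (by omega)),
          Pi.single_eq_of_ne (hN _ _ (by omega) (by omega) (by omega)),
          Pi.single_eq_of_ne (hN _ _ (by omega) (by omega) (by omega))]
        have : A (N m) (N k) = 0 := by
          rcases lt_or_gt_of_ne h1 with h4 | h4
          · exact (h.far m k (by omega) (by omega)).1
          · exact (h.far k m (by omega) (by omega)).2
        rw [this]; simp

theorem IsDoublePath.pathVec_apply_eq_zero (h : IsDoublePath A n N) {k m : ℕ} (hk : 0 < k)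
    (hkn : k < n) (hm : m ≤ n) (h1 : m ≠ k - 1) (h2 : m ≠ k + 1) : pathVec A N k (N m) = 0 := by
  have hN : ∀ a b, a ≤ n → b ≤ n → a ≠ b → N a ≠ N b := fun a b ha hb hab he =>
    hab (h.inj a ha b hb he)
  simp only [pathVec, Pi.sub_apply, Pi.smul_apply]
  rw [Pi.single_eq_of_ne (hN _ _ (by omega) (by omega) (by omega)),
    Pi.single_eq_of_ne (hN _ _ (by omega) (by omega) (by omega))]
  simp

theorem IsDoublePath.pathVec_apply_succ (h : IsDoublePath A n N) {k : ℕ} (hk : 0 < k)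
    (hkn : k < n) : pathVec A N k (N (k + 1)) = -A (N (k + 1)) (N k) := by
  have hN : ∀ a b, a ≤ n → b ≤ n → a ≠ b → N a ≠ N b := fun a b ha hb hab he =>
    hab (h.inj a ha b hb he)
  simp only [pathVec, Pi.sub_apply, Pi.smul_apply]
  rw [Pi.single_eq_of_ne (hN _ _ (by omega) (by omega) (by omega)), Pi.single_eq_same]
  simp

theorem IsDoublePath.pathVec_ne_zero (h : IsDoublePath A n N) {k : ℕ} (hk : 0 < k)
    (hkn : k < n) : pathVec A N k ≠ 0 := fun h0 => by
  have := h.pathVec_apply_succ hk hkn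
  rw [h0, Pi.zero_apply, eq_comm, neg_eq_zero] at this
  exact (h.adj hkn).1 this

omit [DecidableEq I] in
theorem IsDoublePath.q_eq (h : IsDoublePath A n N) (hQ : IsQFamily A Q d) {k : ℕ} (hk : 0 < k)
    (hkn : k < n) : Q (N k) = Q (N 1) := by
  induction k, hk using Nat.le_induction with
  | base => rfl
  | succ k hk ih =>
    rw [← ih (by omega)]
    have h1 := h.edge k hk hkn
    exact hQ.eq_of_eq (h1.2.trans h1.1.symm) (by rw [h1.2]; norm_num)

/-- The left end fixes f_1 up to the choice of c, simple edges propagate the exponent vector and c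
through the interior, and the right end must produce the same c. Each end with Cartan entry -2 in
the row of the leaf adds the condition c = q_1. -/
theorem IsDoublePath.isNormalSolution_iff (hA : IsGCM A) (hQ : IsQFamily A Q d)
    (h : IsDoublePath A n N) :
    IsNormalSolution A Q f ↔ ∃ c, c ^ 2 = (Q (N 1) : ℂ) ^ 2 ∧
      (A (N 0) (N 1) = -2 → c = Q (N 1)) ∧ (A (N n) (N (n - 1)) = -2 → c = Q (N 1)) ∧
      f (N 0) = endTerm A Q (N 0) (N 1) c ∧ f (N n) = endTerm A Q (N n) (N (n - 1)) c ∧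
      ∀ k, 0 < k → k < n → f (N k) = fourTerm A Q (N k) (pathVec A N k) c := by
  have hn := h.two_le
  have hN : ∀ a b, a ≤ n → b ≤ n → a ≠ b → N a ≠ N b := fun a b ha hb hab he =>
    hab (h.inj a ha b hb he)
  have hq' : Q (N (n - 1)) = Q (N 1) := h.q_eq hQ (by omega) (by omega)
  have hvec : A (N n) (N (n - 1)) • (Pi.single (N n) 1 : I → ℤ) -
      A (N (n - 2)) (N (n - 1)) • Pi.single (N (n - 2)) 1 = -pathVec A N (n - 1) := by
    rw [pathVec, show n - 1 + 1 = n by omega, show n - 1 - 1 = n - 2 by omega, neg_sub]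
  constructor
  · intro hf
    obtain ⟨c, hc, hc', hf0, hf1⟩ := h.leftEnd.forward hA hQ hf
    obtain ⟨b, hb, hb', hfn, hfn1⟩ := h.rightEnd.forward hA hQ hf
    have hint : ∀ k, 0 < k → k < n → f (N k) = fourTerm A Q (N k) (pathVec A N k) c := by
      intro k hk
      induction k, hk using Nat.le_induction with
      | base => intro _; exact hf1
      | succ k hk ih =>
        intro hkn
        have ih := ih (by omega)
        have he := h.edge k hk hkn
        obtain ⟨c', hc0, h1, h2⟩ := hf.simple_edge hA hQ (hN k (k + 1) (by omega) (by omega)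
          (by omega)) he.1 he.2
        have e1 : yv A (N k) - 2 • Pi.single (N k) 1 + 2 • Pi.single (N (k + 1)) 1 =
            pathVec A N k := by
          rw [h.yv_eq hA hk (by omega), pathVec, he.2]; module
        have e2 : 2 • Pi.single (N (k + 1)) 1 - 2 • Pi.single (N k) 1 - yv A (N (k + 1)) =
            pathVec A N (k + 1) := by
          rw [h.yv_eq hA (by omega) hkn, pathVec, Nat.add_sub_cancel, he.1]; module
        rw [e1, ih] at h1
        have := fourTerm_right_injective hA
          (h.pathVec_apply_eq_zero hk (by omega) (by omega) (by omega) (by omega))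
          (h.pathVec_ne_zero hk (by omega)) h1
        rw [h2, e2, this]
    -- The right end describes f_{n-1} by the opposite exponent vector; the symmetry of
    -- `fourTerm_neg_of_sq` makes the two constants comparable.
    have hcb : c = b := by
      have h1 := hint (n - 1) (by omega) (by omega)
      rw [hfn1, hvec, fourTerm_neg_of_sq hb] at h1
      exact (fourTerm_right_injective hA
        (h.pathVec_apply_eq_zero (by omega) (by omega) (by omega) (by omega) (by omega))
        (h.pathVec_ne_zero (by omega) (by omega)) h1).symm
    subst hcb
    rw [hq'] at hb'
    exact ⟨c, hc, hc', hb', hf0, hfn, hint⟩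
  · rintro ⟨c, hc, hc1, hc2, hf0, hfn, hint⟩
    have hc0 : c ≠ 0 := fun h => by
      rw [h, zero_pow two_ne_zero, eq_comm] at hc
      exact pow_ne_zero _ (Q _).ne_zero hc
    have hnend : ∀ i j, IsNormal A Q i (endTerm A Q i j c) := fun i j => by
      rw [endTerm]
      split_ifs
      · exact isNormal_twoTerm
      · exact isNormal_fourTerm (Pi.zero_apply _) c
    have hhend : ∀ i j k, A k i = 0 → IsHomog k 0 (endTerm A Q i j c) := fun i j k hk => by
      rw [endTerm]
      split_ifs
      · exact isHomog_twoTerm hk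
      · exact isHomog_fourTerm hk (Pi.zero_apply _) c
    have hhom : ∀ k m, k ≤ n → m ≤ n → m ≠ k → m ≠ k + 1 → k ≠ m + 1 → A (N m) (N k) = 0 →
        IsHomog (N m) 0 (f (N k)) := by
      intro k m hk hm h1 h2 h3 hA0
      by_cases hk0 : k = 0
      · subst hk0; rw [hf0]; exact hhend _ _ _ hA0
      · by_cases hkn : k = n
        · subst hkn; rw [hfn]; exact hhend _ _ _ hA0
        · rw [hint k (by omega) (by omega)]
          exact isHomog_fourTerm hA0
            (h.pathVec_apply_eq_zero (by omega) (by omega) hm (by omega) (by omega)) c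
    have hadj : ∀ k, k < n → Shiftable Q (N k) (N (k + 1)) (f (N k)) (f (N (k + 1))) := by
      intro k hk
      by_cases hk0 : k = 0
      · subst hk0
        rw [hf0, zero_add, hint 1 (by omega) (by omega)]
        exact h.leftEnd.backward hA hQ hc hc1
      · by_cases hkn : k + 1 = n
        · obtain rfl : k = n - 1 := by omega
          rw [hint (n - 1) (by omega) (by omega), hkn, hfn, shiftable_symm,
            ← fourTerm_neg_of_sq (by rw [hc, hq']), ← hvec]
          exact h.rightEnd.backward hA hQ (by rw [hc, hq']) (by rw [hq']; exact hc2)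
        · have he := h.edge k (by omega) (by omega)
          have e : pathVec A N (k + 1) = pathVec A N k - yv A (N k) - yv A (N (k + 1)) := by
            rw [h.yv_eq hA (by omega) hk, h.yv_eq hA (by omega) (show k + 1 < n by omega), pathVec,
              pathVec, Nat.add_sub_cancel, he.1, he.2]
            module
          rw [hint k (by omega) (by omega), hint (k + 1) (by omega) (by omega), e]
          exact shiftable_fourTerm hA hQ he.1 hc0
            (h.pathVec_apply_eq_zero (by omega) (by omega) (by omega) (by omega) (by omega))
            (Or.inl (h.pathVec_apply_succ (by omega) (by omega)))
    have hlt : ∀ k m, k < m → m ≤ n → Shiftable Q (N k) (N m) (f (N k)) (f (N m)) := by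
      intro k m hkm hm
      by_cases h1 : m = k + 1
      · subst h1; exact hadj k (by omega)
      · have h2 := h.far k m (by omega) hm
        exact shiftable_of_isHomog
          (hhom k m (by omega) hm (by omega) (by omega) (by omega) h2.2)
          (hhom m k hm (by omega) (by omega) (by omega) (by omega) h2.1)
    refine ⟨fun i => ?_, fun i j hij => ?_⟩
    · obtain ⟨k, hk, rfl⟩ := h.surj i
      by_cases hk0 : k = 0
      · subst hk0; rw [hf0]; exact hnend _ _
      · by_cases hkn : k = n
        · subst hkn; rw [hfn]; exact hnend _ _
        · rw [hint k (by omega) (by omega)]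
          exact isNormal_fourTerm
            (h.pathVec_apply_eq_zero (by omega) (by omega) (by omega) (by omega) (by omega)) c
    · obtain ⟨k, hk, rfl⟩ := h.surj i
      obtain ⟨m, hm, rfl⟩ := h.surj j
      rcases lt_trichotomy k m with h1 | h1 | h1
      · exact hlt k m h1 hm
      · exact absurd (by rw [h1]) hij
      · exact shiftable_symm.1 (hlt m k h1 hk)

end path

/-! ### Labels and the values q_i along such a path -/

section pathLabels

variable {I : Type*} [DecidableEq I]

variable {A : Matrix I I ℤ} {Q : I → ℂˣ} {d : I → ℚ} {n : ℕ} {N : ℕ → I}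

omit [DecidableEq I] in
theorem IsDoublePath.transpose (h : IsDoublePath A n N) : IsDoublePath A.transpose n N where
  two_le := h.two_le
  surj := h.surj
  inj := h.inj
  edge k h0 h1 := (h.edge k h0 h1).symm
  far k m h0 h1 := (h.far k m h0 h1).symm
  left := h.left.symm.imp And.symm And.symm
  right := h.right.symm.imp And.symm And.symm

/-- The positive null vectors are constant in the interior of the path. -/
theorem IsDoublePath.null [Fintype I] (hA : IsGCM A) (h : IsDoublePath A n N) {u : I → ℤ}
    (hu : ∀ i, ∑ j, A i j * u j = 0) :
    2 * u (N 0) = -A (N 0) (N 1) * u (N 1) ∧ 2 * u (N n) = -A (N n) (N (n - 1)) * u (N 1) ∧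
      ∀ k, 0 < k → k < n → u (N k) = u (N 1) := by
  have hn := h.two_le
  have hrow : ∀ i v, yv A.transpose i = v → ∑ j, v j * u j = 0 := by
    rintro i v rfl; exact hu i
  have h0 := hrow _ _ (h.transpose.leftEnd.yv_leaf hA.transpose)
  have hn0 := hrow _ _ (h.transpose.rightEnd.yv_leaf hA.transpose)
  have hk := fun k (h1 : 0 < k) (h2 : k < n) => hrow _ _ (h.transpose.yv_eq hA.transpose h1 h2)
  have hs : ∀ i (c : ℤ), ∑ j, (c • (Pi.single i 1 : I → ℤ)) j * u j = c * u i := fun i c => by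
    simp [Pi.single_apply]
  have hs2 : ∀ i, ∑ j, ((2 : ℕ) • (Pi.single i 1 : I → ℤ)) j * u j = 2 * u i := fun i => by
    simp [Pi.single_apply]
  simp only [Pi.add_apply, add_mul, Finset.sum_add_distrib, hs, hs2,
    Matrix.transpose_apply] at h0 hn0 hk
  have hstep : ∀ k, 0 < k → k < n →
      u (N k) = u (N 1) ∧ A (N k) (N (k + 1)) * u (N (k + 1)) = -u (N k) := by
    intro k h1
    induction k, h1 using Nat.le_induction with
    | base =>
      intro h2
      refine ⟨rfl, ?_⟩
      have h3 := hk 1 one_pos h2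
      -- As a_{01} a_{10} = 2, the leaf enters the row of node 1 like a neighbour of value u_1
      -- joined by a simple edge.
      have h4 : A (N 1) (N 0) * u (N 0) = -u (N 1) := by
        rcases h.left with h5 | h5 <;> rw [h5.1] at h0 <;> rw [h5.2] <;> omega
      rw [show (1 : ℕ) - 1 = 0 from rfl] at h3
      change A (N 1) (N (1 + 1)) * u (N (1 + 1)) = -u (N 1)
      linarith
    | succ k h1 ih =>
      intro h2
      obtain ⟨i1, i2⟩ := ih (by omega)
      have h3 := hk (k + 1) (by omega) h2
      have h4 := h.edge k h1 h2
      rw [h4.1] at i2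
      rw [Nat.add_sub_cancel, h4.2] at h3
      refine ⟨by linarith, by linarith⟩
  refine ⟨by linarith, ?_, fun k h1 h2 => (hstep k h1 h2).1⟩
  have := (hstep (n - 1) (by omega) (by omega)).1
  rw [this] at hn0
  linarith

omit [DecidableEq I] in
theorem IsLabels.eq_one [Fintype I] {a : I → ℕ} (ha : IsLabels A a) {i : I}
    (h : ∀ j, a i ∣ a j) : a i = 1 := by
  have := Finset.dvd_gcd (s := Finset.univ) (f := a) (a := a i) fun j _ => h j
  rw [ha.coprime] at this
  exact Nat.dvd_one.1 this

/-- The null vector is known up to scale; coprimality fixes the scale, since a label dividing all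
the others is 1. Together with the same statement for Aᵀ this gives d_0, from which the symmetrizer
relation yields every d_i. -/
theorem IsDoublePath.labels [Fintype I] (hA : IsGCM A) (h : IsDoublePath A n N) {a : I → ℕ}
    (ha : IsLabels A a) :
    (A (N 0) (N 1) = -1 → a (N 0) = 1) ∧
    (A (N 0) (N 1) = -2 → A (N n) (N (n - 1)) = -2 → a (N 0) = 1) ∧
    (A (N 0) (N 1) = -2 → A (N n) (N (n - 1)) = -1 → a (N 0) = 2) := by
  obtain ⟨h0, hn, hk⟩ := h.null hA ha.null
  have hall : ∀ {P : I → Prop}, P (N 0) → P (N n) → (∀ k, 0 < k → k < n → P (N k)) →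
      ∀ i, P i := by
    intro P p0 pn pk i
    obtain ⟨k, hk, rfl⟩ := h.surj i
    by_cases h1 : k = 0
    · rw [h1]; exact p0
    · by_cases h2 : k = n
      · rw [h2]; exact pn
      · exact pk k (by omega) (by omega)
  refine ⟨fun h1 => ?_, fun h1 h2 => ?_, fun h1 h2 => ?_⟩
  · rw [h1] at h0
    have h3 : a (N 1) = 2 * a (N 0) := by omega
    apply ha.eq_one
    refine hall dvd_rfl ?_ fun k k0 kn => ?_
    · rcases h.right with h2 | h2 <;> rw [h2.1] at hn
      · have : a (N n) = a (N 0) := by omega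
        rw [this]
      · have : a (N n) = 2 * a (N 0) := by omega
        rw [this]; exact dvd_mul_left _ _
    · have := hk k k0 kn
      have : a (N k) = 2 * a (N 0) := by omega
      rw [this]; exact dvd_mul_left _ _
  · rw [h1] at h0
    rw [h2] at hn
    apply ha.eq_one
    refine hall dvd_rfl ?_ fun k k0 kn => ?_
    · have : a (N n) = a (N 0) := by omega
      rw [this]
    · have := hk k k0 kn
      have : a (N k) = a (N 0) := by omega
      rw [this]
  · rw [h1] at h0
    rw [h2] at hn
    have h3 : a (N 0) = 2 * a (N n) := by omega
    have : a (N n) = 1 := by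
      apply ha.eq_one
      refine hall (by rw [h3]; exact dvd_mul_left _ _) dvd_rfl fun k k0 kn => ?_
      have := hk k k0 kn
      have : a (N k) = 2 * a (N n) := by omega
      rw [this]; exact dvd_mul_left _ _
    rw [h3, this]

omit [DecidableEq I] in
theorem IsDoublePath.qi_interior [Fintype I] (hA : IsAffineCartan A) (h : IsDoublePath A n N)
    {a a' : I → ℕ} (ha : IsLabels A a) (ha' : IsLabels A.transpose a') {ħ : ℂ} {s : ℚ}
    (h0 : (a' (N 0) : ℚ) / a (N 0) = s) :
    (A (N 0) (N 1) = -1 → qi ħ a a' (N 1) = qpow ħ (s / 2)) ∧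
    (A (N 0) (N 1) = -2 → qi ħ a a' (N 1) = qpow ħ (s * 2)) := by
  have h1 := labels_symmetrize hA ha ha' (N 0) (N 1)
  rw [h0] at h1
  unfold qi
  refine ⟨fun h2 => ?_, fun h2 => ?_⟩ <;> congr 1 <;> rcases h.left with h3 | h3 <;>
    rw [h3.1, h3.2] at h1 <;> push_cast at h1 <;> first | omega | linarith

omit [DecidableEq I] in
theorem IsDoublePath.qi_right [Fintype I] (hA : IsAffineCartan A) (h : IsDoublePath A n N)
    {a a' : I → ℕ} (ha : IsLabels A a) (ha' : IsLabels A.transpose a') {ħ : ℂ} {s : ℚ}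
    (hq : ∀ m : ℕ, 0 < m → Complex.exp ħ ^ m ≠ 1) (h0 : qi ħ a a' (N 1) = qpow ħ s) :
    (A (N n) (N (n - 1)) = -1 → qi ħ a a' (N n) = qpow ħ (s * 2)) ∧
    (A (N n) (N (n - 1)) = -2 → qi ħ a a' (N n) = qpow ħ (s / 2)) := by
  have hn := h.two_le
  have hQ := isQFamily_qi hA ha ha' hq
  -- The interior q_i coincide, and since q is not a root of unity, equal powers of q have equal
  -- exponents.
  have h2 : (a' (N (n - 1)) : ℚ) / a (N (n - 1)) = s := by
    have h3 := h.q_eq hQ (k := n - 1) (by omega) (by omega)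
    rw [h0, qi, ← mul_inv_eq_one, ← qpow_neg, ← qpow_add, qpow_eq_one_iff hq] at h3
    linarith
  have h1 := labels_symmetrize hA ha ha' (N n) (N (n - 1))
  rw [h2] at h1
  unfold qi
  refine ⟨fun h2 => ?_, fun h2 => ?_⟩ <;> congr 1 <;> rcases h.right with h3 | h3 <;>
    rw [h3.1, h3.2] at h1 <;> push_cast at h1 <;> first | omega | linarith

end pathLabels

/-! ### Exponents z_k and numberings for the tridiagonal types -/

section families

variable {I : Type*} [DecidableEq I]

variable {A : Matrix I I ℤ} {Q : I → ℂˣ} {d : I → ℚ} {n : ℕ} {N : ℕ → I}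

/-- The exponent vector of `z_k` for a path with double edges at both ends. -/
def pathZ (A : Matrix I I ℤ) (n : ℕ) (N : ℕ → I) (k : ℕ) : I → ℤ :=
  (if k = n then -A (N n) (N (n - 1)) else 1) • Pi.single (N k) 1 -
    (if k = 1 then -A (N 0) (N 1) else 1) • Pi.single (N (k - 1)) 1

omit [DecidableEq I] in
theorem IsDoublePath.coeff_left (h : IsDoublePath A n N) {k : ℕ} (hk : 0 < k) (hkn : k < n) :
    (if k = 1 then -A (N 0) (N 1) else 1) = -A (N (k - 1)) (N k) := by
  split_ifs with h1
  · subst h1; rfl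
  · have := (h.edge (k - 1) (by omega) (by omega)).1
    rw [Nat.sub_add_cancel hk] at this
    rw [this, neg_neg]

omit [DecidableEq I] in
theorem IsDoublePath.coeff_right (h : IsDoublePath A n N) {k : ℕ} (hk : 0 < k) (hkn : k < n) :
    (if k + 1 = n then -A (N n) (N (n - 1)) else 1) = -A (N (k + 1)) (N k) := by
  split_ifs with h1
  · subst h1; rfl
  · rw [(h.edge k hk (by omega)).2, neg_neg]

/-- At interior nodes y_k = z_k z_{k+1}⁻¹, while z_k z_{k+1} carries the exponent of the four-term
expression. This is what makes f_k factor into braces in z_k and z_{k+1}. -/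
theorem IsDoublePath.pathZ_sub (hA : IsGCM A) (h : IsDoublePath A n N) {k : ℕ} (hk : 0 < k)
    (hkn : k < n) : pathZ A n N k - pathZ A n N (k + 1) = yv A (N k) := by
  rw [pathZ, pathZ, h.coeff_left hk hkn, h.coeff_right hk hkn, h.yv_eq hA hk hkn, if_neg hkn.ne,
    if_neg (by omega), Nat.add_sub_cancel]
  module

theorem IsDoublePath.pathZ_add (h : IsDoublePath A n N) {k : ℕ} (hk : 0 < k)
    (hkn : k < n) : pathZ A n N k + pathZ A n N (k + 1) = pathVec A N k := by
  rw [pathZ, pathZ, h.coeff_left hk hkn, h.coeff_right hk hkn, pathVec, if_neg hkn.ne,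
    if_neg (by omega), Nat.add_sub_cancel]
  module

theorem IsDoublePath.yv_zero (hA : IsGCM A) (h : IsDoublePath A n N) :
    (A (N 0) (N 1) = -1 → yv A (N 0) = -(2 • pathZ A n N 1)) ∧
      (A (N 0) (N 1) = -2 → yv A (N 0) = -pathZ A n N 1) := by
  have hn := h.two_le
  rw [h.leftEnd.yv_leaf hA, pathZ, if_neg (by omega), if_pos rfl, Nat.sub_self]
  constructor <;> intro h1 <;> rcases h.left with h2 | h2
  · rw [h2.1, h2.2]; module
  · omega
  · omega
  · rw [h2.1, h2.2]; module

theorem IsDoublePath.yv_last (hA : IsGCM A) (h : IsDoublePath A n N) :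
    (A (N n) (N (n - 1)) = -1 → yv A (N n) = 2 • pathZ A n N n) ∧
      (A (N n) (N (n - 1)) = -2 → yv A (N n) = pathZ A n N n) := by
  have hn := h.two_le
  rw [h.rightEnd.yv_leaf hA, pathZ, if_neg (show n ≠ 1 by omega), if_pos rfl]
  constructor <;> intro h1 <;> rcases h.right with h2 | h2
  · rw [h2.1, h2.2]; module
  · omega
  · omega
  · rw [h2.1, h2.2]; module

/-- The nodes in the order given by a numbering. -/
def nodes (e : Fin (n + 1) ≃ I) (k : ℕ) : I := e (Fin.ofNat (n + 1) k)

theorem val_ofNat {k : ℕ} (hk : k ≤ n) : (Fin.ofNat (n + 1) k).val = k :=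
  Nat.mod_eq_of_lt (by omega)

theorem forall_fin_iff {P : Fin (n + 1) → Prop} :
    (∀ i, P i) ↔ P (Fin.ofNat (n + 1) 0) ∧ P (Fin.ofNat (n + 1) n) ∧
      ∀ k, 0 < k → k < n → P (Fin.ofNat (n + 1) k) := by
  refine ⟨fun h => ⟨h _, h _, fun _ _ _ => h _⟩, fun ⟨h0, hn, hk⟩ i => ?_⟩
  have hi := i.is_lt
  have : i = Fin.ofNat (n + 1) i.val := Fin.ext (val_ofNat (by omega)).symm
  rw [this]
  by_cases h1 : i.val = 0
  · rw [h1]; exact h0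
  · by_cases h2 : i.val = n
    · rw [h2]; exact hn
    · exact hk _ (by omega) (by omega)

omit [DecidableEq I] in
theorem tridiag_apply {u l : ℕ → ℤ} {e : Fin (n + 1) ≃ I} (he : IsNumbering A (tridiag n u l) e)
    {k m : ℕ} (hk : k ≤ n) (hm : m ≤ n) : A (nodes e k) (nodes e m) =
      if k = m then 2 else if m = k + 1 then u k else if k = m + 1 then l m else 0 := by
  rw [nodes, nodes, he, tridiag, Matrix.of_apply, val_ofNat hk, val_ofNat hm]
  simp only [Fin.ext_iff, val_ofNat hk, val_ofNat hm]

omit [DecidableEq I] in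
theorem tridiag_upper {u l : ℕ → ℤ} {e : Fin (n + 1) ≃ I} (he : IsNumbering A (tridiag n u l) e)
    {k : ℕ} (hk : k < n) : A (nodes e k) (nodes e (k + 1)) = u k := by
  rw [tridiag_apply he (by omega) (by omega), if_neg (by omega), if_pos rfl]

omit [DecidableEq I] in
theorem tridiag_lower {u l : ℕ → ℤ} {e : Fin (n + 1) ≃ I} (he : IsNumbering A (tridiag n u l) e)
    {k : ℕ} (hk : k < n) : A (nodes e (k + 1)) (nodes e k) = l k := by
  rw [tridiag_apply he (by omega) (by omega), if_neg (by omega), if_neg (by omega), if_pos rfl]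

omit [DecidableEq I] in
theorem isDoublePath_of_tridiag {u l : ℕ → ℤ} {e : Fin (n + 1) ≃ I}
    (he : IsNumbering A (tridiag n u l) e) (hn : 2 ≤ n)
    (hul : ∀ k, 0 < k → k + 1 < n → u k = -1 ∧ l k = -1)
    (hleft : (u 0 = -1 ∧ l 0 = -2) ∨ (u 0 = -2 ∧ l 0 = -1))
    (hright : (l (n - 1) = -1 ∧ u (n - 1) = -2) ∨ (l (n - 1) = -2 ∧ u (n - 1) = -1)) :
    IsDoublePath A n (nodes e) where
  two_le := hn
  surj i := ⟨(e.symm i).val, by have := (e.symm i).is_lt; omega, by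
    have := (e.symm i).is_lt
    rw [nodes, ← Equiv.eq_symm_apply, Fin.ext_iff, val_ofNat (by omega)]⟩
  inj k hk m hm h := by
    have := congrArg Fin.val (e.injective h)
    rwa [val_ofNat hk, val_ofNat hm] at this
  edge k h0 h1 := by
    rw [tridiag_upper he (by omega), tridiag_lower he (by omega)]
    exact hul k h0 h1
  far k m h1 hm := by
    rw [tridiag_apply he (by omega) hm, tridiag_apply he hm (by omega), if_neg (by omega),
      if_neg (by omega), if_neg (by omega), if_neg (by omega), if_neg (by omega),
      if_neg (by omega)]
    exact ⟨rfl, rfl⟩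
  left := by
    rw [tridiag_upper he (k := 0) (by omega), tridiag_lower he (k := 0) (by omega)]
    exact hleft
  right := by
    have h1 := tridiag_upper he (k := n - 1) (by omega)
    have h2 := tridiag_lower he (k := n - 1) (by omega)
    rw [Nat.sub_add_cancel (by omega)] at h1 h2
    rw [h1, h2]
    exact hright

theorem X_eq_mono (e : Fin (n + 1) ≃ I) (k : ℕ) : X e k = mono (Pi.single (nodes e k) 1) := rfl

theorem X_zpow_mul_X_zpow (e : Fin (n + 1) ≃ I) (k m : ℕ) (r s : ℕ) :
    (X e k ^ r)⁻¹ * X e m ^ s =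
      mono ((s : ℤ) • Pi.single (nodes e m) 1 - (r : ℤ) • Pi.single (nodes e k) 1) := by
  rw [X_eq_mono, X_eq_mono, sub_eq_add_neg, mono_add, mono_neg, mono_zsmul, mono_zsmul,
    zpow_natCast, zpow_natCast, mul_comm]

theorem neg_im_inv : -im⁻¹ = im := by
  ext1
  simp [im]

theorem im_sq : (im : ℂ) ^ 2 = -1 := by simp [im]

omit [DecidableEq I] in
/-- A family of Laurent polynomials given by its values on the nodes of a path. -/
theorem forall_eq_iff_of_smul_eq (hQ : IsQFamily A Q d) {e : Fin (n + 1) ≃ I}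
    {φ : I → Laurent I} {sol : Fin (n + 1) → Laurent I} {g0 gn : Laurent I} {g : ℕ → Laurent I}
    (h0 : scaleFactor Q (nodes e 0) • sol (Fin.ofNat (n + 1) 0) = g0)
    (h1 : scaleFactor Q (nodes e n) • sol (Fin.ofNat (n + 1) n) = gn)
    (h2 : ∀ k, 0 < k → k < n → scaleFactor Q (nodes e k) • sol (Fin.ofNat (n + 1) k) = g k) :
    (∀ i, φ (e i) = sol i) ↔ scaleFactor Q (nodes e 0) • φ (nodes e 0) = g0 ∧
      scaleFactor Q (nodes e n) • φ (nodes e n) = gn ∧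
      ∀ k, 0 < k → k < n → scaleFactor Q (nodes e k) • φ (nodes e k) = g k := by
  rw [forall_fin_iff]
  refine and_congr (scaleFactor_smul_eq_iff hQ h0).symm
    (and_congr (scaleFactor_smul_eq_iff hQ h1).symm ?_)
  exact forall_congr' fun k => forall_congr' fun h3 => forall_congr' fun h4 =>
    (scaleFactor_smul_eq_iff hQ (h2 k h3 h4)).symm

theorem IsDoublePath.smul_interior (hA : IsGCM A) (hQ : IsQFamily A Q d)
    (h : IsDoublePath A n N) {k : ℕ} (hk : 0 < k) (hkn : k < n) {a b : ℂˣ} {c : ℂ}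
    (hab : a = Q (N 1) * b) (hc : c = -((Q (N 1) : ℂ) ^ 2 * (b : ℂ) ^ 2)) :
    scaleFactor Q (N k) • (brace (Q (N k)) (scal a * mono (pathZ A n N k)) *
      brace (Q (N k)) (scal b * mono (pathZ A n N (k + 1)))) =
      fourTerm A Q (N k) (pathVec A N k) c := by
  rw [← h.q_eq hQ hk hkn] at hab hc
  rw [scaleFactor_smul_brace_mul_brace hQ (h.pathZ_sub hA hk hkn) hab, h.pathZ_add hk hkn, hc]

omit [DecidableEq I] in
-- For v = 0 the involution c ↦ q_i² c⁻¹ acts on the constant alone.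
theorem fourTerm_zero_inv {i : I} {c c' : ℂ} (h : c * c' = (Q i : ℂ) ^ 2) :
    fourTerm A Q i 0 c = fourTerm A Q i 0 c' := by
  have h1 := fourTerm_neg (A := A) (Q := Q) (i := i) 0 c'
  have h2 : c' ≠ 0 := by
    rintro rfl
    rw [mul_zero, eq_comm] at h
    exact pow_ne_zero _ (Q i).ne_zero h
  rw [neg_zero] at h1
  rw [h1, ← h, mul_inv_cancel_right₀ h2]

end families

/-! ### Explicit solutions for C_n^{(1)}, A_{2n}^{(2)} and D_{n+1}^{(2)}, n ≥ 2 -/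

section solutions

variable {I : Type*} [Fintype I] [DecidableEq I]

variable {A : Matrix I I ℤ} {d : I → ℚ} {n : ℕ} {e : Fin (n + 1) ≃ I} {ħ : ℂ} {a a' : I → ℕ}

theorem val_qpow_mul (ħ : ℂ) (s t : ℚ) : (qpow ħ s : ℂ) * qpow ħ t = qpow ħ (s + t) := by
  rw [qpow_add, Units.val_mul]

theorem val_qpow_pow (ħ : ℂ) (s : ℚ) (n : ℕ) : (qpow ħ s : ℂ) ^ n = qpow ħ (s * n) := by
  rw [← qpow_pow, Units.val_pow_eq_pow_val]

omit [Fintype I] in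
theorem solC_smul {Q : I → ℂˣ} (hA : IsGCM A) (hQ : IsQFamily A Q d)
    (h : IsDoublePath A n (nodes e)) (h0 : A (nodes e 0) (nodes e 1) = -1)
    (hn : A (nodes e n) (nodes e (n - 1)) = -1) {b : ℂˣ}
    (hb : (Q (nodes e 1) : ℂ) ^ 2 * (b : ℂ) ^ 4 = 1) {c : ℂ}
    (hc : c = -((Q (nodes e 1) : ℂ) ^ 2 * (b : ℂ) ^ 2)) :
    scaleFactor Q (nodes e 0) • solC Q e b (Fin.ofNat (n + 1) 0) =
        endTerm A Q (nodes e 0) (nodes e 1) c ∧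
      scaleFactor Q (nodes e n) • solC Q e b (Fin.ofNat (n + 1) n) =
        endTerm A Q (nodes e n) (nodes e (n - 1)) c ∧
      ∀ k, 0 < k → k < n → scaleFactor Q (nodes e k) • solC Q e b (Fin.ofNat (n + 1) k) =
        fourTerm A Q (nodes e k) (pathVec A (nodes e) k) c := by
  have h2 := h.two_le
  have hz : ∀ k, zC e k = mono (pathZ A n (nodes e) k) := fun k => by
    have := X_zpow_mul_X_zpow e (k - 1) k 1 1
    rw [pow_one, pow_one] at this
    rw [zC, this, pathZ, h0, hn]
    congr 2 <;> split_ifs <;> rfl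
  -- At an end node the product of braces has constant -q_i² b², not c = -q_1² b². Their product is
  -- q_i² by the hypothesis on b, so both give the same expression.
  have hend : ∀ i, fourTerm A Q i 0 (-((Q i : ℂ) ^ 2 * (b : ℂ) ^ 2)) = fourTerm A Q i 0 c :=
    fun i => fourTerm_zero_inv (by rw [hc]; linear_combination (Q i : ℂ) ^ 2 * hb)
  refine ⟨?_, ?_, fun k hk hkn => ?_⟩
  · rw [endTerm, if_neg (by rw [h0]; norm_num), solC, if_pos (val_ofNat (Nat.zero_le n)), hz,
      ← mono_neg, ← nodes, scaleFactor_smul_brace_mul_brace hQ ?_ rfl, neg_add_cancel, hend]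
    rw [(h.yv_zero hA).1 h0]; module
  · rw [endTerm, if_neg (by rw [hn]; norm_num), solC, if_neg (by rw [val_ofNat le_rfl]; omega),
      if_pos (val_ofNat le_rfl), hz, ← mono_neg, ← nodes,
      scaleFactor_smul_brace_mul_brace hQ ?_ rfl, add_neg_cancel, hend]
    rw [(h.yv_last hA).1 hn]; module
  · rw [solC, val_ofNat hkn.le, if_neg hk.ne', if_neg hkn.ne, hz, hz, ← nodes]
    exact h.smul_interior hA hQ hk hkn (by rw [h.q_eq hQ hk hkn]) hc

theorem cartanC_solution_iff (hA : IsAffineCartan A) (ha : IsLabels A a)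
    (ha' : IsLabels A.transpose a') (hq : ∀ m : ℕ, 0 < m → Complex.exp ħ ^ m ≠ 1) (hn : 2 ≤ n)
    (he : IsNumbering A (cartanC n) e) (φ : I → Laurent I) :
    IsSolution A (qi ħ a a') φ ↔ ∃ b : ℂˣ, (b = qpow ħ (-1 / 4) ∨ b = im * qpow ħ (-1 / 4)) ∧
      ∀ i, φ (e i) = solC (qi ħ a a') e b i := by
  have hQ := isQFamily_qi hA ha ha' hq
  have h : IsDoublePath A n (nodes e) := by
    refine isDoublePath_of_tridiag he hn (fun k h1 h2 => ?_) (Or.inl ?_) (Or.inl ?_)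
    · rw [if_neg (by omega), if_neg (by omega)]; exact ⟨rfl, rfl⟩
    · rw [if_neg (by omega), if_pos rfl]; exact ⟨rfl, rfl⟩
    · rw [if_neg (by omega), if_pos (by omega)]; exact ⟨rfl, rfl⟩
  have h0 : A (nodes e 0) (nodes e 1) = -1 := by
    rw [tridiag_upper he (k := 0) (by omega), if_neg (by omega)]
  have h1 : A (nodes e n) (nodes e (n - 1)) = -1 := by
    have := tridiag_lower he (k := n - 1) (by omega)
    rwa [Nat.sub_add_cancel (by omega), if_neg (by omega)] at this
  have h0' : A (nodes e 1) (nodes e 0) = -2 := by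
    rcases h.left with h2 | h2
    · exact h2.2
    · omega
  have h1' : A (nodes e (n - 1)) (nodes e n) = -2 := by
    rcases h.right with h2 | h2
    · exact h2.2
    · omega
  have hq1 : qi ħ a a' (nodes e 1) = qpow ħ (1 / 2) := by
    refine (h.qi_interior hA ha ha' ?_).1 h0
    rw [(h.labels hA.gcm ha).1 h0, (h.transpose.labels hA.gcm.transpose ha').2.1 h0' h1']
    norm_num
  have hr : (qi ħ a a' (nodes e 1) : ℂ) * (qpow ħ (-1 / 4) : ℂ) ^ 2 = 1 := by
    rw [hq1, val_qpow_pow, val_qpow_mul]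
    norm_num [qpow_zero]
  rw [isSolution_iff hA.gcm hQ, h.isNormalSolution_iff hA.gcm hQ]
  set p : ℂ := (qi ħ a a' (nodes e 1) : ℂ)
  have hsol : ∀ {b : ℂˣ} {c : ℂ}, p ^ 2 * (b : ℂ) ^ 4 = 1 → c = -(p ^ 2 * (b : ℂ) ^ 2) →
      ((∀ i, φ (e i) = solC (qi ħ a a') e b i) ↔ _) := fun hb hc =>
    have := solC_smul hA.gcm hQ h h0 h1 hb hc
    forall_eq_iff_of_smul_eq hQ this.1 this.2.1 this.2.2
  set r : ℂ := (qpow ħ (-1 / 4) : ℂ)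
  have hI := im_sq
  constructor
  · rintro ⟨c, hc, -, -, hφ⟩
    -- The relation c = -q_1² b² with q_1 = q^{1/2} turns c = q_1 into b = ±ι q^{-1/4} and c = -q_1
    -- into b = ±q^{-1/4}. The sign of b does not affect the solution, so one representative of each
    -- pair is kept.
    rcases sq_eq_sq_iff_eq_or_eq_neg.1 hc with hc | hc
    · refine ⟨_, Or.inr rfl, (hsol ?_ ?_).2 hφ⟩
      · rw [Units.val_mul]
        linear_combination (p ^ 2 * r ^ 4 * ((im : ℂ) ^ 2 - 1)) * hI + (p * r ^ 2 + 1) * hr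
      · rw [Units.val_mul, hc]
        linear_combination (p ^ 2 * r ^ 2) * hI - p * hr
    · refine ⟨_, Or.inl rfl, (hsol ?_ ?_).2 hφ⟩
      · linear_combination (p * r ^ 2 + 1) * hr
      · rw [hc]
        linear_combination p * hr
  · rintro ⟨b, hb, hφ⟩
    have hb4 : p ^ 2 * (b : ℂ) ^ 4 = 1 := by
      rcases hb with rfl | rfl
      · linear_combination (p * r ^ 2 + 1) * hr
      · rw [Units.val_mul]
        linear_combination (p ^ 2 * r ^ 4 * ((im : ℂ) ^ 2 - 1)) * hI + (p * r ^ 2 + 1) * hr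
    refine ⟨_, ?_, fun h2 => by omega, fun h2 => by omega, (hsol hb4 rfl).1 hφ⟩
    linear_combination p ^ 2 * hb4

omit [Fintype I] [DecidableEq I] in
theorem scaleFactor_smul_brace_same {Q : I → ℂˣ} (hQ : IsQFamily A Q d) {i : I} {z : I → ℤ}
    (hz : yv A i = -(2 • z)) (hi : Q i = qpow ħ 2) :
    scaleFactor Q i • (brace (Q i) (scal (im * qpow ħ (-3 / 2)) * mono z) *
      brace (Q i) (scal (im * qpow ħ (-1 / 2)) * mono z)) = fourTerm A Q i 0 (qpow ħ 1) := by
  -- Both braces involve z, so the first one is rewritten by u ↦ -u⁻¹ as a brace in z⁻¹ with scalar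
  -- ι q^{3/2} = q² · ι q^{-1/2}. The resulting constant is q³, equivalent to q under c ↦ q_0² c⁻¹.
  have h1 : -(im * qpow ħ (-3 / 2))⁻¹ = Q i * (im * qpow ħ (-1 / 2)) := by
    rw [mul_inv, ← neg_mul, neg_im_inv, ← qpow_neg, hi, mul_left_comm, ← qpow_add]
    norm_num
  rw [brace_scal_mono_neg _ (im * qpow ħ (-3 / 2)), h1,
    scaleFactor_smul_brace_mul_brace hQ (by rw [hz]; module) rfl, neg_add_cancel]
  apply fourTerm_zero_inv
  rw [Units.val_mul, mul_pow, im_sq, hi]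
  simp only [neg_one_mul, mul_neg, neg_neg]
  simp only [val_qpow_pow, val_qpow_mul]
  norm_num

theorem cartanA2_solution_iff (hA : IsAffineCartan A) (ha : IsLabels A a)
    (ha' : IsLabels A.transpose a') (hq : ∀ m : ℕ, 0 < m → Complex.exp ħ ^ m ≠ 1) (hn : 2 ≤ n)
    (he : IsNumbering A (cartanA2 n) e) (φ : I → Laurent I) :
    IsSolution A (qi ħ a a') φ ↔ ∀ i, φ (e i) = solA2 ħ (qi ħ a a') e i := by
  have hQ := isQFamily_qi hA ha ha' hq
  have h : IsDoublePath A n (nodes e) := by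
    refine isDoublePath_of_tridiag he hn (fun k h1 h2 => ?_) (Or.inl ?_) (Or.inr ?_)
    · rw [if_neg (by omega), if_neg (by omega)]; exact ⟨rfl, rfl⟩
    · rw [if_pos rfl, if_neg (by omega)]; exact ⟨rfl, rfl⟩
    · rw [if_neg (by omega), if_pos (by omega)]; exact ⟨rfl, rfl⟩
  have h0 : A (nodes e 0) (nodes e 1) = -1 := tridiag_upper he (k := 0) (by omega)
  have h1 : A (nodes e n) (nodes e (n - 1)) = -2 := by
    have := tridiag_lower he (k := n - 1) (by omega)
    rw [Nat.sub_add_cancel (by omega), if_neg (by omega), if_pos (by omega)] at this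
    rw [this]; rfl
  have h0' : A (nodes e 1) (nodes e 0) = -2 := by
    rcases h.left with h2 | h2
    · exact h2.2
    · omega
  have h1' : A (nodes e (n - 1)) (nodes e n) = -1 := by
    rcases h.right with h2 | h2
    · omega
    · exact h2.2
  have hd0 : (a' (nodes e 0) : ℚ) / a (nodes e 0) = 2 := by
    rw [(h.labels hA.gcm ha).1 h0, (h.transpose.labels hA.gcm.transpose ha').2.2 h0' h1']
    norm_num
  have hq0 : qi ħ a a' (nodes e 0) = qpow ħ 2 := by rw [qi, hd0]
  have hq1 : qi ħ a a' (nodes e 1) = qpow ħ 1 := by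
    rw [(h.qi_interior hA ha ha' hd0).1 h0]; norm_num
  have hqn : qi ħ a a' (nodes e n) = qpow ħ (1 / 2) := (h.qi_right hA ha ha' hq hq1).2 h1
  have hz : ∀ k, zA2 e k = mono (pathZ A n (nodes e) k) := fun k => by
    have := X_zpow_mul_X_zpow e (k - 1) k 1 (if k = n then 2 else 1)
    rw [pow_one] at this
    rw [zA2, this, pathZ, h0, h1]
    congr 2 <;> split_ifs <;> rfl
  have key := forall_eq_iff_of_smul_eq (φ := φ) (e := e) hQ (sol := solA2 ħ (qi ħ a a') e)
    (g0 := endTerm A (qi ħ a a') (nodes e 0) (nodes e 1) (qpow ħ 1))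
    (gn := endTerm A (qi ħ a a') (nodes e n) (nodes e (n - 1)) (qpow ħ 1))
    (g := fun k => fourTerm A (qi ħ a a') (nodes e k) (pathVec A (nodes e) k) (qpow ħ 1))
    ?_ ?_ ?_
  · rw [isSolution_iff hA.gcm hQ, h.isNormalSolution_iff hA.gcm hQ, key, hq1]
    constructor
    · rintro ⟨c, -, -, hc, hφ⟩
      -- The entry a_{n,n-1} = -2 leaves only c = q_1, so the solution is unique.
      rwa [hc h1] at hφ
    · exact fun hφ => ⟨_, rfl, fun _ => rfl, fun _ => rfl, hφ⟩
  · rw [endTerm, if_neg (by rw [h0]; norm_num), solA2, if_pos (val_ofNat (Nat.zero_le n)), hz,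
      ← nodes]
    exact scaleFactor_smul_brace_same hQ ((h.yv_zero hA.gcm).1 h0) hq0
  · rw [endTerm, if_pos h1, solA2, if_neg (by rw [val_ofNat le_rfl]; omega),
      if_pos (val_ofNat le_rfl), hz, ← nodes]
    exact scaleFactor_smul_I_smul_brace hQ
      (Or.inl ⟨((h.yv_last hA.gcm).2 h1).symm, by rw [Units.val_mul, hqn]; rfl⟩)
  · intro k hk hkn
    rw [solA2, val_ofNat hkn.le, if_neg hk.ne', if_neg hkn.ne, hz, hz, ← nodes]
    refine h.smul_interior hA.gcm hQ hk hkn ?_ ?_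
    · rw [hq1, mul_left_comm, ← qpow_add]; norm_num
    · rw [hq1, Units.val_mul, mul_pow, im_sq]
      simp only [neg_one_mul, mul_neg, neg_neg]
      simp only [val_qpow_pow, val_qpow_mul]
      norm_num

theorem cartanD2_solution_iff (hA : IsAffineCartan A) (ha : IsLabels A a)
    (ha' : IsLabels A.transpose a') (hq : ∀ m : ℕ, 0 < m → Complex.exp ħ ^ m ≠ 1) (hn : 2 ≤ n)
    (he : IsNumbering A (cartanD2 n) e) (φ : I → Laurent I) :
    IsSolution A (qi ħ a a') φ ↔ ∀ i, φ (e i) = solD2 ħ (qi ħ a a') e i := by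
  have hQ := isQFamily_qi hA ha ha' hq
  have h : IsDoublePath A n (nodes e) := by
    refine isDoublePath_of_tridiag he hn (fun k h1 h2 => ?_) (Or.inr ?_) (Or.inr ?_)
    · rw [if_neg (by omega), if_neg (by omega)]; exact ⟨rfl, rfl⟩
    · rw [if_pos rfl, if_neg (by omega)]; exact ⟨rfl, rfl⟩
    · rw [if_pos (by omega), if_neg (by omega)]; exact ⟨rfl, rfl⟩
  have h0 : A (nodes e 0) (nodes e 1) = -2 := by
    rw [tridiag_upper he (k := 0) (by omega), if_pos rfl]
  have h1 : A (nodes e n) (nodes e (n - 1)) = -2 := by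
    have := tridiag_lower he (k := n - 1) (by omega)
    rwa [Nat.sub_add_cancel (by omega), if_pos rfl] at this
  have h0' : A (nodes e 1) (nodes e 0) = -1 := by
    rcases h.left with h2 | h2
    · omega
    · exact h2.2
  have hd0 : (a' (nodes e 0) : ℚ) / a (nodes e 0) = 1 := by
    rw [(h.labels hA.gcm ha).2.1 h0 h1, (h.transpose.labels hA.gcm.transpose ha').1 h0']
    norm_num
  have hq0 : qi ħ a a' (nodes e 0) = qpow ħ 1 := by rw [qi, hd0]
  have hq1 : qi ħ a a' (nodes e 1) = qpow ħ 2 := by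
    rw [(h.qi_interior hA ha ha' hd0).2 h0]; norm_num
  have hqn : qi ħ a a' (nodes e n) = qpow ħ 1 := by
    rw [(h.qi_right hA ha ha' hq hq1).2 h1]; norm_num
  have hz : ∀ k, zD2 e k = mono (pathZ A n (nodes e) k) := fun k => by
    rw [zD2, X_zpow_mul_X_zpow, pathZ, h0, h1]
    congr 2 <;> split_ifs <;> rfl
  have key := forall_eq_iff_of_smul_eq (φ := φ) (e := e) hQ (sol := solD2 ħ (qi ħ a a') e)
    (g0 := endTerm A (qi ħ a a') (nodes e 0) (nodes e 1) (qpow ħ 2))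
    (gn := endTerm A (qi ħ a a') (nodes e n) (nodes e (n - 1)) (qpow ħ 2))
    (g := fun k => fourTerm A (qi ħ a a') (nodes e k) (pathVec A (nodes e) k) (qpow ħ 2))
    ?_ ?_ ?_
  · rw [isSolution_iff hA.gcm hQ, h.isNormalSolution_iff hA.gcm hQ, key, hq1]
    constructor
    · rintro ⟨c, -, -, hc, hφ⟩
      rwa [hc h1] at hφ
    · exact fun hφ => ⟨_, rfl, fun _ => rfl, fun _ => rfl, hφ⟩
  · rw [endTerm, if_pos h0, solD2, if_pos (val_ofNat (Nat.zero_le n)), hz, ← nodes]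
    refine scaleFactor_smul_I_smul_brace hQ (Or.inr ⟨?_, ?_⟩)
    · rw [(h.yv_zero hA.gcm).2 h0, neg_neg]
    · rw [Units.val_mul, hq0, qpow_neg, Units.val_inv_eq_inv_val]; rfl
  · rw [endTerm, if_pos h1, solD2, if_neg (by rw [val_ofNat le_rfl]; omega),
      if_pos (val_ofNat le_rfl), hz, ← nodes]
    exact scaleFactor_smul_I_smul_brace hQ
      (Or.inl ⟨((h.yv_last hA.gcm).2 h1).symm, by rw [Units.val_mul, hqn]; rfl⟩)
  · intro k hk hkn
    rw [solD2, val_ofNat hkn.le, if_neg hk.ne', if_neg hkn.ne, hz, hz, ← nodes]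
    refine h.smul_interior hA.gcm hQ hk hkn ?_ ?_
    · rw [hq1, mul_left_comm, ← qpow_add]; norm_num
    · rw [hq1, Units.val_mul, mul_pow, im_sq]
      simp only [neg_one_mul, mul_neg, neg_neg]
      simp only [val_qpow_pow, val_qpow_mul]
      norm_num

end solutions

/-! ### Type A_2^{(2)} -/

section rankTwo

variable {I : Type*} [Fintype I]

variable {A : Matrix I I ℤ} {e : Fin (1 + 1) ≃ I} {ħ : ℂ} {a a' : I → ℕ}

omit [Fintype I] in
theorem fin_two_cases {e : Fin (1 + 1) ≃ I} (i : I) : i = nodes e 0 ∨ i = nodes e 1 := by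
  obtain ⟨k, rfl⟩ := e.surjective i
  fin_cases k
  · exact Or.inl rfl
  · exact Or.inr rfl

omit [Fintype I] in
theorem cartanA2_one_apply (he : IsNumbering A (cartanA2 1) e) :
    A (nodes e 0) (nodes e 0) = 2 ∧ A (nodes e 0) (nodes e 1) = -1 ∧
      A (nodes e 1) (nodes e 0) = -4 ∧ A (nodes e 1) (nodes e 1) = 2 := by
  refine ⟨?_, ?_, ?_, ?_⟩
  · rw [tridiag_apply he zero_le_one zero_le_one]; rfl
  · exact tridiag_upper he (k := 0) one_pos
  · exact tridiag_lower he (k := 0) one_pos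
  · rw [tridiag_apply he le_rfl le_rfl]; rfl

theorem cartanA2_one_labels (ha : IsLabels A a) (ha' : IsLabels A.transpose a')
    (he : IsNumbering A (cartanA2 1) e) : a (nodes e 0) = 1 ∧ a (nodes e 1) = 2 ∧
      a' (nodes e 0) = 2 ∧ a' (nodes e 1) = 1 := by
  obtain ⟨h00, h01, h10, h11⟩ := cartanA2_one_apply he
  have hs : ∀ g : I → ℤ, ∑ i, g i = g (nodes e 0) + g (nodes e 1) := fun g => by
    rw [← e.sum_comp, Fin.sum_univ_two]; rfl
  have h1 := ha.null (nodes e 0)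
  have h2 := ha'.null (nodes e 1)
  rw [hs] at h1 h2
  simp only [Matrix.transpose_apply, h00, h01, h11] at h1 h2
  have h3 : a (nodes e 0) = 1 := ha.eq_one fun j => by
    rcases fin_two_cases (e := e) j with rfl | rfl
    · rfl
    · exact ⟨2, by omega⟩
  have h4 : a' (nodes e 1) = 1 := ha'.eq_one fun j => by
    rcases fin_two_cases (e := e) j with rfl | rfl
    · exact ⟨2, by omega⟩
    · rfl
  omega

theorem cartanA2_one_solution_iff [DecidableEq I] (hA : IsAffineCartan A) (ha : IsLabels A a)
    (ha' : IsLabels A.transpose a') (hq : ∀ m : ℕ, 0 < m → Complex.exp ħ ^ m ≠ 1)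
    (he : IsNumbering A (cartanA2 1) e) (φ : I → Laurent I) :
    IsSolution A (qi ħ a a') φ ↔ ∀ i, φ (e i) = solA2 ħ (qi ħ a a') e i := by
  have hQ := isQFamily_qi hA ha ha' hq
  obtain ⟨h00, h01, h10, h11⟩ := cartanA2_one_apply he
  obtain ⟨l0, l1, l0', l1'⟩ := cartanA2_one_labels ha ha' he
  have hq0 : qi ħ a a' (nodes e 0) = qpow ħ 2 := by rw [qi, l0, l0']; norm_num
  have hq1 : qi ħ a a' (nodes e 1) = qpow ħ (1 / 2) := by rw [qi, l1, l1']; norm_num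
  have hne : nodes e 0 ≠ nodes e 1 := fun h => by rw [← h, h00] at h01; norm_num at h01
  have hc1 : (qpow ħ 1 : ℂ) = (qi ħ a a' (nodes e 1) : ℂ) ^ 2 := by
    rw [hq1, val_qpow_pow]; norm_num
  have hcq : (qpow ħ 1 : ℂ) ^ 2 = qi ħ a a' (nodes e 0) := by
    rw [hq0, val_qpow_pow]; norm_num
  set z : I → ℤ := 2 • Pi.single (nodes e 1) 1 - Pi.single (nodes e 0) 1 with hzdef
  have hz : zA2 e 1 = mono z := by
    have := X_zpow_mul_X_zpow e 0 1 1 2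
    rw [pow_one] at this
    rw [zA2, if_pos rfl, Nat.sub_self, this, hzdef]
    congr 1
    module
  have hy0 : yv A (nodes e 0) = -(2 • z) := by
    funext i
    rcases fin_two_cases (e := e) i with rfl | rfl
    · simp [yv, h00, hzdef, Pi.single_eq_of_ne hne]
    · simp [yv, h10, hzdef, Pi.single_eq_of_ne hne.symm]
  have hy1 : yv A (nodes e 1) = z := by
    funext i
    rcases fin_two_cases (e := e) i with rfl | rfl
    · simp [yv, h01, hzdef, Pi.single_eq_of_ne hne]
    · simp [yv, h11, hzdef, Pi.single_eq_of_ne hne.symm]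
  rw [isSolution_iff hA.gcm hQ, forall_eq_iff_of_smul_eq hQ
    (g0 := fourTerm A (qi ħ a a') (nodes e 0) 0 (qpow ħ 1))
    (gn := twoTerm A (qi ħ a a') (nodes e 1)) (g := fun _ => 0) ?_ ?_
    fun k h1 h2 => by omega]
  · constructor
    · intro hf
      obtain ⟨v, c, hc, hvi, hfi, hv, hj⟩ := hf.edge hA.gcm hQ hne h01
      -- With a_{10} = -4 the four-term shape at node 1 would require v_1 = -2, but v_1 is 4 or 0.
      -- The two-term shape then gives v = y_0 + 2 y_1 = 0 as exponents, and c = q_1² = q.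
      have hj2 : v - yv A (nodes e 0) = 2 • yv A (nodes e 1) ∧
          c = (qi ħ a a' (nodes e 1) : ℂ) ^ 2 ∧
          scaleFactor (qi ħ a a') (nodes e 1) • φ (nodes e 1) =
            twoTerm A (qi ħ a a') (nodes e 1) := by
        rcases hj with h | h
        · rcases hv with h' | h'
          · omega
          · rw [h'.1, Pi.zero_apply] at h; omega
        · exact ⟨h.1, h.2.1, h.2.2.2⟩
      have hv0 : v = 0 := by
        rw [sub_eq_iff_eq_add.1 hj2.1, hy0, hy1, add_neg_cancel]
      refine ⟨?_, hj2.2.2, fun k h1 h2 => by omega⟩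
      rw [hc1, ← hj2.2.1, ← hv0]
      exact hfi
    · rintro ⟨h0, h1, -⟩
      have hs : Shiftable (qi ħ a a') (nodes e 0) (nodes e 1)
          (scaleFactor (qi ħ a a') (nodes e 0) • φ (nodes e 0))
          (scaleFactor (qi ħ a a') (nodes e 1) • φ (nodes e 1)) := by
        rw [h0, h1]
        exact shiftable_twoTerm hA.gcm hQ h01 (Pi.zero_apply _) (Or.inr ⟨rfl, hcq⟩)
          (by rw [hy0, hy1]; module) hc1
      refine ⟨fun i => ?_, fun i j hij => ?_⟩
      · rcases fin_two_cases (e := e) i with rfl | rfl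
        · rw [h0]; exact isNormal_fourTerm (Pi.zero_apply _) _
        · rw [h1]; exact isNormal_twoTerm
      · rcases fin_two_cases (e := e) i with rfl | rfl <;>
          rcases fin_two_cases (e := e) j with rfl | rfl
        · exact absurd rfl hij
        · exact hs
        · exact shiftable_symm.1 hs
        · exact absurd rfl hij
  · rw [solA2, if_pos (val_ofNat zero_le_one), hz, ← nodes]
    exact scaleFactor_smul_brace_same hQ hy0 hq0
  · rw [solA2, if_neg (by rw [val_ofNat le_rfl]; omega), if_pos (val_ofNat le_rfl), hz, ← nodes]
    exact scaleFactor_smul_I_smul_brace hQ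
      (Or.inl ⟨hy1.symm, by rw [Units.val_mul, hq1]; rfl⟩)

end rankTwo

/-! ### Conditions on A imposed by a solution -/

section localRules

variable {I : Type*} {A : Matrix I I ℤ} {Q : I → ℂˣ} {d : I → ℚ} {f : I → Laurent I}

/-- The node `j` is the only possible neighbour of `i`. -/
def IsLeaf (A : Matrix I I ℤ) (i j : I) : Prop := ∀ k, k ≠ i → k ≠ j → A k i = 0

/-- The local conditions on a generalized Cartan matrix imposed by the existence of
a solution. -/
structure IsLocallyAdmissible (A : Matrix I I ℤ) : Prop where
  edge : ∀ i j, i ≠ j → A i j = -1 →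
    A j i = -1 ∨ (A j i = -2 ∧ (IsLeaf A i j ∨ IsLeaf A j i)) ∨ A j i = -4
  branch : ∀ i j k m, j ≠ i → k ≠ i → m ≠ i → j ≠ k → j ≠ m → k ≠ m → A i j = -1 → A i k = -1 →
    A m i = 0

/-- Along an edge, v_j is -a_{ji} or 0 and v_j - a_{ji} is 2 or 4; the four combinations give the
possible values of a_{ji}, with a leaf in the two mixed cases. At a branching node, the edges to j
and k describe f_i by vectors v and w that must agree up to sign: at j they differ by a sign, so w =
-v, but at m both equal a_{mi}, which must therefore vanish. -/
theorem IsNormalSolution.isLocallyAdmissible (hA : IsGCM A) (hQ : IsQFamily A Q d)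
    (hf : IsNormalSolution A Q f) : IsLocallyAdmissible A where
  edge i j hne hij := by
    obtain ⟨v, c, -, -, -, hv, hj⟩ := hf.edge hA hQ hne hij
    have hδ : v - yv A i = 2 • yv A j → v j - A j i = 4 := fun h => by
      have := congrFun h j
      simpa [yv, hA.diag] using this
    rcases hv with ⟨-, h1, -⟩ | ⟨h1, -, h2⟩ <;> rcases hj with ⟨h3, -⟩ | ⟨h3, -, h4, -⟩
    · left; omega
    · right; left
      exact ⟨by have := hδ h3; omega, Or.inr fun k h5 h6 => h4 k h6 h5⟩
    · right; left
      rw [h1, Pi.zero_apply] at h3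
      exact ⟨by omega, Or.inl h2⟩
    · right; right
      have := hδ h3
      rw [h1, Pi.zero_apply] at this
      omega
  branch i j k m hj hk hm hjk hjm hkm hij hik := by
    by_contra hmi
    have hvec : ∀ j k, j ≠ i → k ≠ i → j ≠ k → A i j = -1 → A k i ≠ 0 →
        ∃ (v : I → ℤ) (c : ℂ), c ≠ 0 ∧ v i = 0 ∧ f i = fourTerm A Q i v c ∧ v ≠ 0 ∧
          v j = -A j i ∧ ∀ k, k ≠ i → k ≠ j → v k = A k i := by
      intro j k hj hk hjk hij hki
      obtain ⟨v, c, hc, hvi, hfi, hv, -⟩ := hf.edge hA hQ hj.symm hij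
      rcases hv with hv | hv
      · exact ⟨v, c, hc, hvi, hfi, hv⟩
      · exact absurd (hv.2.2 k hk hjk.symm) hki
    have hji : A j i ≠ 0 := fun h => by rw [hA.zero _ _ h] at hij; norm_num at hij
    have hki : A k i ≠ 0 := fun h => by rw [hA.zero _ _ h] at hik; norm_num at hik
    obtain ⟨v, c, hc, hvi, hfi, hv0, hvj, hv⟩ := hvec j k hj hk hjk hij hki
    obtain ⟨w, b, -, -, hfi', -, hwk, hw⟩ := hvec k j hk hj hjk.symm hik hji
    rcases fourTerm_left_injective hA hvi hv0 hc (hfi.symm.trans hfi') with h | h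
    · have h1 := congrFun h j
      rw [hvj, hw j hj hjk] at h1
      omega
    · have h1 := congrFun h m
      rw [Pi.neg_apply, hv m hm hjm.symm, hw m hm hkm.symm] at h1
      omega

end localRules

/-! ### Inequalities from the positive null vector -/

section nullVector

variable {I : Type*} {A : Matrix I I ℤ} {i j k m : I}

theorem IsIndecomposable.eq_univ (h : IsIndecomposable A) {S : Set I} (hS : S.Nonempty)
    (hc : ∀ i ∈ S, ∀ j, j ∉ S → A i j = 0) (i : I) : i ∈ S := by
  by_contra hi
  obtain ⟨k, hk, j, hj, hkj⟩ := h S hS ⟨i, hi⟩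
  exact hkj (hc k hk j hj)

variable [Fintype I] {u : I → ℝ}

theorem row_le (hA : IsGCM A) (hu : ∀ i, 0 < u i) (h0 : ∀ i, ∑ j, (A i j : ℝ) * u j = 0)
    {s : Finset I} (hs : i ∉ s) : ∑ j ∈ s, -(A i j : ℝ) * u j ≤ 2 * u i := by
  classical
  have h1 := h0 i
  rw [← Finset.sum_sdiff (Finset.subset_univ (insert i s)), Finset.sum_insert hs, hA.diag] at h1
  have h2 : ∑ j ∈ Finset.univ \ insert i s, (A i j : ℝ) * u j ≤ 0 := by
    refine Finset.sum_nonpos fun j hj => ?_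
    rw [Finset.mem_sdiff, Finset.mem_insert, not_or] at hj
    have h3 : (A i j : ℝ) ≤ 0 := by exact_mod_cast hA.offDiag i j (Ne.symm hj.2.1)
    exact mul_nonpos_of_nonpos_of_nonneg h3 (hu j).le
  simp only [neg_mul, Finset.sum_neg_distrib]
  push_cast at h1
  linarith

theorem row_eq (hA : IsGCM A) (h0 : ∀ i, ∑ j, (A i j : ℝ) * u j = 0)
    {s : Finset I} (hs : i ∉ s) (hz : ∀ j, j ≠ i → j ∉ s → A i j = 0) :
    ∑ j ∈ s, -(A i j : ℝ) * u j = 2 * u i := by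
  classical
  have h1 := h0 i
  rw [← Finset.sum_subset (Finset.subset_univ (insert i s)) fun j _ hj => by
      rw [Finset.mem_insert, not_or] at hj
      rw [hz j hj.1 hj.2, Int.cast_zero, zero_mul], Finset.sum_insert hs, hA.diag] at h1
  simp only [neg_mul, Finset.sum_neg_distrib]
  push_cast at h1
  linarith

/-- A pair of nodes with `a_{ij} a_{ji} ≥ 4` exhausts an affine diagram. -/
theorem eq_four_of_four_le (hA : IsGCM A) (hI : IsIndecomposable A) (hu : ∀ i, 0 < u i)
    (h0 : ∀ i, ∑ j, (A i j : ℝ) * u j = 0) (hij : i ≠ j) (h4 : 4 ≤ A i j * A j i) :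
    A i j * A j i = 4 ∧ ∀ k, k = i ∨ k = j := by
  classical
  have hpos : ∀ {i j : I}, i ≠ j → 4 ≤ A i j * A j i → A j i < 0 := fun hij h4 =>
    lt_of_le_of_ne (hA.offDiag _ _ hij.symm) fun h => by rw [h, mul_zero] at h4; norm_num at h4
  -- The inequalities -a_{ij} u_j ≤ 2 u_i and -a_{ji} u_i ≤ 2 u_j combine to a_{ij} a_{ji} ≤ 4. In
  -- the case of equality both are tight, which leaves no room for another neighbour of either node.
  have key : ∀ {i j : I}, i ≠ j → 4 ≤ A i j * A j i → A i j * A j i = 4 ∧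
      2 * u i ≤ -(A i j : ℝ) * u j := by
    intro i j hij h4
    have h1 := row_le hA hu h0 (s := {j}) (Finset.notMem_singleton.2 hij)
    have h2 := row_le hA hu h0 (s := {i}) (Finset.notMem_singleton.2 hij.symm)
    rw [Finset.sum_singleton] at h1 h2
    have h3 : (A j i : ℝ) < 0 := by exact_mod_cast hpos hij h4
    have h3' : (A i j : ℝ) < 0 := by exact_mod_cast hpos hij.symm (by rwa [mul_comm])
    have h4' : (4 : ℝ) ≤ A i j * A j i := by exact_mod_cast h4
    have hj := hu j
    have hi := hu i
    have h5 : (A i j * A j i : ℝ) * u j ≤ 4 * u j := by nlinarith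
    have h6 : (A i j * A j i : ℝ) ≤ 4 := le_of_mul_le_mul_right h5 hj
    have h7 : (A i j * A j i : ℝ) = 4 := le_antisymm h6 h4'
    refine ⟨by exact_mod_cast h7, ?_⟩
    nlinarith
  have hleaf : ∀ {i j : I}, i ≠ j → 4 ≤ A i j * A j i → ∀ k, k ≠ i → k ≠ j → A i k = 0 := by
    intro i j hij h4 k hki hkj
    by_contra hne
    have h1 := row_le hA hu h0 (i := i) (s := {j, k}) (by simp [hij, hki.symm])
    rw [Finset.sum_pair hkj.symm] at h1
    have h2 := (key hij h4).2
    have h3 : (A i k : ℝ) < 0 := by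
      exact_mod_cast lt_of_le_of_ne (hA.offDiag i k hki.symm) hne
    nlinarith [hu k]
  refine ⟨(key hij h4).1, hI.eq_univ (S := {i, j}) ⟨i, Or.inl rfl⟩ ?_⟩
  intro l hl k hk
  rw [Set.mem_insert_iff, Set.mem_singleton_iff, not_or] at hk
  rcases hl with rfl | rfl
  · exact hleaf hij h4 k hk.1 hk.2
  · exact hleaf hij.symm (by rwa [mul_comm]) k hk.2 hk.1

end nullVector

/-! ### Diagrams without pairs of product ≥ 4: at most two neighbours, maximal paths -/

section thin

variable {I : Type*} [Fintype I] {A : Matrix I I ℤ} {u : I → ℝ} {i j k m : I}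

/-- An affine Cartan matrix with null vector `u` and with `a_{ij} a_{ji} < 4` for `i ≠ j`, which
satisfies the local conditions for the existence of a solution. -/
structure IsThin (A : Matrix I I ℤ) (u : I → ℝ) : Prop where
  gcm : IsGCM A
  indecomposable : IsIndecomposable A
  pos : ∀ i, 0 < u i
  null : ∀ i, ∑ j, (A i j : ℝ) * u j = 0
  lt_four : ∀ i j, i ≠ j → A i j * A j i < 4
  admissible : IsLocallyAdmissible A

theorem IsThin.edge (h : IsThin A u) (hne : i ≠ j) (h0 : A i j ≠ 0) :
    (A i j = -1 ∧ A j i = -1) ∨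
      (((A i j = -1 ∧ A j i = -2) ∨ (A i j = -2 ∧ A j i = -1)) ∧ (IsLeaf A i j ∨ IsLeaf A j i)) := by
  have h0' : A j i ≠ 0 := fun h' => h0 (h.gcm.zero _ _ h')
  have h1 := h.gcm.offDiag i j hne
  have h2 := h.gcm.offDiag j i hne.symm
  have h3 := h.lt_four i j hne
  by_cases hij : A i j = -1
  · rcases h.admissible.edge i j hne hij with h4 | ⟨h4, h5⟩ | h4
    · exact Or.inl ⟨hij, h4⟩
    · exact Or.inr ⟨Or.inl ⟨hij, h4⟩, h5⟩
    · rw [hij, h4] at h3; norm_num at h3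
  · by_cases hji : A j i = -1
    · rcases h.admissible.edge j i hne.symm hji with h4 | ⟨h4, h5⟩ | h4
      · exact absurd h4 hij
      · exact Or.inr ⟨Or.inr ⟨h4, hji⟩, h5.symm⟩
      · rw [hji, h4] at h3; norm_num at h3
    · have h5 : A i j ≤ -2 := by omega
      have h6 : A j i ≤ -2 := by omega
      nlinarith

/-- An edge between two nodes, neither of which is a leaf, is simple. -/
theorem IsThin.edge_eq (h : IsThin A u) (hne : i ≠ j) (h0 : A i j ≠ 0)
    (hi : ∃ k, k ≠ i ∧ k ≠ j ∧ A k i ≠ 0) (hj : ∃ k, k ≠ j ∧ k ≠ i ∧ A k j ≠ 0) :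
    A i j = -1 ∧ A j i = -1 := by
  obtain ⟨k, h1, h2, h3⟩ := hi
  obtain ⟨m, h4, h5, h6⟩ := hj
  rcases h.edge hne h0 with h7 | ⟨-, h7 | h7⟩
  · exact h7
  · exact absurd (h7 k h1 h2) h3
  · exact absurd (h7 m h4 h5) h6

/-- Every node has at most two neighbours. -/
theorem IsThin.eq_zero_of_three (h : IsThin A u) (hj : j ≠ i) (hk : k ≠ i) (hm : m ≠ i)
    (hjk : j ≠ k) (hjm : j ≠ m) (hkm : k ≠ m) (h1 : A i j ≠ 0) (h2 : A i k ≠ 0) : A i m = 0 := by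
  classical
  by_contra h3
  -- A neighbour j with a_{ij} ≠ -1 is a leaf behind a double edge with a_{ij} = -2, and its row
  -- gives 2 u_j = u_i. Two such neighbours already exhaust the total 2 u_i of row i. If at most one
  -- of the three entries differs from -1, the branching rule applies instead.
  have key : ∀ {j k m : I}, j ≠ i → k ≠ i → m ≠ i → j ≠ k → j ≠ m → k ≠ m → A i j ≠ 0 →
      A i k ≠ 0 → A i m ≠ 0 → A i j ≠ -1 → A i k ≠ -1 → False := by
    intro j k m hj hk hm hjk hjm hkm h1 h2 h3 h4 h5
    have hleaf : ∀ {j k : I}, j ≠ i → k ≠ i → j ≠ k → A i j ≠ 0 → A i k ≠ 0 → A i j ≠ -1 →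
        2 * u j = u i ∧ A i j = -2 := by
      intro j k hj hk hjk h1 h2 h4
      rcases h.edge hj.symm h1 with h6 | ⟨h6 | h6, h7⟩
      · exact absurd h6.1 h4
      · exact absurd h6.1 h4
      · have h8 : IsLeaf A j i := by
          rcases h7 with h7 | h7
          · exact absurd (h.gcm.zero _ _ (h7 k hk hjk.symm)) h2
          · exact h7
        have h9 := row_eq h.gcm h.null (i := j) (s := {i}) (Finset.notMem_singleton.2 hj)
          fun l hl hli => h.gcm.zero _ _ (h8 l hl (Finset.notMem_singleton.1 hli))
        rw [Finset.sum_singleton, h6.2] at h9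
        push_cast at h9
        exact ⟨by linarith, h6.1⟩
    obtain ⟨e1, e2⟩ := hleaf hj hk hjk h1 h2 h4
    obtain ⟨e3, e4⟩ := hleaf hk hj hjk.symm h2 h1 h5
    have h6 := row_le h.gcm h.pos h.null (i := i) (s := {j, k, m})
      (by simp [hj.symm, hk.symm, hm.symm])
    rw [Finset.sum_insert (by simp [hjk, hjm]), Finset.sum_pair hkm, e2, e4] at h6
    push_cast at h6
    have h7 : (A i m : ℝ) < 0 := by
      exact_mod_cast lt_of_le_of_ne (h.gcm.offDiag i m hm.symm) h3
    nlinarith [h.pos m, h.pos i]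
  have hz : ∀ {k}, A i k ≠ 0 → A k i ≠ 0 := fun h1 h2 => h1 (h.gcm.zero _ _ h2)
  by_cases h4 : A i j = -1
  · by_cases h5 : A i k = -1
    · exact hz h3 (h.admissible.branch i j k m hj hk hm hjk hjm hkm h4 h5)
    · by_cases h6 : A i m = -1
      · exact hz h2 (h.admissible.branch i j m k hj hm hk hjm hjk hkm.symm h4 h6)
      · exact key hk hm hj hkm hjk.symm hjm.symm h2 h3 h1 h5 h6
  · by_cases h5 : A i k = -1
    · by_cases h6 : A i m = -1
      · exact hz h1 (h.admissible.branch i k m j hk hm hj hkm hjk.symm hjm.symm h5 h6)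
      · exact key hj hm hk hjm hjk hkm.symm h1 h3 h2 h4 h6
    · exact key hj hk hm hjk hjm hkm h1 h2 h3 h4 h5

/-- An injective path `N 0, …, N n` in the Dynkin diagram. -/
structure IsPath (A : Matrix I I ℤ) (n : ℕ) (N : ℕ → I) : Prop where
  inj : ∀ k ≤ n, ∀ m ≤ n, N k = N m → k = m
  adj : ∀ k < n, A (N k) (N (k + 1)) ≠ 0

theorem IsPath.lt_card {n : ℕ} {N : ℕ → I} (h : IsPath A n N) : n < Fintype.card I := by
  have h1 : Function.Injective fun k : Fin (n + 1) => N k := fun k m hkm =>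
    Fin.ext (h.inj _ (by have := k.is_lt; omega) _ (by have := m.is_lt; omega) hkm)
  have := Fintype.card_le_of_injective _ h1
  rw [Fintype.card_fin] at this
  omega

theorem exists_maximal_path [Nonempty I] (A : Matrix I I ℤ) :
    ∃ n N, IsPath A n N ∧ ∀ N', ¬IsPath A (n + 1) N' := by
  classical
  obtain ⟨i⟩ := ‹Nonempty I›
  have h0 : ∃ N, IsPath A 0 N := ⟨fun _ => i, fun k hk m hm _ => by omega, fun k hk => by omega⟩
  have h1 := Nat.findGreatest_spec (P := fun n => ∃ N, IsPath A n N) (Nat.zero_le (Fintype.card I))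
    h0
  obtain ⟨N, hN⟩ := h1
  refine ⟨_, N, hN, fun N' h' => ?_⟩
  have := Nat.le_findGreatest (P := fun n => ∃ N, IsPath A n N) h'.lt_card.le ⟨N', h'⟩
  omega

variable {n : ℕ} {N : ℕ → I}

omit [Fintype I] in
theorem IsPath.ne (h : IsPath A n N) {k m : ℕ} (hk : k ≤ n) (hm : m ≤ n) (hkm : k ≠ m) :
    N k ≠ N m := fun he => hkm (h.inj k hk m hm he)

theorem IsThin.isPath_adj (h : IsThin A u) (hN : IsPath A n N) {k : ℕ} (hk : k < n) :
    A (N (k + 1)) (N k) ≠ 0 := fun h' => hN.adj k hk (h.gcm.zero _ _ h')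

theorem IsThin.adj_interior (h : IsThin A u) (hN : IsPath A n N) {k : ℕ} (hk : 0 < k) (hkn : k < n)
    (h1 : j ≠ N k) (h2 : j ≠ N (k - 1)) (h3 : j ≠ N (k + 1)) : A (N k) j = 0 := by
  have h4 := h.isPath_adj hN (k := k - 1) (by omega)
  rw [Nat.sub_add_cancel hk] at h4
  exact h.eq_zero_of_three (hN.ne (by omega) (by omega) (by omega))
    (hN.ne (by omega) (by omega) (by omega)) h1 (hN.ne (by omega) (by omega) (by omega))
    h2.symm h3.symm h4 (hN.adj k hkn)

/-- An outside neighbour of an end node would lengthen the path, and an interior node already has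
two neighbours on it. So nothing outside is adjacent to the path, and connectedness finishes the
argument. -/
theorem IsThin.isPath_surj (h : IsThin A u) (hN : IsPath A n N)
    (hmax : ∀ N', ¬IsPath A (n + 1) N') (i : I) : ∃ k ≤ n, N k = i := by
  have hz : ∀ {i j}, A i j ≠ 0 → A j i ≠ 0 := fun h1 h2 => h1 (h.gcm.zero _ _ h2)
  refine h.indecomposable.eq_univ (S := {i | ∃ k ≤ n, N k = i}) ⟨N 0, 0, Nat.zero_le _, rfl⟩ ?_ i
  rintro _ ⟨k, hk, rfl⟩ j hj
  have hj' : ∀ m ≤ n, N m ≠ j := fun m hm hmj => hj ⟨m, hm, hmj⟩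
  by_contra hkj
  by_cases h0 : k = 0
  · subst h0
    refine hmax (fun m => if m = 0 then j else N (m - 1)) ⟨fun a ha b hb hab => ?_, fun a ha => ?_⟩
    · split_ifs at hab with h1 h2 h2
      · omega
      · exact absurd hab.symm (hj' _ (by omega))
      · exact absurd hab (hj' _ (by omega))
      · have := hN.inj _ (by omega) _ (by omega) hab
        omega
    · rw [if_neg (show a + 1 ≠ 0 by omega), Nat.add_sub_cancel]
      split_ifs with h1
      · subst h1; exact hz hkj
      · have := hN.adj (a - 1) (by omega)
        rwa [Nat.sub_add_cancel (by omega)] at this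
  · by_cases h1 : k = n
    · subst h1
      refine hmax (fun m => if m = k + 1 then j else N m) ⟨fun a ha b hb hab => ?_, fun a ha => ?_⟩
      · split_ifs at hab with h1 h2 h2
        · omega
        · exact absurd hab.symm (hj' _ (by omega))
        · exact absurd hab (hj' _ (by omega))
        · exact hN.inj _ (by omega) _ (by omega) hab
      · rw [if_neg (show a ≠ k + 1 by omega)]
        split_ifs with h1
        · rw [show a = k by omega]; exact hkj
        · exact hN.adj a (by omega)
    · exact hkj (h.adj_interior hN (by omega) (by omega) (hj' k hk).symm (hj' _ (by omega)).symm
        (hj' _ (by omega)).symm)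

/-- The last hypothesis leaves out the pair of end nodes, the only one whose adjacency is still
open; it separates cycles from paths. -/
theorem IsThin.isPath_far (h : IsThin A u) (hN : IsPath A n N) {k m : ℕ} (hkm : k + 1 < m)
    (hm : m ≤ n) (h0 : 0 < k ∨ m < n) : A (N k) (N m) = 0 := by
  by_cases hk : 0 < k
  · exact h.adj_interior hN hk (by omega) (hN.ne (by omega) (by omega) (by omega))
      (hN.ne (by omega) (by omega) (by omega)) (hN.ne (by omega) (by omega) (by omega))
  · exact h.gcm.zero _ _ (h.adj_interior hN (k := m) (by omega) (by omega)
      (hN.ne (by omega) (by omega) (by omega)) (hN.ne (by omega) (by omega) (by omega))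
      (hN.ne (by omega) (by omega) (by omega)))

end thin

/-! ### Cycles, and paths with double ends -/

section classification

variable {I : Type*} [Fintype I] {A : Matrix I I ℤ} {u : I → ℝ} {n : ℕ} {N : ℕ → I}

theorem IsThin.two_le_of_isPath (h : IsThin A u) (hN : IsPath A n N)
    (hs : ∀ i, ∃ k ≤ n, N k = i) : 2 ≤ n := by
  by_contra hn
  have h0 := h.pos (N 0)
  rcases (show n = 0 ∨ n = 1 by omega) with rfl | rfl
  · have h1 := row_eq h.gcm h.null (i := N 0) (s := ∅) (Finset.notMem_empty _) fun j hj _ => by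
      obtain ⟨k, hk, rfl⟩ := hs j
      exact absurd (by rw [show k = 0 by omega]) hj
    rw [Finset.sum_empty] at h1
    linarith
  · have h01 := hN.ne zero_le_one le_rfl zero_ne_one
    have h1 := row_eq h.gcm h.null (i := N 0) (s := {N 1}) (Finset.notMem_singleton.2 h01)
      fun j hj hj' => by
        obtain ⟨k, hk, rfl⟩ := hs j
        rw [Finset.mem_singleton] at hj'
        rcases (show k = 0 ∨ k = 1 by omega) with rfl | rfl
        · exact absurd rfl hj
        · exact absurd rfl hj'
    have h2 := row_eq h.gcm h.null (i := N 1) (s := {N 0}) (Finset.notMem_singleton.2 h01.symm)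
      fun j hj hj' => by
        obtain ⟨k, hk, rfl⟩ := hs j
        rw [Finset.mem_singleton] at hj'
        rcases (show k = 0 ∨ k = 1 by omega) with rfl | rfl
        · exact absurd rfl hj'
        · exact absurd rfl hj
    rw [Finset.sum_singleton] at h1 h2
    have h3 : (A (N 0) (N 1) * A (N 1) (N 0) : ℝ) < 4 := by
      exact_mod_cast h.lt_four _ _ h01
    have h4 : (A (N 0) (N 1) * A (N 1) (N 0) : ℝ) * u (N 0) = 4 * u (N 0) := by
      linear_combination (-(A (N 0) (N 1) : ℝ)) * h2 + 2 * h1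
    have := mul_right_cancel₀ h0.ne' h4
    linarith

theorem IsThin.edge_interior (h : IsThin A u) (hN : IsPath A n N) {k : ℕ} (hk : 0 < k)
    (hkn : k + 1 < n) : A (N k) (N (k + 1)) = -1 ∧ A (N (k + 1)) (N k) = -1 := by
  have h1 := hN.adj (k - 1) (by omega)
  rw [Nat.sub_add_cancel hk] at h1
  exact h.edge_eq (hN.ne (by omega) (by omega) (by omega)) (hN.adj k (by omega))
    ⟨N (k - 1), hN.ne (by omega) (by omega) (by omega), hN.ne (by omega) (by omega) (by omega), h1⟩
    ⟨N (k + 2), hN.ne (by omega) (by omega) (by omega), hN.ne (by omega) (by omega) (by omega),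
      h.isPath_adj hN (k := k + 1) (by omega)⟩

/-- Once the ends are joined every node has two neighbours, so there are no leaves and every edge is
simple. -/
theorem IsThin.edge_cyclic (h : IsThin A u) (hN : IsPath A n N) (hn : 2 ≤ n)
    (hc : A (N 0) (N n) ≠ 0) {k m : ℕ} (hm : m ≤ n) (hkm : m = k + 1 ∨ (k = 0 ∧ m = n)) :
    A (N k) (N m) = -1 ∧ A (N m) (N k) = -1 := by
  have hne : ∀ {a b}, a ≤ n → b ≤ n → a ≠ b → N a ≠ N b := fun h1 h2 h3 => hN.ne h1 h2 h3
  have hc' : A (N n) (N 0) ≠ 0 := fun h' => hc (h.gcm.zero _ _ h')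
  have hn1 := hN.adj (n - 1) (by omega)
  rw [Nat.sub_add_cancel (by omega)] at hn1
  rcases hkm with rfl | ⟨rfl, rfl⟩
  · refine h.edge_eq (hne (by omega) (by omega) (by omega)) (hN.adj k (by omega)) ?_ ?_
    · by_cases h0 : k = 0
      · subst h0
        exact ⟨N n, hne (by omega) (by omega) (by omega), hne (by omega) (by omega) (by omega), hc'⟩
      · have h1 := hN.adj (k - 1) (by omega)
        rw [Nat.sub_add_cancel (by omega)] at h1
        exact ⟨N (k - 1), hne (by omega) (by omega) (by omega),
          hne (by omega) (by omega) (by omega), h1⟩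
    · by_cases h0 : k + 1 = n
      · rw [h0]
        exact ⟨N 0, hne (by omega) (by omega) (by omega), hne (by omega) (by omega) (by omega), hc⟩
      · exact ⟨N (k + 2), hne (by omega) (by omega) (by omega),
          hne (by omega) (by omega) (by omega), h.isPath_adj hN (k := k + 1) (by omega)⟩
  · exact h.edge_eq (hne (by omega) (by omega) (by omega)) hc
      ⟨N 1, hne (by omega) (by omega) (by omega), hne (by omega) (by omega) (by omega),
        h.isPath_adj hN (k := 0) (by omega)⟩
      ⟨N (m - 1), hne (by omega) (by omega) (by omega), hne (by omega) (by omega) (by omega), hn1⟩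

/-- The numbering of the nodes attached to an enumeration. -/
theorem exists_equiv_of_enum {I : Type*} {n : ℕ} {N : ℕ → I} (hs : ∀ i, ∃ k ≤ n, N k = i)
    (hi : ∀ k ≤ n, ∀ m ≤ n, N k = N m → k = m) :
    ∃ e : Fin (n + 1) ≃ I, ∀ k, e k = N k.val := by
  refine ⟨Equiv.ofBijective (fun k : Fin (n + 1) => N k.val) ⟨fun k m hkm => ?_, fun i => ?_⟩,
    fun k => rfl⟩
  · exact Fin.ext (hi _ (by have := k.is_lt; omega) _ (by have := m.is_lt; omega) hkm)
  · obtain ⟨k, hk, rfl⟩ := hs i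
    exact ⟨⟨k, by omega⟩, rfl⟩

theorem IsThin.hasType_cartanA (h : IsThin A u) (hN : IsPath A n N)
    (hs : ∀ i, ∃ k ≤ n, N k = i) (hn : 2 ≤ n) (hc : A (N 0) (N n) ≠ 0) :
    HasType A (cartanA n) := by
  obtain ⟨e, he⟩ := exists_equiv_of_enum hs hN.inj
  refine ⟨e, ?_⟩
  have hlt : ∀ i j : Fin (n + 1), i.val < j.val →
      A (e i) (e j) = cartanA n i j ∧ A (e j) (e i) = cartanA n j i := by
    intro i j hij
    have hi := i.is_lt
    have hj := j.is_lt
    have h1 : j = i + 1 ↔ j.val = i.val + 1 := by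
      rw [Fin.ext_iff, Fin.val_add_one, if_neg]
      intro h; rw [h, Fin.val_last] at hij; omega
    -- For i < j the cyclic successor of j can be i only by wrapping around from n to 0.
    have h2 : i = j + 1 ↔ i.val = 0 ∧ j.val = n := by
      rw [Fin.ext_iff, Fin.val_add_one]
      split_ifs with h <;> rw [Fin.ext_iff, Fin.val_last] at h <;> omega
    have h3 : i ≠ j := fun h => by rw [h] at hij; omega
    rw [he, he, cartanA, Matrix.of_apply, Matrix.of_apply, if_neg h3, if_neg h3.symm]
    simp only [h1, h2]
    by_cases h4 : j.val = i.val + 1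
    · have h5 := h.edge_cyclic hN hn hc (by omega) (Or.inl h4)
      rw [if_pos h4, if_neg (by omega), h5.1, h5.2]
      norm_num
    · by_cases h6 : i.val = 0 ∧ j.val = n
      · have h5 := h.edge_cyclic hN hn hc (by omega) (Or.inr h6)
        rw [if_neg h4, if_pos h6, h5.1, h5.2]
        norm_num
      · have h5 := h.isPath_far hN (show i.val + 1 < j.val by omega) (by omega) (by omega)
        rw [if_neg h4, if_neg h6, h5, h.gcm.zero _ _ h5]
        norm_num
  intro i j
  rcases lt_trichotomy i.val j.val with h1 | h1 | h1
  · exact (hlt i j h1).1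
  · rw [Fin.ext h1, h.gcm.diag, cartanA, Matrix.of_apply, if_pos rfl,
      if_neg (Fin.ne_add_one (by omega) j)]
    norm_num
  · exact (hlt j i h1).2

/-- If the end nodes of the path are not adjacent, then its end edges are double edges. -/
theorem IsThin.isDoublePath (h : IsThin A u) (hN : IsPath A n N)
    (hs : ∀ i, ∃ k ≤ n, N k = i) (hn : 2 ≤ n) (hc : A (N 0) (N n) = 0) :
    IsDoublePath A n N := by
  classical
  have hne : ∀ {a b}, a ≤ n → b ≤ n → a ≠ b → N a ≠ N b := fun h1 h2 h3 => hN.ne h1 h2 h3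
  have hfar : ∀ k m, k + 1 < m → m ≤ n → A (N k) (N m) = 0 := by
    intro k m hkm hm
    by_cases h0 : 0 < k ∨ m < n
    · exact h.isPath_far hN hkm hm h0
    · obtain rfl : k = 0 := by omega
      obtain rfl : m = n := by omega
      exact hc
  have hfar' : ∀ k m, k ≤ n → m ≤ n → k + 1 < m ∨ m + 1 < k → A (N k) (N m) = 0 := by
    intro k m hk hm hkm
    rcases hkm with h1 | h1
    · exact hfar k m h1 hm
    · exact h.gcm.zero _ _ (hfar m k h1 hk)
  have hrow0 : -(A (N 0) (N 1) : ℝ) * u (N 1) = 2 * u (N 0) := by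
    rw [← row_eq h.gcm h.null (i := N 0) (s := {N 1})
      (Finset.notMem_singleton.2 (hne (by omega) (by omega) zero_ne_one)), Finset.sum_singleton]
    intro j hj hj'
    obtain ⟨k, hk, rfl⟩ := hs j
    rw [Finset.mem_singleton] at hj'
    have : k ≠ 0 := fun h => hj (by rw [h])
    have : k ≠ 1 := fun h => hj' (by rw [h])
    exact hfar' 0 k (by omega) hk (by omega)
  have hrown : -(A (N n) (N (n - 1)) : ℝ) * u (N (n - 1)) = 2 * u (N n) := by
    rw [← row_eq h.gcm h.null (i := N n) (s := {N (n - 1)})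
      (Finset.notMem_singleton.2 (hne (by omega) (by omega) (by omega))), Finset.sum_singleton]
    intro j hj hj'
    obtain ⟨k, hk, rfl⟩ := hs j
    rw [Finset.mem_singleton] at hj'
    have : k ≠ n := fun h => hj (by rw [h])
    have : k ≠ n - 1 := fun h => hj' (by rw [h])
    exact hfar' n k (by omega) hk (by omega)
  have hrow : ∀ k, 0 < k → k < n → -(A (N k) (N (k - 1)) : ℝ) * u (N (k - 1)) +
      -(A (N k) (N (k + 1)) : ℝ) * u (N (k + 1)) = 2 * u (N k) := by
    intro k h0 hkn
    rw [← row_eq h.gcm h.null (i := N k) (s := {N (k - 1), N (k + 1)}) ?_ ?_,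
      Finset.sum_pair (hne (by omega) (by omega) (by omega))]
    · rw [Finset.mem_insert, Finset.mem_singleton, not_or]
      exact ⟨hne (by omega) (by omega) (by omega), hne (by omega) (by omega) (by omega)⟩
    · intro j hj hj'
      obtain ⟨m, hm, rfl⟩ := hs j
      rw [Finset.mem_insert, Finset.mem_singleton, not_or] at hj'
      have : m ≠ k := fun h => hj (by rw [h])
      have : m ≠ k - 1 := fun h => hj'.1 (by rw [h])
      have : m ≠ k + 1 := fun h => hj'.2 (by rw [h])
      exact hfar' k m (by omega) hm (by omega)
  have hprod : ∀ {i j}, i ≠ j → A i j ≠ 0 → (A i j * A j i : ℤ) ≤ 2 ∧ (A i j * A j i = 2 →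
      (A i j = -1 ∧ A j i = -2) ∨ (A i j = -2 ∧ A j i = -1)) := by
    intro i j hij h0
    rcases h.edge hij h0 with h1 | ⟨h1 | h1, -⟩ <;> rw [h1.1, h1.2] <;> norm_num
  have hn1 := hN.adj (n - 1) (by omega)
  rw [Nat.sub_add_cancel (by omega)] at hn1
  have p0 := hprod (hne (by omega) (by omega) zero_ne_one) (hN.adj 0 (by omega))
  have pn := hprod (hne (by omega) (by omega) (show n ≠ n - 1 by omega))
    (fun h' => hn1 (h.gcm.zero _ _ h'))
  -- the increments of `u`, suitably rescaled at the ends, are constant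
  have hstep : ∀ k, 0 < k → k < n → -(A (N k) (N (k + 1)) : ℝ) * u (N (k + 1)) - u (N k) =
      u (N 1) - -(A (N 1) (N 0) : ℝ) * u (N 0) := by
    intro k hk
    induction k, hk using Nat.le_induction with
    | base =>
      intro h1
      have := hrow 1 one_pos h1
      rw [show (1 : ℕ) - 1 = 0 from rfl] at this
      change -(A (N 1) (N (1 + 1)) : ℝ) * u (N (1 + 1)) - u (N 1) = _
      linarith
    | succ k hk ih =>
      intro hkn
      have h1 := ih (by omega)
      have h2 := hrow (k + 1) (by omega) hkn
      have h3 := h.edge_interior hN hk hkn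
      rw [h3.1] at h1
      rw [Nat.add_sub_cancel, h3.2] at h2
      push_cast at h1 h2
      linarith
  have hlast := hstep (n - 1) (by omega) (by omega)
  rw [Nat.sub_add_cancel (by omega)] at hlast
  have u1 := h.pos (N 1)
  have un := h.pos (N (n - 1))
  have q0 : ((A (N 0) (N 1) * A (N 1) (N 0) : ℤ) : ℝ) * u (N 1) =
      2 * (-(A (N 1) (N 0) : ℝ) * u (N 0)) := by
    push_cast
    linear_combination (-(A (N 1) (N 0) : ℝ)) * hrow0
  have qn : ((A (N n) (N (n - 1)) * A (N (n - 1)) (N n) : ℤ) : ℝ) * u (N (n - 1)) =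
      2 * (-(A (N (n - 1)) (N n) : ℝ) * u (N n)) := by
    push_cast
    linear_combination (-(A (N (n - 1)) (N n) : ℝ)) * hrown
  have l0 : ((A (N 0) (N 1) * A (N 1) (N 0) : ℤ) : ℝ) ≤ 2 := by exact_mod_cast p0.1
  have ln : ((A (N n) (N (n - 1)) * A (N (n - 1)) (N n) : ℤ) : ℝ) ≤ 2 := by exact_mod_cast pn.1
  have m0 := mul_le_mul_of_nonneg_right l0 u1.le
  have mn := mul_le_mul_of_nonneg_right ln un.le
  -- Let p and r be the products a_{ij} a_{ji} at the left and right end edges. The constant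
  -- increment equals u_1 (1 - p/2) ≥ 0 at the left and u_{n-1} (r/2 - 1) ≤ 0 at the right. Hence it
  -- is 0 and p = r = 2.
  have e0 : ((A (N 0) (N 1) * A (N 1) (N 0) : ℤ) : ℝ) = 2 :=
    mul_right_cancel₀ u1.ne' (by linarith)
  have en : ((A (N n) (N (n - 1)) * A (N (n - 1)) (N n) : ℤ) : ℝ) = 2 :=
    mul_right_cancel₀ un.ne' (by linarith)
  exact
    { two_le := hn
      surj := hs
      inj := hN.inj
      edge := fun k h1 h2 => h.edge_interior hN h1 h2
      far := fun k m h1 h2 => ⟨hfar k m h1 h2, h.gcm.zero _ _ (hfar k m h1 h2)⟩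
      left := p0.2 (by exact_mod_cast e0)
      right := pn.2 (by exact_mod_cast en) }

end classification

/-! ### Matching the diagrams with the four families -/

section types

variable {I : Type*} {A : Matrix I I ℤ} {n : ℕ} {N : ℕ → I}

theorem IsDoublePath.hasType_tridiag (hA : IsGCM A) (h : IsDoublePath A n N) {f g : ℕ → ℤ}
    (hf : ∀ k < n, A (N k) (N (k + 1)) = f k) (hg : ∀ k < n, A (N (k + 1)) (N k) = g k) :
    HasType A (tridiag n f g) := by
  obtain ⟨e, he⟩ := exists_equiv_of_enum h.surj h.inj
  refine ⟨e, fun i j => ?_⟩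
  have hi := i.is_lt
  have hj := j.is_lt
  rw [he, he, tridiag, Matrix.of_apply]
  split_ifs with h1 h2 h3
  · rw [h1, hA.diag]
  · rw [h2, hf _ (by omega)]
  · rw [h3, hg _ (by omega)]
  · have h4 : i.val ≠ j.val := fun h => h1 (Fin.ext h)
    rcases lt_or_gt_of_ne h4 with h5 | h5
    · exact (h.far _ _ (by omega) (by omega)).1
    · exact (h.far _ _ (by omega) (by omega)).2

theorem IsDoublePath.reverse (h : IsDoublePath A n N) :
    IsDoublePath A n fun k => N (n - k) where
  two_le := h.two_le
  surj i := by
    obtain ⟨k, hk, rfl⟩ := h.surj i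
    exact ⟨n - k, by omega, by rw [Nat.sub_sub_self hk]⟩
  inj k hk m hm hkm := by have := h.inj _ (by omega) _ (by omega) hkm; omega
  edge k h0 h1 := by
    have := h.edge (n - (k + 1)) (by omega) (by omega)
    rw [show n - (k + 1) + 1 = n - k by omega] at this
    exact this.symm
  far k m h0 h1 := (h.far (n - m) (n - k) (by omega) (by omega)).symm
  left := by
    rw [Nat.sub_zero]
    exact h.right
  right := by
    have := h.two_le
    rw [Nat.sub_self, Nat.sub_sub_self (by omega)]
    exact h.left

theorem IsDoublePath.entries (h : IsDoublePath A n N) {p p' r r' : ℤ}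
    (h0 : A (N 0) (N 1) = p ∧ A (N 1) (N 0) = p')
    (h1 : A (N n) (N (n - 1)) = r ∧ A (N (n - 1)) (N n) = r') {k : ℕ} (hk : k < n) :
    A (N k) (N (k + 1)) = (if k = 0 then p else if k + 1 = n then r' else -1) ∧
      A (N (k + 1)) (N k) = if k = 0 then p' else if k + 1 = n then r else -1 := by
  split_ifs with h2 h3
  · subst h2; exact h0
  · subst h3
    rw [Nat.add_sub_cancel] at h1
    exact h1.symm
  · exact h.edge k (by omega) (by omega)

/-- The orientations of the two end edges leave four cases; the two mixed ones are reversals of each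
other and both give A_{2n}^{(2)}. -/
theorem IsDoublePath.hasType (hA : IsGCM A) (h : IsDoublePath A n N) :
    HasType A (cartanC n) ∨ HasType A (cartanA2 n) ∨ HasType A (cartanD2 n) := by
  have hn := h.two_le
  have hA2 : ∀ {N : ℕ → I}, IsDoublePath A n N → A (N 0) (N 1) = -1 ∧ A (N 1) (N 0) = -2 →
      A (N n) (N (n - 1)) = -2 ∧ A (N (n - 1)) (N n) = -1 → HasType A (cartanA2 n) := by
    intro N h h0 h1
    refine h.hasType_tridiag hA (fun k hk => ?_) (fun k hk => ?_)
    · rw [(h.entries h0 h1 hk).1]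
      split_ifs <;> rfl
    · rw [(h.entries h0 h1 hk).2]
      split_ifs <;> first | rfl | omega
  rcases h.left with h0 | h0 <;> rcases h.right with h1 | h1
  · left
    refine h.hasType_tridiag hA (fun k hk => ?_) (fun k hk => ?_)
    · rw [(h.entries h0 h1 hk).1]
      split_ifs <;> first | rfl | omega
    · rw [(h.entries h0 h1 hk).2]
      split_ifs <;> rfl
  · exact Or.inr (Or.inl (hA2 h h0 h1))
  · refine Or.inr (Or.inl (hA2 h.reverse ?_ ?_))
    · rw [Nat.sub_zero]; exact h1
    · rw [Nat.sub_self, Nat.sub_sub_self (by omega)]; exact h0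
  · right; right
    refine h.hasType_tridiag hA (fun k hk => ?_) (fun k hk => ?_)
    · rw [(h.entries h0 h1 hk).1]
      split_ifs <;> rfl
    · rw [(h.entries h0 h1 hk).2]
      split_ifs <;> first | rfl | omega

theorem hasType_fin_two (hA : IsGCM A) {i j : I} (hij : i ≠ j) (hI : ∀ k, k = i ∨ k = j)
    {B : Matrix (Fin (1 + 1)) (Fin (1 + 1)) ℤ} (h00 : B 0 0 = 2) (h11 : B 1 1 = 2)
    (h01 : B 0 1 = A i j) (h10 : B 1 0 = A j i) : HasType A B := by
  refine ⟨Equiv.ofBijective ![i, j] ⟨?_, fun k => ?_⟩, fun k m => ?_⟩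
  · intro k m
    fin_cases k <;> fin_cases m <;> simp [hij, hij.symm]
  · rcases hI k with rfl | rfl
    · exact ⟨0, rfl⟩
    · exact ⟨1, rfl⟩
  · fin_cases k <;> fin_cases m
    · exact (hA.diag i).trans h00.symm
    · exact h01.symm
    · exact h10.symm
    · exact (hA.diag j).trans h11.symm

/-- The affine Cartan matrices satisfying the local conditions. -/
theorem IsAffineCartan.exists_hasType [Fintype I] (hA : IsAffineCartan A)
    (h : IsLocallyAdmissible A) : ∃ n : ℕ,
      (1 ≤ n ∧ HasType A (cartanA n)) ∨ (2 ≤ n ∧ HasType A (cartanC n)) ∨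
      (1 ≤ n ∧ HasType A (cartanA2 n)) ∨ (2 ≤ n ∧ HasType A (cartanD2 n)) := by
  obtain ⟨u, hu, h0⟩ := hA.null
  have h0' : ∀ i, ∑ j, (A i j : ℝ) * u j = 0 := fun i => congrFun h0 i
  by_cases h4 : ∃ i j, i ≠ j ∧ 4 ≤ A i j * A j i
  · obtain ⟨i, j, hij, h4⟩ := h4
    obtain ⟨h5, h6⟩ := eq_four_of_four_le hA.gcm hA.indecomposable hu h0' hij h4
    have h7 := hA.gcm.offDiag i j hij
    have h8 := hA.gcm.offDiag j i hij.symm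
    refine ⟨1, ?_⟩
    -- Two negative integers with product 4. Both factorizations occur as affine diagrams of the
    -- list, so this case does not use the local conditions.
    have h9 : (A i j = -2 ∧ A j i = -2) ∨ (A i j = -1 ∧ A j i = -4) ∨
        (A j i = -1 ∧ A i j = -4) := by
      have h10 : A j i ≠ 0 := fun h => by rw [h, mul_zero] at h5; norm_num at h5
      have h11 : A j i ≤ -1 := by omega
      have h12 : -4 ≤ A i j := by nlinarith
      generalize A i j = s at *
      generalize A j i = t at *
      interval_cases s <;> omega
    rcases h9 with ⟨h1, h2⟩ | ⟨h1, h2⟩ | ⟨h1, h2⟩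
    · exact Or.inl ⟨le_rfl, hasType_fin_two hA.gcm hij h6 rfl rfl (by rw [h1]; rfl)
        (by rw [h2]; rfl)⟩
    · exact Or.inr (Or.inr (Or.inl ⟨le_rfl, hasType_fin_two hA.gcm hij h6 rfl rfl
        (by rw [h1]; rfl) (by rw [h2]; rfl)⟩))
    · exact Or.inr (Or.inr (Or.inl ⟨le_rfl, hasType_fin_two hA.gcm hij.symm
        (fun k => (h6 k).symm) rfl rfl (by rw [h1]; rfl) (by rw [h2]; rfl)⟩))
  · push Not at h4
    have hT : IsThin A u := ⟨hA.gcm, hA.indecomposable, hu, h0', h4, h⟩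
    have := hA.nonempty
    obtain ⟨n, N, hN, hmax⟩ := exists_maximal_path A
    have hs := hT.isPath_surj hN hmax
    have hn := hT.two_le_of_isPath hN hs
    refine ⟨n, ?_⟩
    by_cases hc : A (N 0) (N n) = 0
    · rcases (hT.isDoublePath hN hs hn hc).hasType hA.gcm with h1 | h1 | h1
      · exact Or.inr (Or.inl ⟨hn, h1⟩)
      · exact Or.inr (Or.inr (Or.inl ⟨by omega, h1⟩))
      · exact Or.inr (Or.inr (Or.inr ⟨hn, h1⟩))
    · exact Or.inl ⟨by omega, hT.hasType_cartanA hN hs hn hc⟩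

end types

end QShift

end

/-! ### Assembly of the main theorem -/

theorem theorem4p1 {I : Type*} [Fintype I] [DecidableEq I] (A : Matrix I I ℤ)
    (hA : QShift.IsAffineCartan A)
    (a a' : I → ℕ) (ha : QShift.IsLabels A a) (ha' : QShift.IsLabels A.transpose a')
    (q ħ : ℂ) (hħ : Complex.exp ħ = q) (hq : ∀ m : ℕ, 0 < m → q ^ m ≠ 1) :
    ((∃ φ : I → QShift.Laurent I, QShift.IsSolution A (QShift.qi ħ a a') φ) ↔
      ∃ n : ℕ,
        (1 ≤ n ∧ QShift.HasType A (QShift.cartanA n)) ∨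
        (2 ≤ n ∧ QShift.HasType A (QShift.cartanC n)) ∨
        (1 ≤ n ∧ QShift.HasType A (QShift.cartanA2 n)) ∨
        (2 ≤ n ∧ QShift.HasType A (QShift.cartanD2 n))) ∧
    (∀ (n : ℕ) (e : Fin (n + 1) ≃ I), 1 ≤ n → QShift.IsNumbering A (QShift.cartanA n) e →
      ∀ φ : I → QShift.Laurent I, QShift.IsSolution A (QShift.qi ħ a a') φ ↔
        ∃ b : ℂˣ, ∀ i, φ (e i) = QShift.solA (QShift.qi ħ a a') e b i) ∧
    (∀ (n : ℕ) (e : Fin (n + 1) ≃ I), 2 ≤ n → QShift.IsNumbering A (QShift.cartanC n) e →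
      ∀ φ : I → QShift.Laurent I, QShift.IsSolution A (QShift.qi ħ a a') φ ↔
        ∃ b : ℂˣ, (b = QShift.qpow ħ (-1 / 4) ∨ b = QShift.im * QShift.qpow ħ (-1 / 4)) ∧
          ∀ i, φ (e i) = QShift.solC (QShift.qi ħ a a') e b i) ∧
    (∀ (n : ℕ) (e : Fin (n + 1) ≃ I), 1 ≤ n → QShift.IsNumbering A (QShift.cartanA2 n) e →
      ∀ φ : I → QShift.Laurent I, QShift.IsSolution A (QShift.qi ħ a a') φ ↔
        ∀ i, φ (e i) = QShift.solA2 ħ (QShift.qi ħ a a') e i) ∧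
    (∀ (n : ℕ) (e : Fin (n + 1) ≃ I), 2 ≤ n → QShift.IsNumbering A (QShift.cartanD2 n) e →
      ∀ φ : I → QShift.Laurent I, QShift.IsSolution A (QShift.qi ħ a a') φ ↔
        ∀ i, φ (e i) = QShift.solD2 ħ (QShift.qi ħ a a') e i) := by
  subst hħ
  have hQ := QShift.isQFamily_qi hA ha ha' hq
  have hA1 : ∀ (n : ℕ) (e : Fin (n + 1) ≃ I), 1 ≤ n →
      QShift.IsNumbering A (QShift.cartanA n) e → ∀ φ : I → QShift.Laurent I,
        QShift.IsSolution A (QShift.qi ħ a a') φ ↔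
          ∃ b : ℂˣ, ∀ i, φ (e i) = QShift.solA (QShift.qi ħ a a') e b i :=
    fun n e hn he => QShift.cartanA_solution_iff hn hA.gcm hQ he
  have hC : ∀ (n : ℕ) (e : Fin (n + 1) ≃ I), 2 ≤ n →
      QShift.IsNumbering A (QShift.cartanC n) e → ∀ φ : I → QShift.Laurent I,
        QShift.IsSolution A (QShift.qi ħ a a') φ ↔ ∃ b : ℂˣ,
          (b = QShift.qpow ħ (-1 / 4) ∨ b = QShift.im * QShift.qpow ħ (-1 / 4)) ∧
            ∀ i, φ (e i) = QShift.solC (QShift.qi ħ a a') e b i :=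
    fun n e hn he => QShift.cartanC_solution_iff hA ha ha' hq hn he
  have hA2 : ∀ (n : ℕ) (e : Fin (n + 1) ≃ I), 1 ≤ n →
      QShift.IsNumbering A (QShift.cartanA2 n) e → ∀ φ : I → QShift.Laurent I,
        QShift.IsSolution A (QShift.qi ħ a a') φ ↔
          ∀ i, φ (e i) = QShift.solA2 ħ (QShift.qi ħ a a') e i := by
    intro n e hn he
    rcases hn.eq_or_lt with rfl | hn
    · exact QShift.cartanA2_one_solution_iff hA ha ha' hq he
    · exact QShift.cartanA2_solution_iff hA ha ha' hq hn he
  have hD2 : ∀ (n : ℕ) (e : Fin (n + 1) ≃ I), 2 ≤ n →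
      QShift.IsNumbering A (QShift.cartanD2 n) e → ∀ φ : I → QShift.Laurent I,
        QShift.IsSolution A (QShift.qi ħ a a') φ ↔
          ∀ i, φ (e i) = QShift.solD2 ħ (QShift.qi ħ a a') e i :=
    fun n e hn he => QShift.cartanD2_solution_iff hA ha ha' hq hn he
  refine ⟨⟨?_, ?_⟩, hA1, hC, hA2, hD2⟩
  · rintro ⟨φ, hφ⟩
    exact hA.exists_hasType
      (((QShift.isSolution_iff hA.gcm hQ).1 hφ).isLocallyAdmissible hA.gcm hQ)
  · have hval : ∀ {n : ℕ} (e : Fin (n + 1) ≃ I) (sol : Fin (n + 1) → QShift.Laurent I),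
        ∃ φ : I → QShift.Laurent I, ∀ i, φ (e i) = sol i := fun e sol =>
      ⟨fun j => sol (e.symm j), fun i => by simp only [Equiv.symm_apply_apply]⟩
    rintro ⟨n, ⟨hn, e, he⟩ | ⟨hn, e, he⟩ | ⟨hn, e, he⟩ | ⟨hn, e, he⟩⟩
    · obtain ⟨φ, hφ⟩ := hval e (QShift.solA (QShift.qi ħ a a') e 1)
      exact ⟨φ, (hA1 n e hn he φ).2 ⟨1, hφ⟩⟩
    · obtain ⟨φ, hφ⟩ := hval e (QShift.solC (QShift.qi ħ a a') e (QShift.qpow ħ (-1 / 4)))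
      exact ⟨φ, (hC n e hn he φ).2 ⟨_, Or.inl rfl, hφ⟩⟩
    · obtain ⟨φ, hφ⟩ := hval e (QShift.solA2 ħ (QShift.qi ħ a a') e)
      exact ⟨φ, (hA2 n e hn he φ).2 hφ⟩
    · obtain ⟨φ, hφ⟩ := hval e (QShift.solD2 ħ (QShift.qi ħ a a') e)
      exact ⟨φ, (hD2 n e hn he φ).2 hφ⟩
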